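/- Let $\alpha\in(0,1)$, $\Omega=(0,1)\times(0,1)\ni z=(\theta,r)$, $A=\mathrm{diag}(1,r^\alpha)$, $w=r^\alpha$, and let $H_0^1(\Omega;w)$ be the closure of $C_0^\infty(\Omega)$ with respect to the norm $\big(\int_\Omega (u^2+A\nabla u\cdot\nabla u)\,dz\big)^{1/2}$, with dual $H^{-1}(\Omega;w)$. Let $$\delta_0\in\left(0,\tfrac1{32}\right),\qquad 0<\beta<\tfrac12\min\left\{\tfrac18(2-\alpha)^2,\delta_0\right\},\qquad T>\max\left\{4\delta_0^{-1/2},\sqrt{8/\beta}\right\},$$ and $\omega=[(0,4\delta_0)\cup(1-4\delta_0,1)]\times(0,1)$. Then there is a constant $C>0$, depending only on $\delta_0,\alpha,\beta$ and $T$, such that the following holds for all $\varphi^0\in H_0^1(\Omega;w)$ and $\varphi^1\in L^2(\Omega)$. Let $$\varphi\in L^2(0,T;H_0^1(\Omega;w))\cap H^1(0,T;L^2(\Omega))\cap H^2(0,T;H^{-1}(\Omega;w))$$ be the weak solution of $\partial_{tt}\varphi-\mathrm{div}(A\nabla\varphi)=0$ in $\Omega\times(0,T)$, $\varphi=0$ on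 $\partial\Omega\times(0,T)$, $\varphi(0)=\varphi^0$, $\partial_t\varphi(0)=\varphi^1$; that is, for each $v\in H_0^1(\Omega;w)$ and a.e. $t\in(0,T)$, $\langle\partial_{tt}\varphi,v\rangle+\int_\Omega A\nabla\varphi\cdot\nabla v\,dz=0$, together with the initial conditions. Then the normal derivative $\partial_r\varphi$ on the side $r=1$ exists in $L^2((0,1)\times(0,T))$, and $$E(0)\le C\int_0^T\!\!\int_{\delta_0}^{1-\delta_0}(\partial_r\varphi)^2(\theta,1,t)\,d\theta\,dt+C\int_0^T\!\!\int_\omega\left[(\partial_t\varphi)^2+A\nabla\varphi\cdot\nabla\varphi+\varphi^2\right]dz\,dt,$$ where $E(0)=\frac12\int_\Omega\left[(\varphi^1)^2+A\nabla\varphi^0\cdot\nabla\varphi^0\right]dz$. Here the trace of $\partial_r\varphi$ on $r=1$ is the (unique) function $g\in L^2((0,1)\times(0,T))$ of $(\theta,t)$ such that $$\int_0^T\!\!\int_0^1 g(\theta,t)\,\chi(\theta,1,t)\,d\theta\,dt=\int_0^T\!\!\int_\Omega\left(-\partial_t\varphi\,\partial_t\chi+A\nabla\varphi\cdot\nabla\chi\right)dz\,dt$$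 for all $\chi\in C_0^\infty\big((0,1)\times(0,\infty)\times(0,T)\big)$. -/

import Mathlib

open MeasureTheory Set
open scoped ContDiff

noncomputable section

namespace DegenerateWave

/-- The unit square `Ω = (0,1) × (0,1)`; points are `z = (θ, r)`, so `z.1 = θ` and `z.2 = r`. -/
def Dom : Set (ℝ × ℝ) := Ioo 0 1 ×ˢ Ioo 0 1

/-- The real Hilbert space `L²(Ω)`. -/
abbrev L2Dom : Type := Lp ℝ 2 (volume.restrict Dom)

/-- `L²(Ω)³` with its Hilbert norm. A function `u` of finite `H¹(Ω; w)` norm, `w = r ^ α`, is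
represented in it by the triple `(u, ∂_θ u, r ^ (α / 2) ∂_r u)`, whose squared norm is
`∫ u² + (∂_θ u)² + r ^ α (∂_r u)²`, that is, the squared `H¹(Ω; w)` norm of `u`. -/
abbrev GraphSpace : Type := PiLp 2 (fun _ : Fin 3 => L2Dom)

/-- Elements of `C₀^∞(S)`. -/
structure IsTestFunction {E : Type*} [NormedAddCommGroup E] [NormedSpace ℝ E]
    (S : Set E) (u : E → ℝ) : Prop where
  contDiff : ContDiff ℝ ∞ u
  hasCompactSupport : HasCompactSupport u
  tsupport_subset : tsupport u ⊆ S

/-- The triples `(u, ∂_θ u, r ^ (α / 2) ∂_r u)` of the functions `u ∈ C₀^∞(Ω)`. They already form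
a linear subspace of `L²(Ω)³`. -/
def testGraph (α : ℝ) : Set GraphSpace :=
  {U | ∃ u : ℝ × ℝ → ℝ, IsTestFunction Dom u ∧
    (U 0 =ᵐ[volume.restrict Dom] u) ∧
    (U 1 =ᵐ[volume.restrict Dom] fun z => fderiv ℝ u z (1, 0)) ∧
    (U 2 =ᵐ[volume.restrict Dom] fun z => z.2 ^ (α / 2) * fderiv ℝ u z (0, 1))}

/-- The weighted Dirichlet space `H₀¹(Ω; w)`, the closure of `C₀^∞(Ω)` in the `H¹(Ω; w)` norm.
Each function of the space is identified with its triple `(u, ∂_θ u, r ^ (α / 2) ∂_r u)`; the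
relation between `u` and its weak gradient passes to limits, see `H01.weak_gradient`. -/
def H01 (α : ℝ) : Submodule ℝ GraphSpace :=
  (Submodule.span ℝ (testGraph α)).topologicalClosure

/-- The embedding `H₀¹(Ω; w) → L²(Ω)`, `u ↦ u`. -/
def H01.val (α : ℝ) : H01 α →L[ℝ] L2Dom :=
  (PiLp.proj 2 (fun _ : Fin 3 => L2Dom) 0).comp (H01 α).subtypeL

/-- `u ↦ ∂_θ u`. -/
def H01.dTheta (α : ℝ) : H01 α →L[ℝ] L2Dom :=
  (PiLp.proj 2 (fun _ : Fin 3 => L2Dom) 1).comp (H01 α).subtypeL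

/-- `u ↦ r ^ (α / 2) ∂_r u`. -/
def H01.wdR (α : ℝ) : H01 α →L[ℝ] L2Dom :=
  (PiLp.proj 2 (fun _ : Fin 3 => L2Dom) 2).comp (H01 α).subtypeL

theorem H01.weak_gradient_aux {α : ℝ} {h₀ h₁ : ℝ × ℝ → ℝ} {i : Fin 3}
    (hh₀ : MemLp h₀ 2 (volume.restrict Dom)) (hh₁ : MemLp h₁ 2 (volume.restrict Dom))
    (key : ∀ U ∈ testGraph α, ∫ z in Dom, U 0 z * h₀ z = -∫ z in Dom, U i z * h₁ z)
    (U : H01 α) :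
    ∫ z in Dom, (U : GraphSpace) 0 z * h₀ z = -∫ z in Dom, (U : GraphSpace) i z * h₁ z := by
  have hin : ∀ (f : L2Dom) (h : ℝ × ℝ → ℝ) (hh : MemLp h 2 (volume.restrict Dom)),
      inner ℝ (hh.toLp h) f = ∫ z in Dom, f z * h z := by
    intro f h hh
    rw [L2.inner_def]
    refine integral_congr_ae ?_
    filter_upwards [hh.coeFn_toLp] with z hz
    simp [hz]
  let L : GraphSpace →L[ℝ] ℝ :=
    (innerSL ℝ (hh₀.toLp h₀)).comp (PiLp.proj 2 (fun _ : Fin 3 => L2Dom) 0) +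
      (innerSL ℝ (hh₁.toLp h₁)).comp (PiLp.proj 2 (fun _ : Fin 3 => L2Dom) i)
  have hL : ∀ V : GraphSpace,
      L V = (∫ z in Dom, V 0 z * h₀ z) + ∫ z in Dom, V i z * h₁ z := by
    intro V
    rw [← hin _ _ hh₀, ← hin _ _ hh₁]
    rfl
  have hle : H01 α ≤ LinearMap.ker L.toLinearMap := by
    refine Submodule.topologicalClosure_minimal _ ?_ (ContinuousLinearMap.isClosed_ker L)
    refine Submodule.span_le.2 fun V hV => ?_
    have h1 : L V = 0 := by rw [hL, key V hV]; ring
    exact h1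
  have h2 : L (U : GraphSpace) = 0 := hle U.2
  rw [hL] at h2
  linarith

/-- For `u ∈ H₀¹(Ω; w)` the second and third components of its triple are `∂_θ u` and
`r ^ (α / 2) ∂_r u` in the sense of weak derivatives in `Ω`. -/
theorem H01.weak_gradient {α : ℝ} (u : H01 α) {χ : ℝ × ℝ → ℝ} (hχ : IsTestFunction Dom χ) :
    (∫ z in Dom, H01.val α u z * fderiv ℝ χ z (1, 0) = -∫ z in Dom, H01.dTheta α u z * χ z) ∧
    (∫ z in Dom, H01.val α u z * fderiv ℝ χ z (0, 1) =
      -∫ z in Dom, H01.wdR α u z * (z.2 ^ (-(α / 2)) * χ z)) := by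
  have hc : ∀ {ψ : ℝ × ℝ → ℝ}, IsTestFunction Dom ψ → ∀ v : ℝ × ℝ,
      Continuous fun z => fderiv ℝ ψ z v := fun hψ v =>
    (hψ.contDiff.continuous_fderiv (by simp)).clm_apply continuous_const
  have hs : ∀ {ψ : ℝ × ℝ → ℝ}, IsTestFunction Dom ψ → ∀ v : ℝ × ℝ,
      HasCompactSupport fun z => fderiv ℝ ψ z v := fun hψ v =>
    hψ.hasCompactSupport.fderiv_apply ℝ v
  have hw : Continuous fun z : ℝ × ℝ => z.2 ^ (-(α / 2)) * χ z := by
    refine continuous_iff_continuousAt.2 fun z => ?_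
    by_cases hz : z ∈ tsupport χ
    · have hz2 : z.2 ≠ 0 := (hχ.tsupport_subset hz).2.1.ne'
      exact (continuousAt_snd.rpow_const (Or.inl hz2)).mul hχ.contDiff.continuous.continuousAt
    · have h0 : (fun z : ℝ × ℝ => z.2 ^ (-(α / 2)) * χ z) =ᶠ[nhds z] fun _ => 0 := by
        filter_upwards [notMem_tsupport_iff_eventuallyEq.1 hz] with y hy
        simp [hy]
      exact continuousAt_const.congr h0.symm
  have hws : HasCompactSupport fun z : ℝ × ℝ => z.2 ^ (-(α / 2)) * χ z :=
    hχ.hasCompactSupport.mul_left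
  have ibp : ∀ {ψ : ℝ × ℝ → ℝ}, IsTestFunction Dom ψ → ∀ v : ℝ × ℝ,
      ∫ z in Dom, ψ z * fderiv ℝ χ z v = -∫ z in Dom, fderiv ℝ ψ z v * χ z := by
    intro ψ hψ v
    have hψ0 : ∀ z, z ∉ Dom → χ z = 0 := fun z hz =>
      image_eq_zero_of_notMem_tsupport fun h => hz (hχ.tsupport_subset h)
    have hψ1 : ∀ z, z ∉ Dom → ψ z = 0 := fun z hz =>
      image_eq_zero_of_notMem_tsupport fun h => hz (hψ.tsupport_subset h)
    rw [setIntegral_eq_integral_of_forall_compl_eq_zero fun z hz => by simp [hψ1 z hz],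
      setIntegral_eq_integral_of_forall_compl_eq_zero fun z hz => by simp [hψ0 z hz]]
    refine integral_mul_fderiv_eq_neg_fderiv_mul_of_integrable ?_ ?_ ?_ ?_ ?_
    · exact ((hc hψ v).mul hχ.contDiff.continuous).integrable_of_hasCompactSupport
        (hs hψ v).mul_right
    · exact (hψ.contDiff.continuous.mul (hc hχ v)).integrable_of_hasCompactSupport
        (hs hχ v).mul_left
    · exact (hψ.contDiff.continuous.mul hχ.contDiff.continuous).integrable_of_hasCompactSupport
        hχ.hasCompactSupport.mul_left
    · exact fun x _ => (hψ.contDiff.differentiable (by simp)).differentiableAt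
    · exact fun x _ => (hχ.contDiff.differentiable (by simp)).differentiableAt
  have hm : MeasurableSet Dom := measurableSet_Ioo.prod measurableSet_Ioo
  refine ⟨H01.weak_gradient_aux (i := 1)
    ((hc hχ _).memLp_of_hasCompactSupport (hs hχ _))
    (hχ.contDiff.continuous.memLp_of_hasCompactSupport hχ.hasCompactSupport) ?_ u,
    H01.weak_gradient_aux (i := 2)
    ((hc hχ _).memLp_of_hasCompactSupport (hs hχ _))
    (hw.memLp_of_hasCompactSupport hws) ?_ u⟩
  · rintro U ⟨ψ, hψ, h0, h1, h2⟩
    rw [integral_congr_ae (g := fun z => ψ z * fderiv ℝ χ z (1, 0)) (by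
        filter_upwards [h0] with z hz; simp only [hz]), ibp hψ]
    congr 1
    refine integral_congr_ae ?_
    filter_upwards [h1] with z hz
    rw [hz]
  · rintro U ⟨ψ, hψ, h0, h1, h2⟩
    rw [integral_congr_ae (g := fun z => ψ z * fderiv ℝ χ z (0, 1)) (by
        filter_upwards [h0] with z hz; simp only [hz]), ibp hψ]
    congr 1
    refine integral_congr_ae ?_
    filter_upwards [h2, ae_restrict_mem hm] with z hz hzD
    have hz2 : (0 : ℝ) < z.2 := hzD.2.1
    rw [hz, Real.rpow_neg hz2.le]
    have : z.2 ^ (α / 2) ≠ 0 := (Real.rpow_pos_of_pos hz2 _).ne'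
    field_simp

/-- The form `∫_Ω A∇u · ∇v = ∫_Ω (∂_θ u ∂_θ v + r ^ α ∂_r u ∂_r v)`, `A = diag(1, r ^ α)`. -/
def aForm {α : ℝ} (u v : H01 α) : ℝ :=
  ∫ z in Dom, (H01.dTheta α u z * H01.dTheta α v z + H01.wdR α u z * H01.wdR α v z)

/-- `H⁻¹(Ω; w)`, the dual of `H₀¹(Ω; w)`. -/
abbrev Hneg1 (α : ℝ) : Type := H01 α →L[ℝ] ℝ

/-- The embedding `L²(Ω) → H⁻¹(Ω; w)`, `g ↦ (v ↦ ∫_Ω g v)`. -/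
def toHneg1 (α : ℝ) (g : L2Dom) : Hneg1 α := (innerSL ℝ g).comp (H01.val α)

/-- `u'` is the weak derivative of `u` on `(0, T)`, for functions with values in `X`. -/
def HasWeakTimeDeriv {X : Type*} [NormedAddCommGroup X] [NormedSpace ℝ X] (T : ℝ)
    (u u' : ℝ → X) : Prop :=
  ∀ χ : ℝ → ℝ, IsTestFunction (Ioo 0 T) χ →
    ∫ t in Ioo 0 T, deriv χ t • u t = -∫ t in Ioo 0 T, χ t • u' t

/-- `u(0) = x` for the continuous representative of `u` on `[0, T]`. -/
def HasInitialValue {X : Type*} [NormedAddCommGroup X] (T : ℝ) (u : ℝ → X) (x : X) : Prop :=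
  ∃ v : ℝ → X, ContinuousOn v (Icc 0 T) ∧ v =ᵐ[volume.restrict (Ioo 0 T)] u ∧ v 0 = x

/-- `φ ∈ L²(0,T; H₀¹(Ω;w)) ∩ H¹(0,T; L²(Ω)) ∩ H²(0,T; H⁻¹(Ω;w))`, with time derivatives
`φt = ∂_t φ` and `φtt = ∂_tt φ`, is a weak solution of `∂_tt φ - div(A∇φ) = f` in `Ω × (0,T)`,
`φ = 0` on the lateral boundary, `φ(0) = φ0`, `∂_t φ(0) = φ1`. -/
structure IsWeakSolution (α T : ℝ) (φ0 : H01 α) (φ1 : L2Dom) (f : ℝ → L2Dom)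
    (φ : ℝ → H01 α) (φt : ℝ → L2Dom) (φtt : ℝ → Hneg1 α) : Prop where
  memLp : MemLp φ 2 (volume.restrict (Ioo 0 T))
  memLp_dt : MemLp φt 2 (volume.restrict (Ioo 0 T))
  memLp_dtt : MemLp φtt 2 (volume.restrict (Ioo 0 T))
  weak_dt : HasWeakTimeDeriv T (fun t => H01.val α (φ t)) φt
  weak_dtt : HasWeakTimeDeriv T (fun t => toHneg1 α (φt t)) φtt
  equation : ∀ v : H01 α, ∀ᵐ t ∂(volume.restrict (Ioo 0 T)),
    φtt t v + aForm (φ t) v = ∫ z in Dom, f t z * H01.val α v z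
  initial : HasInitialValue T (fun t => H01.val α (φ t)) (H01.val α φ0)
  initial_dt : HasInitialValue T (fun t => toHneg1 α (φt t)) (toHneg1 α φ1)

/-- `g ∈ L²((0,1) × (0,T))`, a function of `(θ, t)`, is the trace of `∂_r φ` on the side `r = 1`
of `∂Ω`. For finite-energy solutions this trace is understood through Green's formula
`∫∫_{r = 1} ∂_r φ χ = ∫∫_{Ω × (0,T)} (-∂_t φ ∂_t χ + A∇φ · ∇χ - f χ)`
for all smooth `χ((θ, r), t)` that vanish near the sides `θ = 0`, `θ = 1`, `r = 0` and near
`t = 0`, `t = T`, but not necessarily at `r = 1` (where the conormal derivative `A∇φ · ν` is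
`∂_r φ`). At most one `g` has this property, up to null sets. -/
structure IsNormalTrace (α T : ℝ) (f : ℝ → L2Dom) (φ : ℝ → H01 α) (φt : ℝ → L2Dom)
    (g : ℝ × ℝ → ℝ) : Prop where
  memLp : MemLp g 2 (volume.restrict (Ioo 0 1 ×ˢ Ioo 0 T))
  green : ∀ χ : (ℝ × ℝ) × ℝ → ℝ,
    IsTestFunction ((Ioo 0 1 ×ˢ Ioi 0) ×ˢ Ioo 0 T) χ →
    ∫ p in Ioo (0 : ℝ) 1 ×ˢ Ioo 0 T, g p * χ ((p.1, 1), p.2) =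
      ∫ t in Ioo 0 T, ∫ z in Dom,
        (-(φt t z * fderiv ℝ χ (z, t) ((0, 0), 1))
          + H01.dTheta α (φ t) z * fderiv ℝ χ (z, t) ((1, 0), 0)
          + z.2 ^ (α / 2) * H01.wdR α (φ t) z * fderiv ℝ χ (z, t) ((0, 1), 0)
          - f t z * χ (z, t))

/-- The energy `(1/2) ∫_Ω (v² + A∇u · ∇u)` of a state `u`, `∂_t u = v`. -/
def energy {α : ℝ} (u : H01 α) (v : L2Dom) : ℝ :=
  (1 / 2) * ∫ z in Dom, (v z ^ 2 + (H01.dTheta α u z ^ 2 + H01.wdR α u z ^ 2))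

/-- The strip `ω = ((0, 4δ) ∪ (1 - 4δ, 1)) × (0,1)` near the sides `θ = 0` and `θ = 1`. -/
def strip (δ : ℝ) : Set (ℝ × ℝ) := (Ioo 0 (4 * δ) ∪ Ioo (1 - 4 * δ) 1) ×ˢ Ioo 0 1

/-- `∫∫_{ω × (0,T)} ((∂_t φ)² + A∇φ · ∇φ + φ²)`. -/
def interiorTerm {α : ℝ} (δ T : ℝ) (φ : ℝ → H01 α) (φt : ℝ → L2Dom) : ℝ :=
  ∫ t in Ioo 0 T, ∫ z in strip δ,
    (φt t z ^ 2 + (H01.dTheta α (φ t) z ^ 2 + H01.wdR α (φ t) z ^ 2) + H01.val α (φ t) z ^ 2)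

end DegenerateWave

end

open DegenerateWave

open MeasureTheory Set
open scoped ContDiff

noncomputable section

namespace DegenerateWave

/-! ### Weak derivatives on an interval -/

/-! The argument is the multiplier method, carried out on finite sums of eigenfunctions and then
passed to the limit, so that the degeneracy at r = 0 never has to be handled for a general weak
solution.

Since A = diag(1, r^α) separates the variables, -div(A∇) has product eigenfunctions E = s(θ) e(r),
where s is a Dirichlet eigenfunction of -d²/dθ² and e one of -(r^α e')'. Both factors belong to the
family -(r^a u')', with a = 0 and a = α. Its explicit Green function defines a compact, symmetric,
injective operator on L²(0,1), which yields a Hilbert basis (`exists_mode_basis`). The products lie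
in H₀¹(Ω; w) and form orthogonal bases of both L²(Ω) and H₀¹(Ω; w) (`exists_modeSystem`,
`ModeSystem.basisL2`, `ModeSystem.basisH01`). Testing the weak equation with E turns each
coefficient into a harmonic oscillator with the prescribed initial data
(`ae_eq_harmonic_oscillator`). Each mode conserves its energy, so the partial sums approximate the
solution uniformly in almost every t, with error bounded by the tail of the energy series
(`ModeSystem.norm_sub_partialSol_le`).

For a finite sum φ, differentiate ∫ ∂_tφ (A ∂_θφ + b r ∂_rφ + (c/2) φ) in time, where A and b are
now functions of θ. The result is half of ∫ b (∂_rφ)² over r = 1 minus half of a quadratic form in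
∂_tφ and ∇φ (`ModeSystem.hasDerivAt_multForm`). This rests on two polarised identities for pairs of
modes, `ModeSystem.mult_add` and `ModeSystem.eig_mult_add`, obtained by multiplying one-dimensional
integrations by parts. The identity is used twice. With A = 0, b = 1, c = 0 it bounds the L² norm of
the normal derivative by the energy (`ModeSystem.integral_partialTrace_sq_le`). With A = η(θ)(θ -
1/2), b = η(θ), c = 1 + α/2, where η is a cutoff equal to 1 off the strip ω, the coefficients of
(∂_tφ)², (∂_θφ)² and r^α(∂_rφ)² off ω are 1 - α/2, 1 + α/2 and 1 - α/2, all at least 1/2. What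
happens on ω is absorbed by the interior term. With S twice the energy, the endpoint terms cost at
most 4S and the time integral gains TS/2, so T ≥ 10 suffices
(`ModeSystem.observability_partialSol`); the assumed lower bound on T in terms of δ₀ guarantees
this.

In the limit, the trace bound makes the normal derivatives of the partial sums converge in L²,
Green's formula identifies the limit as the trace (`ModeSystem.isNormalTrace_of_tendsto`), the trace
is unique (`IsNormalTrace.ae_eq`), and the inequality survives (`ModeSystem.exists_observability`).
-/

theorem IsTestFunction.eq_zero {E : Type*} [NormedAddCommGroup E] [NormedSpace ℝ E] {S : Set E}
    {u : E → ℝ} (hu : IsTestFunction S u) {x : E} (hx : x ∉ S) : u x = 0 :=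
  image_eq_zero_of_notMem_tsupport fun h => hx (hu.tsupport_subset h)

theorem IsTestFunction.continuous {E : Type*} [NormedAddCommGroup E] [NormedSpace ℝ E] {S : Set E}
    {u : E → ℝ} (hu : IsTestFunction S u) : Continuous u := hu.contDiff.continuous

theorem IsTestFunction.add {E : Type*} [NormedAddCommGroup E] [NormedSpace ℝ E] {S : Set E}
    {u v : E → ℝ} (hu : IsTestFunction S u) (hv : IsTestFunction S v) :
    IsTestFunction S (fun x => u x + v x) :=
  ⟨hu.contDiff.add hv.contDiff, hu.hasCompactSupport.add hv.hasCompactSupport,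
    (tsupport_add u v).trans (union_subset hu.tsupport_subset hv.tsupport_subset)⟩

theorem IsTestFunction.mul_left {E : Type*} [NormedAddCommGroup E] [NormedSpace ℝ E] {S : Set E}
    {u v : E → ℝ} (hu : IsTestFunction S u) (hv : ContDiff ℝ ∞ v) :
    IsTestFunction S (fun x => v x * u x) :=
  ⟨hv.mul hu.contDiff, hu.hasCompactSupport.mul_left,
    (closure_mono (Function.support_mul_subset_right v u)).trans hu.tsupport_subset⟩

theorem IsTestFunction.deriv {S : Set ℝ} {u : ℝ → ℝ} (hu : IsTestFunction S u) :
    IsTestFunction S (deriv u) :=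
  ⟨(contDiff_infty_iff_deriv.1 hu.contDiff).2, hu.hasCompactSupport.deriv,
    (closure_minimal (support_deriv_subset) (isClosed_tsupport u)).trans hu.tsupport_subset⟩

theorem IsTestFunction.hasDerivAt {S : Set ℝ} {u : ℝ → ℝ} (hu : IsTestFunction S u) (x : ℝ) :
    HasDerivAt u (_root_.deriv u x) x :=
  ((hu.contDiff.differentiable (by simp)) x).hasDerivAt

theorem IsTestFunction.integrableOn_mul {T : ℝ} {u f : ℝ → ℝ} (hu : IsTestFunction (Ioo 0 T) u)
    (hf : IntegrableOn f (Ioo 0 T)) : IntegrableOn (fun x => u x * f x) (Ioo 0 T) := by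
  obtain ⟨C, hC⟩ := hu.continuous.bounded_above_of_compact_support hu.hasCompactSupport
  exact hf.bdd_mul hu.continuous.aestronglyMeasurable (Filter.Eventually.of_forall hC)

/-- A compact subset of `(0,T)` is contained in a compact subinterval. -/
theorem exists_Icc_of_isCompact {T : ℝ} (hT : 0 < T) {K : Set ℝ} (hK : IsCompact K)
    (hKT : K ⊆ Ioo 0 T) : ∃ a b, 0 < a ∧ a ≤ b ∧ b < T ∧ K ⊆ Icc a b := by
  -- Adding the midpoint makes the compact set nonempty, so a least and a greatest element exist
  -- even when K is empty.
  have hK' : IsCompact (insert (T / 2) K) := hK.insert _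
  have hsub : insert (T / 2) K ⊆ Ioo 0 T := insert_subset ⟨by linarith, by linarith⟩ hKT
  obtain ⟨a, ha, ha'⟩ := hK'.exists_isLeast (insert_nonempty _ _)
  obtain ⟨b, hb, hb'⟩ := hK'.exists_isGreatest (insert_nonempty _ _)
  exact ⟨a, b, (hsub ha).1, ha' hb, (hsub hb).2,
    fun x hx => ⟨ha' (mem_insert_of_mem _ hx), hb' (mem_insert_of_mem _ hx)⟩⟩

theorem IsTestFunction.exists_Icc {T : ℝ} (hT : 0 < T) {u : ℝ → ℝ}
    (hu : IsTestFunction (Ioo 0 T) u) :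
    ∃ a b, 0 < a ∧ a ≤ b ∧ b < T ∧ ∀ x, x ∉ Icc a b → u x = 0 := by
  obtain ⟨a, b, ha, hab, hb, h⟩ := exists_Icc_of_isCompact hT hu.hasCompactSupport
    hu.tsupport_subset
  exact ⟨a, b, ha, hab, hb, fun x hx => image_eq_zero_of_notMem_tsupport fun h' => hx (h h')⟩

theorem integral_Ioo_eq_interval {E : Type*} [NormedAddCommGroup E] [NormedSpace ℝ E] {T : ℝ}
    (hT : 0 ≤ T) (f : ℝ → E) : ∫ x in Ioo 0 T, f x = ∫ x in (0 : ℝ)..T, f x := by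
  rw [intervalIntegral.integral_of_le hT, integral_Ioc_eq_integral_Ioo]

/-- A test function on `(0,T)` of mean zero is the derivative of a test function. -/
theorem IsTestFunction.exists_primitive {T : ℝ} (hT : 0 < T) {χ : ℝ → ℝ}
    (hχ : IsTestFunction (Ioo 0 T) χ) (h0 : ∫ x in Ioo 0 T, χ x = 0) :
    ∃ ψ, IsTestFunction (Ioo 0 T) ψ ∧ ∀ x, _root_.deriv ψ x = χ x := by
  obtain ⟨a, b, ha, hab, hb, hz⟩ := hχ.exists_Icc hT
  have hder : ∀ x, HasDerivAt (fun x => ∫ t in (0 : ℝ)..x, χ t) (χ x) x := fun x =>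
    intervalIntegral.integral_hasDerivAt_right (hχ.continuous.intervalIntegrable _ _)
      hχ.continuous.stronglyMeasurable.stronglyMeasurableAtFilter hχ.continuous.continuousAt
  have hd : _root_.deriv (fun x => ∫ t in (0 : ℝ)..x, χ t) = χ := funext fun x => (hder x).deriv
  -- To the left of a the primitive integrates zero; to the right of b it equals the full integral
  -- of χ, which vanishes. This is the only use of the mean-zero condition.
  have hsupp : Function.support (fun x => ∫ t in (0 : ℝ)..x, χ t) ⊆ Icc a b := by
    intro x hx
    by_contra hx'
    apply hx
    rcases lt_or_ge x a with h | h
    · refine intervalIntegral.integral_zero_ae (Filter.Eventually.of_forall fun t ht => hz t ?_)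
      intro ht'
      have := ht.2
      rcases le_max_iff.1 ht.2 with h2 | h2
      · linarith [ht'.1]
      · linarith [ht'.1]
    · have hbx : b < x := by
        by_contra h3
        exact hx' ⟨h, not_lt.1 h3⟩
      have h1 : ∫ t in (0 : ℝ)..b, χ t = 0 := by
        rw [integral_Ioo_eq_interval hT.le, ← intervalIntegral.integral_add_adjacent_intervals
          (hχ.continuous.intervalIntegrable 0 b) (hχ.continuous.intervalIntegrable b T)] at h0
        have h2 : ∫ t in b..T, χ t = 0 := by
          refine intervalIntegral.integral_zero_ae (Filter.Eventually.of_forall fun t ht => hz t ?_)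
          intro ht'
          rw [uIoc_of_le hb.le] at ht
          linarith [ht'.2, ht.1]
        linarith
      have h2 : ∫ t in b..x, χ t = 0 := by
        refine intervalIntegral.integral_zero_ae (Filter.Eventually.of_forall fun t ht => hz t ?_)
        intro ht'
        rw [uIoc_of_le hbx.le] at ht
        linarith [ht'.2, ht.1]
      show ∫ t in (0 : ℝ)..x, χ t = 0
      rw [← intervalIntegral.integral_add_adjacent_intervals
          (hχ.continuous.intervalIntegrable 0 b) (hχ.continuous.intervalIntegrable b x), h1, h2,
        add_zero]
  have hts : tsupport (fun x => ∫ t in (0 : ℝ)..x, χ t) ⊆ Icc a b :=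
    closure_minimal hsupp isClosed_Icc
  refine ⟨fun x => ∫ t in (0 : ℝ)..x, χ t, ⟨?_, ?_, ?_⟩, fun x => (hder x).deriv⟩
  · rw [contDiff_infty_iff_deriv, hd]
    exact ⟨fun x => (hder x).differentiableAt, hχ.contDiff⟩
  · exact isCompact_Icc.of_isClosed_subset (isClosed_tsupport _) hts
  · exact hts.trans (Icc_subset_Ioo ha hb)

theorem exists_testFunction_integral_eq_one {T : ℝ} (hT : 0 < T) :
    ∃ ρ : ℝ → ℝ, IsTestFunction (Ioo 0 T) ρ ∧ ∫ x in Ioo 0 T, ρ x = 1 := by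
  let f : ContDiffBump (T / 2) := ⟨T / 8, T / 4, by linarith, by linarith⟩
  have hts : tsupport (f.normed volume) ⊆ Ioo 0 T := by
    rw [f.tsupport_normed_eq, Real.closedBall_eq_Icc]
    refine Icc_subset_Ioo ?_ ?_
    · show 0 < T / 2 - T / 4
      linarith
    · show T / 2 + T / 4 < T
      linarith
  refine ⟨f.normed volume, ⟨f.contDiff_normed, f.hasCompactSupport_normed, hts⟩, ?_⟩
  rw [setIntegral_eq_integral_of_forall_compl_eq_zero, f.integral_normed]
  exact fun x hx => image_eq_zero_of_notMem_tsupport fun h => hx (hts h)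

/-- **du Bois-Reymond lemma**: a function with vanishing weak derivative is constant. -/
theorem ae_const_of_integral_deriv_mul_eq_zero {T : ℝ} (hT : 0 < T) {f : ℝ → ℝ}
    (hf : IntegrableOn f (Ioo 0 T))
    (h : ∀ χ : ℝ → ℝ, IsTestFunction (Ioo 0 T) χ → ∫ x in Ioo 0 T, deriv χ x * f x = 0) :
    ∃ C : ℝ, ∀ᵐ x ∂volume.restrict (Ioo 0 T), f x = C := by
  obtain ⟨ρ, hρ, hρ1⟩ := exists_testFunction_integral_eq_one hT
  -- A constant function equals its own average against ρ, which forces this choice of C.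
  set C : ℝ := ∫ x in Ioo 0 T, ρ x * f x with hC
  refine ⟨C, ?_⟩
  have hfC : IntegrableOn (fun x => f x - C) (Ioo 0 T) :=
    hf.sub (integrableOn_const (by simp))
  have key := isOpen_Ioo.ae_eq_zero_of_integral_contDiff_smul_eq_zero
    (μ := volume.restrict (Ioo 0 T)) (U := Ioo 0 T) (f := fun x => f x - C)
    (by
      have : Integrable (fun x => f x - C) (volume.restrict (Ioo 0 T)) := hfC
      exact this.locallyIntegrable.locallyIntegrableOn _) ?_
  · filter_upwards [key, ae_restrict_mem measurableSet_Ioo] with x hx hx'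
    linarith [hx hx']
  · intro χ h1 h2 h3
    have hχ : IsTestFunction (Ioo 0 T) χ := ⟨h1, h2, h3⟩
    set m : ℝ := ∫ x in Ioo 0 T, χ x with hm
    have hχi : IntegrableOn χ (Ioo 0 T) :=
      (hχ.continuous.integrable_of_hasCompactSupport h2).integrableOn
    have hρi : IntegrableOn ρ (Ioo 0 T) :=
      (hρ.continuous.integrable_of_hasCompactSupport hρ.hasCompactSupport).integrableOn
    -- Subtracting m ρ removes the mean of χ, so the difference is the derivative of a test function
    -- and the hypothesis applies to it.
    have hχ' : IsTestFunction (Ioo 0 T) (fun x => χ x + (-m) * ρ x) :=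
      hχ.add (hρ.mul_left contDiff_const)
    obtain ⟨ψ, hψ, hd⟩ := hχ'.exists_primitive hT (by
      rw [integral_add hχi (hρi.const_mul _), integral_const_mul, hρ1, ← hm]; ring)
    have h4 := h ψ hψ
    simp only [hd, add_mul, mul_assoc] at h4
    rw [integral_add (hχ.integrableOn_mul hf) ((hρ.integrableOn_mul hf).const_mul _),
      integral_const_mul, ← hC] at h4
    simp only [smul_eq_mul, mul_sub]
    rw [integral_sub (hχ.integrableOn_mul hf) (hχi.mul_const _), integral_mul_const, ← hm]
    linarith

/-- The weak harmonic oscillator `c' = c₁`, `c₁' = -ν² c` on `(0,T)`, with initial values taken by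
continuous representatives, has only the classical solution. -/
theorem ae_eq_harmonic_oscillator {T ν A B : ℝ} (hT : 0 < T) (hν : 0 < ν) {c c₁ v v₁ : ℝ → ℝ}
    (hc : IntegrableOn c (Ioo 0 T)) (hc₁ : IntegrableOn c₁ (Ioo 0 T))
    (h : ∀ χ : ℝ → ℝ, IsTestFunction (Ioo 0 T) χ →
      ∫ x in Ioo 0 T, deriv χ x * c x = -∫ x in Ioo 0 T, χ x * c₁ x)
    (h₁ : ∀ χ : ℝ → ℝ, IsTestFunction (Ioo 0 T) χ →
      ∫ x in Ioo 0 T, deriv χ x * c₁ x = ν ^ 2 * ∫ x in Ioo 0 T, χ x * c x)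
    (hv : ContinuousOn v (Icc 0 T)) (hvc : v =ᵐ[volume.restrict (Ioo 0 T)] c) (hv0 : v 0 = A)
    (hv₁ : ContinuousOn v₁ (Icc 0 T)) (hvc₁ : v₁ =ᵐ[volume.restrict (Ioo 0 T)] c₁)
    (hv₁0 : v₁ 0 = B) :
    ∀ᵐ t ∂volume.restrict (Ioo 0 T),
      c t = A * Real.cos (ν * t) + B / ν * Real.sin (ν * t) ∧
      c₁ t = -(A * ν) * Real.sin (ν * t) + B * Real.cos (ν * t) := by
  have hcos : ContDiff ℝ ∞ fun t => Real.cos (ν * t) :=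
    Real.contDiff_cos.comp (contDiff_const.mul contDiff_id)
  have hsin : ContDiff ℝ ∞ fun t => Real.sin (ν * t) :=
    Real.contDiff_sin.comp (contDiff_const.mul contDiff_id)
  have dcos : ∀ t, HasDerivAt (fun t => Real.cos (ν * t)) (-ν * Real.sin (ν * t)) t := fun t => by
    have := (Real.hasDerivAt_cos (ν * t)).comp t ((hasDerivAt_id t).const_mul ν)
    refine this.congr_deriv (by simp; ring)
  have dsin : ∀ t, HasDerivAt (fun t => Real.sin (ν * t)) (ν * Real.cos (ν * t)) t := fun t => by
    have := (Real.hasDerivAt_sin (ν * t)).comp t ((hasDerivAt_id t).const_mul ν)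
    refine this.congr_deriv (by simp; ring)
  have imul : ∀ {f g : ℝ → ℝ}, IntegrableOn f (Ioo 0 T) → ContDiff ℝ ∞ g → (∀ t, |g t| ≤ 1) →
      IntegrableOn (fun t => g t * f t) (Ioo 0 T) := fun hf hg hb =>
    hf.bdd_mul hg.continuous.aestronglyMeasurable (Filter.Eventually.of_forall hb)
  have hc1 : ∀ t, |Real.cos (ν * t)| ≤ 1 := fun t => Real.abs_cos_le_one _
  have hs1 : ∀ t, |Real.sin (ν * t)| ≤ 1 := fun t => Real.abs_sin_le_one _
  -- The product rule for a weak derivative: the smooth factor g is moved onto the test function,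
  -- since g χ is again a test function.
  have prod : ∀ {χ g g' f : ℝ → ℝ} {k : ℝ}, IsTestFunction (Ioo 0 T) χ → ContDiff ℝ ∞ g →
      ContDiff ℝ ∞ g' → (∀ t, HasDerivAt g (k * g' t) t) →
      IntegrableOn f (Ioo 0 T) →
      ∫ t in Ioo 0 T, deriv χ t * (g t * f t) =
        (∫ t in Ioo 0 T, deriv (fun t => g t * χ t) t * f t) -
          k * ∫ t in Ioo 0 T, (g' t * χ t) * f t := by
    intro χ g g' f k hχ hg hg' hd hf
    rw [← integral_const_mul, ← integral_sub ((hχ.mul_left hg).deriv.integrableOn_mul hf)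
      (((hχ.mul_left hg').integrableOn_mul hf).const_mul _)]
    congr 1
    ext t
    rw [((hd t).fun_mul (hχ.hasDerivAt t)).deriv]
    ring
  -- A continuous representative that is almost everywhere constant is constant up to t = 0, which
  -- ties the constant to the initial value.
  have hconst : ∀ {f w : ℝ → ℝ} {C : ℝ}, (∀ᵐ t ∂volume.restrict (Ioo 0 T), f t = C) →
      ContinuousOn w (Icc 0 T) → w =ᵐ[volume.restrict (Ioo 0 T)] f → C = w 0 := by
    intro f w C hf hw hwf
    have h1 : w =ᵐ[volume.restrict (Icc 0 T)] fun _ => C := by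
      rw [← restrict_Ioo_eq_restrict_Icc]
      exact hwf.trans hf
    exact (Measure.eqOn_Icc_of_ae_eq volume hT.ne h1 hw continuousOn_const
      ⟨le_rfl, hT.le⟩).symm
  -- Rotating the phase plane by the angle ν t freezes the flow: this combination and the next one
  -- are the two first integrals, so their weak derivatives vanish.
  obtain ⟨C, hC⟩ := ae_const_of_integral_deriv_mul_eq_zero hT
    (f := fun t => Real.cos (ν * t) * c t + (-1 / ν) * (Real.sin (ν * t) * c₁ t))
    ((imul hc hcos hc1).add ((imul hc₁ hsin hs1).const_mul _)) (by
      intro χ hχ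
      have e : ∀ t, deriv χ t * (Real.cos (ν * t) * c t + (-1 / ν) * (Real.sin (ν * t) * c₁ t)) =
          deriv χ t * (Real.cos (ν * t) * c t) +
            (-1 / ν) * (deriv χ t * (Real.sin (ν * t) * c₁ t)) := fun t => by ring
      simp only [e]
      rw [integral_add (hχ.deriv.integrableOn_mul (imul hc hcos hc1))
        ((hχ.deriv.integrableOn_mul (imul hc₁ hsin hs1)).const_mul _), integral_const_mul,
        prod hχ hcos hsin dcos hc, prod hχ hsin hcos dsin hc₁, h _ (hχ.mul_left hcos),
        h₁ _ (hχ.mul_left hsin)]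
      field_simp
      ring)
  obtain ⟨C', hC'⟩ := ae_const_of_integral_deriv_mul_eq_zero hT
    (f := fun t => ν * (Real.sin (ν * t) * c t) + (Real.cos (ν * t) * c₁ t))
    (((imul hc hsin hs1).const_mul _).add (imul hc₁ hcos hc1)) (by
      intro χ hχ
      have e : ∀ t, deriv χ t * (ν * (Real.sin (ν * t) * c t) + (Real.cos (ν * t) * c₁ t)) =
          ν * (deriv χ t * (Real.sin (ν * t) * c t)) +
            (deriv χ t * (Real.cos (ν * t) * c₁ t)) := fun t => by ring
      simp only [e]
      rw [integral_add ((hχ.deriv.integrableOn_mul (imul hc hsin hs1)).const_mul _)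
        (hχ.deriv.integrableOn_mul (imul hc₁ hcos hc1)), integral_const_mul,
        prod hχ hsin hcos dsin hc, prod hχ hcos hsin dcos hc₁, h _ (hχ.mul_left hsin),
        h₁ _ (hχ.mul_left hcos)]
      ring)
  have hCA : C = A := by
    rw [hconst (w := fun t => Real.cos (ν * t) * v t + (-1 / ν) * (Real.sin (ν * t) * v₁ t)) hC
      ((hcos.continuous.continuousOn.mul hv).add
        (continuousOn_const.mul (hsin.continuous.continuousOn.mul hv₁)))
      (by filter_upwards [hvc, hvc₁] with t h1 h2; rw [h1, h2])]
    simp [hv0]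
  have hCB : C' = B := by
    rw [hconst (w := fun t => ν * (Real.sin (ν * t) * v t) + (Real.cos (ν * t) * v₁ t)) hC'
      ((continuousOn_const.mul (hsin.continuous.continuousOn.mul hv)).add
        (hcos.continuous.continuousOn.mul hv₁))
      (by filter_upwards [hvc, hvc₁] with t h1 h2; rw [h1, h2])]
    simp [hv₁0]
  filter_upwards [hC, hC'] with t h1 h2
  rw [hCA] at h1
  rw [hCB] at h2
  have hcs := Real.sin_sq_add_cos_sq (ν * t)
  have hνne := hν.ne'
  rw [← h1, ← h2]
  -- The rotation is inverted with sin² + cos² = 1.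
  constructor
  · field_simp
    linear_combination (-ν * c t) * hcs
  · field_simp
    linear_combination (-c₁ t) * hcs

/-! ### Compact integral operators on `L²(0,1)` -/

/-- The real Hilbert space `L²(0,1)`. -/
abbrev L2I : Type := Lp ℝ 2 (volume.restrict (Ioo (0 : ℝ) 1))

instance : IsProbabilityMeasure (volume.restrict (Ioo (0 : ℝ) 1)) :=
  ⟨by simp⟩

theorem memLp_Ioo_of_continuousOn {f : ℝ → ℝ} (hf : ContinuousOn f (Icc 0 1)) :
    MemLp f 2 (volume.restrict (Ioo (0 : ℝ) 1)) := by
  obtain ⟨C, hC⟩ := isCompact_Icc.exists_bound_of_continuousOn hf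
  refine MemLp.of_bound ((hf.mono Ioo_subset_Icc_self).aestronglyMeasurable measurableSet_Ioo) C ?_
  filter_upwards [ae_restrict_mem measurableSet_Ioo] with x hx
  exact hC x (Ioo_subset_Icc_self hx)

theorem L2I_inner_eq {f g : L2I} {f' g' : ℝ → ℝ} (hf : f =ᵐ[volume.restrict (Ioo 0 1)] f')
    (hg : g =ᵐ[volume.restrict (Ioo 0 1)] g') :
    inner ℝ f g = ∫ x in (0 : ℝ)..1, f' x * g' x := by
  rw [L2.inner_def, ← integral_Ioo_eq_interval zero_le_one]
  refine integral_congr_ae ?_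
  filter_upwards [hf, hg] with x h1 h2
  simp [h1, h2, mul_comm]

/-- The interval has measure one, so no factor appears between the sup and L² norms. -/
theorem L2I_norm_le {f : L2I} {C : ℝ} (hC : ∀ᵐ x ∂volume.restrict (Ioo (0 : ℝ) 1), ‖f x‖ ≤ C) :
    ‖f‖ ≤ C := by
  have hC0 : 0 ≤ C := by
    obtain ⟨x, hx⟩ := hC.exists
    exact (norm_nonneg _).trans hx
  have := Lp.norm_le_of_ae_bound (p := 2) hC0 hC
  simpa [measureUnivNNReal] using this

/-- The operator `f ↦ (r ↦ ⟨k r, f⟩)` on `L²(0,1)`. -/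
def sliceOp (k : ℝ → L2I) (hk : Continuous k) : L2I →L[ℝ] L2I :=
  LinearMap.mkContinuousOfExistsBound
    { toFun := fun f => (memLp_Ioo_of_continuousOn
        (f := fun r => inner ℝ (k r) f) (hk.inner continuous_const).continuousOn).toLp
      map_add' := fun f g => by
        rw [← MemLp.toLp_add]
        congr 1
        ext r
        simp [inner_add_right]
      map_smul' := fun c f => by
        rw [RingHom.id_apply, ← MemLp.toLp_const_smul]
        congr 1
        ext r
        simp [inner_smul_right] }
    (by
      obtain ⟨C, hC⟩ := isCompact_Icc.exists_bound_of_continuousOn (s := Icc (0 : ℝ) 1)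
        hk.continuousOn
      refine ⟨C, fun f => L2I_norm_le ?_⟩
      have h := (memLp_Ioo_of_continuousOn (f := fun r => inner ℝ (k r) f)
        (hk.inner continuous_const).continuousOn).coeFn_toLp
      filter_upwards [h, ae_restrict_mem measurableSet_Ioo] with r hr hr'
      simp only [LinearMap.coe_mk, AddHom.coe_mk]
      rw [hr]
      exact (norm_inner_le_norm _ _).trans
        (mul_le_mul_of_nonneg_right (hC r (Ioo_subset_Icc_self hr')) (norm_nonneg _)))

theorem sliceOp_ae (k : ℝ → L2I) (hk : Continuous k) (f : L2I) :
    sliceOp k hk f =ᵐ[volume.restrict (Ioo 0 1)] fun r => inner ℝ (k r) f :=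
  (memLp_Ioo_of_continuousOn (f := fun r => inner ℝ (k r) f)
    (hk.inner continuous_const).continuousOn).coeFn_toLp

/-- Replacing k r by its value at the left end of the mesh cell containing r gives a finite-rank
operator. Uniform continuity of k on [0,1] makes these converge in operator norm as the mesh is
refined. -/
theorem sliceOp_isCompact (k : ℝ → L2I) (hk : Continuous k) :
    IsCompactOperator (sliceOp k hk) := by
  have hmem : ∀ s : Set ℝ, MeasurableSet s →
      MemLp (s.indicator fun _ => (1 : ℝ)) 2 (volume.restrict (Ioo (0 : ℝ) 1)) := fun s hs =>
    (memLp_const 1).indicator hs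
  let J : ℕ → ℕ → Set ℝ := fun N i => Ico ((i : ℝ) / (N + 1)) (((i : ℝ) + 1) / (N + 1))
  let χ : ℕ → ℕ → L2I := fun N i => (hmem (J N i) measurableSet_Ico).toLp
  let F : ℕ → (L2I →L[ℝ] L2I) := fun N => ∑ i ∈ Finset.range (N + 1),
    (ContinuousLinearMap.toSpanSingleton ℝ (χ N i)).comp (innerSL ℝ (k ((i : ℝ) / (N + 1))))
  have hFc : ∀ N, IsCompactOperator (F N) := by
    intro N
    have : F N ∈ compactOperator (RingHom.id ℝ) L2I L2I := by
      refine Submodule.sum_mem _ fun i _ => ?_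
      exact (isCompactOperator_of_locallyCompactSpace_rng
        (ContinuousLinearMap.toSpanSingleton ℝ (χ N i))).comp_clm _
    exact this
  refine isCompactOperator_of_tendsto (l := Filter.atTop) (F := F) ?_
    (Filter.Eventually.of_forall hFc)
  rw [Metric.tendsto_atTop]
  intro ε hε
  have huc := isCompact_Icc.uniformContinuousOn_of_continuous (s := Icc (0 : ℝ) 1) hk.continuousOn
  rw [Metric.uniformContinuousOn_iff] at huc
  obtain ⟨δ, hδ, huc⟩ := huc (ε / 2) (by positivity)
  obtain ⟨N₀, hN₀⟩ := exists_nat_one_div_lt hδ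
  refine ⟨N₀, fun N hN => ?_⟩
  rw [dist_eq_norm]
  refine lt_of_le_of_lt (ContinuousLinearMap.opNorm_le_bound _ (by positivity : 0 ≤ ε / 2)
    fun f => ?_) (by linarith)
  refine L2I_norm_le ?_
  have hN1 : (0 : ℝ) < N + 1 := by positivity
  have hFf : F N f = ∑ i ∈ Finset.range (N + 1), (inner ℝ (k ((i : ℝ) / (N + 1))) f) • χ N i := by
    simp [F]
  have hval : F N f =ᵐ[volume.restrict (Ioo 0 1)] fun r =>
      ∑ i ∈ Finset.range (N + 1), (inner ℝ (k ((i : ℝ) / (N + 1))) f) *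
        (J N i).indicator (fun _ => (1 : ℝ)) r := by
    rw [hFf]
    refine (Lp.coeFn_finsetSum _ _).trans ?_
    have : ∀ᵐ r ∂volume.restrict (Ioo (0 : ℝ) 1), ∀ i ∈ Finset.range (N + 1),
        ((inner ℝ (k ((i : ℝ) / (N + 1))) f) • χ N i : L2I) r =
          (inner ℝ (k ((i : ℝ) / (N + 1))) f) * (J N i).indicator (fun _ => (1 : ℝ)) r := by
      rw [Filter.eventually_all_finset]
      intro i _
      filter_upwards [Lp.coeFn_smul (inner ℝ (k ((i : ℝ) / (N + 1))) f) (χ N i),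
        (hmem (J N i) measurableSet_Ico).coeFn_toLp] with r h1 h2
      rw [h1, Pi.smul_apply, h2, smul_eq_mul]
    filter_upwards [this] with r hr
    rw [Finset.sum_apply]
    exact Finset.sum_congr rfl hr
  filter_upwards [Lp.coeFn_sub (F N f) (sliceOp k hk f), hval, sliceOp_ae k hk f,
    ae_restrict_mem measurableSet_Ioo] with r h1 h2 h3 hr
  simp only [_root_.sub_apply]
  rw [h1, Pi.sub_apply, h2, h3]
  -- The index of the unique mesh cell containing r; all other terms of the finite-rank sum vanish
  -- at r.
  set j := ⌊r * (N + 1)⌋₊ with hj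
  have hr0 : 0 ≤ r * (N + 1) := by have := hr.1; positivity
  have hj1 : (j : ℝ) ≤ r * (N + 1) := Nat.floor_le hr0
  have hj2 : r * (N + 1) < j + 1 := Nat.lt_floor_add_one _
  have hjN : j < N + 1 := by
    have : (j : ℝ) < ((N + 1 : ℕ) : ℝ) := by
      push_cast
      have := mul_lt_mul_of_pos_right hr.2 hN1
      linarith
    exact_mod_cast this
  have hsum : ∑ i ∈ Finset.range (N + 1), (inner ℝ (k ((i : ℝ) / (N + 1))) f) *
        (J N i).indicator (fun _ => (1 : ℝ)) r = inner ℝ (k ((j : ℝ) / (N + 1))) f := by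
    rw [Finset.sum_eq_single j]
    · rw [indicator_of_mem, mul_one]
      exact ⟨by rw [div_le_iff₀ hN1]; exact hj1, by rw [lt_div_iff₀ hN1]; exact hj2⟩
    · intro i _ hij
      rw [indicator_of_notMem, mul_zero]
      rintro ⟨h4, h5⟩
      rw [div_le_iff₀ hN1] at h4
      rw [lt_div_iff₀ hN1] at h5
      apply hij
      have h6 : (i : ℝ) < j + 1 := by linarith
      have h7 : (j : ℝ) < i + 1 := by linarith
      have h8 : i < j + 1 := by exact_mod_cast h6
      have h9 : j < i + 1 := by exact_mod_cast h7
      omega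
    · intro h
      exact absurd (Finset.mem_range.2 hjN) h
  rw [hsum, ← inner_sub_left]
  refine (norm_inner_le_norm _ _).trans (mul_le_mul_of_nonneg_right ?_ (norm_nonneg _))
  rw [← dist_eq_norm]
  have hj3 : (j : ℝ) / (N + 1) ≤ r := by rw [div_le_iff₀ hN1]; exact hj1
  refine (huc _ ⟨by positivity, hj3.trans hr.2.le⟩ _ (Ioo_subset_Icc_self hr) ?_).le
  rw [Real.dist_eq, abs_sub_comm, abs_of_nonneg (by linarith)]
  have h10 : r - (j : ℝ) / (N + 1) < 1 / (N + 1) := by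
    rw [sub_lt_iff_lt_add, ← add_div, lt_div_iff₀ hN1]
    linarith
  have h11 : (1 : ℝ) / (N + 1) ≤ 1 / (N₀ + 1) := by
    apply one_div_le_one_div_of_le (by positivity)
    have : (N₀ : ℝ) ≤ N := by exact_mod_cast hN
    linarith
  linarith

/-- A compact self-adjoint injective operator on a separable Hilbert space has a countable Hilbert
basis of eigenvectors. -/
theorem exists_hilbertBasis_of_isCompactOperator {H : Type} [NormedAddCommGroup H]
    [InnerProductSpace ℝ H] [CompleteSpace H] [TopologicalSpace.SeparableSpace H] {K : H →L[ℝ] H}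
    (hK : IsCompactOperator K) (hs : (K : H →ₗ[ℝ] H).IsSymmetric) (hinj : ∀ x, K x = 0 → x = 0) :
    ∃ (ι : Type) (_ : Countable ι) (b : HilbertBasis ι ℝ H) (μ : ι → ℝ),
      ∀ i, μ i ≠ 0 ∧ K (b i) = μ i • b i := by
  let M := {μ : ℝ // μ ≠ 0}
  have hfin : ∀ μ : M, FiniteDimensional ℝ (Module.End.eigenspace (K : H →ₗ[ℝ] H) μ.1) :=
    fun μ => ContinuousLinearMap.finite_dimensional_eigenspace hK μ.1 μ.2
  let V : M → Submodule ℝ H := fun μ => Module.End.eigenspace (K : H →ₗ[ℝ] H) μ.1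
  have hV : OrthogonalFamily ℝ (fun μ : M => V μ) fun μ => (V μ).subtypeₗᵢ :=
    hs.orthogonalFamily_eigenspaces.comp Subtype.val_injective
  let ι := Σ μ : M, Fin (Module.finrank ℝ (V μ))
  let v : ι → H := fun i => ((stdOrthonormalBasis ℝ (V i.1)) i.2 : H)
  have hv : Orthonormal ℝ v :=
    hV.orthonormal_sigma_orthonormal fun μ => (stdOrthonormalBasis ℝ (V μ)).orthonormal
  -- By the spectral theorem the eigenspaces of K have trivial joint orthogonal complement. The
  -- eigenvalue zero contributes nothing because K is injective, and each remaining eigenspace is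
  -- spanned by its chosen finite basis.
  have hbot : (Submodule.span ℝ (range v))ᗮ = ⊥ := by
    rw [eq_bot_iff, ← ContinuousLinearMap.orthogonalComplement_iSup_eigenspaces_eq_bot hK hs]
    refine Submodule.orthogonal_le (iSup_le fun μ => ?_)
    by_cases hμ : μ = 0
    · intro x hx
      rw [Module.End.mem_eigenspace_iff, hμ, zero_smul] at hx
      rw [hinj x hx]
      exact Submodule.zero_mem _
    · intro x hx
      have h1 := (stdOrthonormalBasis ℝ (V ⟨μ, hμ⟩)).sum_repr ⟨x, hx⟩
      have h2 := congrArg (Subtype.val) h1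
      simp only [Submodule.coe_sum, Submodule.coe_smul] at h2
      rw [← h2]
      exact Submodule.sum_mem _ fun i _ => Submodule.smul_mem _ _
        (Submodule.subset_span ⟨⟨⟨μ, hμ⟩, i⟩, rfl⟩)
  have hcount : Countable ι := by
    -- Distinct orthonormal vectors are √2 apart, so balls of radius 1/2 are disjoint; a separable
    -- space carries only countably many disjoint nonempty open sets.
    have hd : (univ : Set ι).PairwiseDisjoint fun i => Metric.ball (v i) (1 / 2) := by
      intro i _ j _ hij
      refine Metric.ball_disjoint_ball ?_
      rw [dist_eq_norm]
      have h1 : ‖v i - v j‖ ^ 2 = 2 := by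
        rw [@norm_sub_sq_real, hv.1 i, hv.1 j, hv.2 hij]; norm_num
      nlinarith [norm_nonneg (v i - v j)]
    exact countable_univ_iff.1 (hd.countable_of_isOpen (fun i _ => Metric.isOpen_ball)
      fun i _ => ⟨v i, Metric.mem_ball_self (by norm_num)⟩)
  refine ⟨ι, hcount, HilbertBasis.mkOfOrthogonalEqBot hv hbot, fun i => i.1.1, fun i =>
    ⟨i.1.2, ?_⟩⟩
  rw [HilbertBasis.coe_mkOfOrthogonalEqBot]
  exact Module.End.mem_eigenspace_iff.1 ((stdOrthonormalBasis ℝ (V i.1)) i.2).2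

/-! ### The degenerate Sturm–Liouville operator on `(0,1)` -/

/-- `e` is a Dirichlet eigenfunction of `-(r ^ a e')'` on `(0,1)` with eigenvalue `l`, and
`q = r ^ a e'` is its flux. -/
structure IsMode (a l : ℝ) (e q : ℝ → ℝ) : Prop where
  cont : Continuous e
  cont_flux : Continuous q
  hasDerivAt : ∀ r ∈ Ioo (0 : ℝ) 1, HasDerivAt e (r ^ (-a) * q r) r
  hasDerivAt_flux : ∀ r ∈ Ioo (0 : ℝ) 1, HasDerivAt q (-(l * e r)) r
  zero : e 0 = 0
  one : e 1 = 0

/-- Green's function of `-(r ^ a u')'` on `(0,1)` with Dirichlet conditions. -/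
def green (a r s : ℝ) : ℝ := min r s ^ (1 - a) * (1 - max r s ^ (1 - a)) / (1 - a)

theorem green_comm (a r s : ℝ) : green a r s = green a s r := by
  rw [green, green, min_comm, max_comm]

theorem continuous_green {a : ℝ} (ha : a < 1) : Continuous fun x : ℝ × ℝ => green a x.1 x.2 := by
  have h : Continuous fun x : ℝ => x ^ (1 - a) := Real.continuous_rpow_const (by linarith)
  unfold green
  exact ((h.comp (continuous_fst.min continuous_snd)).mul
    (continuous_const.sub (h.comp (continuous_fst.max continuous_snd)))).div_const _

/-- Both factors of the numerator lie in [0,1]. The constant matters: its inverse becomes the lower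
bound 1 - a for all eigenvalues. -/
theorem abs_green_le {a r s : ℝ} (ha : a < 1) (hr : r ∈ Icc (0 : ℝ) 1) (hs : s ∈ Icc (0 : ℝ) 1) :
    |green a r s| ≤ 1 / (1 - a) := by
  have h1 : 0 < 1 - a := by linarith
  have h2 : (0 : ℝ) ≤ min r s := le_min hr.1 hs.1
  have h3 : (0 : ℝ) ≤ max r s := h2.trans min_le_max
  have h4 : max r s ≤ 1 := max_le hr.2 hs.2
  have h5 := Real.rpow_le_one h3 h4 h1.le
  have h6 := Real.rpow_nonneg h3 (1 - a)
  have h7 := Real.rpow_le_one h2 (min_le_max.trans h4) h1.le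
  have h8 := Real.rpow_nonneg h2 (1 - a)
  rw [green, abs_div, abs_of_pos h1]
  refine div_le_div_of_nonneg_right ?_ h1.le
  rw [abs_of_nonneg (mul_nonneg h8 (by linarith))]
  nlinarith

/-- The solution of `-(r ^ a u')' = h`, `u(0) = u(1) = 0`. -/
theorem green_solution {a : ℝ} (ha : a < 1) {h : ℝ → ℝ} (hh : Continuous h) :
    ∃ q : ℝ → ℝ, Continuous q ∧
      (∀ r ∈ Ioo (0 : ℝ) 1, HasDerivAt (fun r => ∫ s in (0 : ℝ)..1, green a r s * h s)
        (r ^ (-a) * q r) r) ∧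
      (∀ r, HasDerivAt q (-h r) r) ∧
      (∫ s in (0 : ℝ)..1, green a 0 s * h s) = 0 ∧ (∫ s in (0 : ℝ)..1, green a 1 s * h s) = 0 := by
  have h1a : 0 < 1 - a := by linarith
  have hp : Continuous fun x : ℝ => x ^ (1 - a) := Real.continuous_rpow_const h1a.le
  have hph : Continuous fun x : ℝ => x ^ (1 - a) * h x := hp.mul hh
  have hph' : Continuous fun x : ℝ => (1 - x ^ (1 - a)) * h x := (continuous_const.sub hp).mul hh
  -- Cutting the integral at s = r resolves the minimum and maximum and leaves functions of r times
  -- integrals with limit r. On differentiating, the two terms produced by the moving limit cancel.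
  have key : ∀ r ∈ Icc (0 : ℝ) 1, ∫ s in (0 : ℝ)..1, green a r s * h s =
      ((1 - r ^ (1 - a)) * (∫ s in (0 : ℝ)..r, s ^ (1 - a) * h s) +
        r ^ (1 - a) * (∫ s in r..1, (1 - s ^ (1 - a)) * h s)) / (1 - a) := by
    intro r hr
    have hc : Continuous fun s => green a r s * h s :=
      ((continuous_green ha).comp (continuous_const.prodMk continuous_id)).mul hh
    rw [← intervalIntegral.integral_add_adjacent_intervals (hc.intervalIntegrable 0 r)
      (hc.intervalIntegrable r 1), add_div]
    congr 1
    · rw [← intervalIntegral.integral_const_mul, ← intervalIntegral.integral_div]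
      refine intervalIntegral.integral_congr fun s hs => ?_
      rw [uIcc_of_le hr.1] at hs
      simp only [green, min_eq_right hs.2, max_eq_left hs.2]
      ring
    · rw [← intervalIntegral.integral_const_mul, ← intervalIntegral.integral_div]
      refine intervalIntegral.integral_congr fun s hs => ?_
      rw [uIcc_of_le hr.2] at hs
      simp only [green, min_eq_left hs.1, max_eq_right hs.1]
      ring
  have d1 : ∀ r, HasDerivAt (fun r => ∫ s in (0 : ℝ)..r, s ^ (1 - a) * h s)
      (r ^ (1 - a) * h r) r := fun r =>
    intervalIntegral.integral_hasDerivAt_right (hph.intervalIntegrable _ _)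
      hph.stronglyMeasurable.stronglyMeasurableAtFilter hph.continuousAt
  have d2 : ∀ r, HasDerivAt (fun r => ∫ s in r..1, (1 - s ^ (1 - a)) * h s)
      (-((1 - r ^ (1 - a)) * h r)) r := fun r =>
    intervalIntegral.integral_hasDerivAt_left (hph'.intervalIntegrable _ _)
      hph'.stronglyMeasurable.stronglyMeasurableAtFilter hph'.continuousAt
  refine ⟨fun r => -(∫ s in (0 : ℝ)..r, s ^ (1 - a) * h s) +
    ∫ s in r..1, (1 - s ^ (1 - a)) * h s, ?_, ?_, ?_, ?_, ?_⟩
  · exact continuous_iff_continuousAt.2 fun r => ((d1 r).neg.add (d2 r)).continuousAt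
  · intro r hr
    have dp : HasDerivAt (fun r : ℝ => r ^ (1 - a)) ((1 - a) * r ^ (-a)) r := by
      have := Real.hasDerivAt_rpow_const (x := r) (p := 1 - a) (Or.inl hr.1.ne')
      refine this.congr_deriv ?_
      congr 2
      ring
    have D := (((dp.const_sub 1).fun_mul (d1 r)).fun_add (dp.fun_mul (d2 r))).div_const (1 - a)
    refine (D.congr_of_eventuallyEq ?_).congr_deriv ?_
    · filter_upwards [Ioo_mem_nhds hr.1 hr.2] with x hx
      exact key x (Ioo_subset_Icc_self hx)
    · field_simp
      ring
  · intro r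
    refine ((d1 r).fun_neg.fun_add (d2 r)).congr_deriv ?_
    ring
  · rw [key 0 ⟨le_rfl, zero_le_one⟩]
    simp [Real.zero_rpow h1a.ne']
  · rw [key 1 ⟨zero_le_one, le_rfl⟩]
    simp

theorem green_slice_continuousOn {a : ℝ} (ha : a < 1) (r : ℝ) :
    ContinuousOn (green a r) (Icc 0 1) :=
  ((continuous_green ha).comp (continuous_const.prodMk continuous_id)).continuousOn

/-- `r ↦ G(r, ·)` as a curve in `L²(0,1)`. -/
def greenSlice {a : ℝ} (ha : a < 1) (r : ℝ) : L2I :=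
  (memLp_Ioo_of_continuousOn (green_slice_continuousOn ha r)).toLp

theorem greenSlice_ae {a : ℝ} (ha : a < 1) (r : ℝ) :
    greenSlice ha r =ᵐ[volume.restrict (Ioo 0 1)] green a r :=
  (memLp_Ioo_of_continuousOn (green_slice_continuousOn ha r)).coeFn_toLp

/-- The squared distance between two slices is the integral of a continuous function of the
parameter, and it vanishes when the slices coincide. -/
theorem continuous_greenSlice {a : ℝ} (ha : a < 1) : Continuous (greenSlice ha) := by
  have hsq : ∀ r r', ‖greenSlice ha r - greenSlice ha r'‖ ^ 2 =
      ∫ s in (0 : ℝ)..1, (green a r s - green a r' s) * (green a r s - green a r' s) := by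
    intro r r'
    have h : (greenSlice ha r - greenSlice ha r' : L2I) =ᵐ[volume.restrict (Ioo 0 1)]
        fun s => green a r s - green a r' s := by
      filter_upwards [Lp.coeFn_sub (greenSlice ha r) (greenSlice ha r'), greenSlice_ae ha r,
        greenSlice_ae ha r'] with s h1 h2 h3
      rw [h1, Pi.sub_apply, h2, h3]
    rw [← real_inner_self_eq_norm_sq, L2I_inner_eq h h]
  rw [continuous_iff_continuousAt]
  intro r'
  have hc : Continuous fun r => ‖greenSlice ha r - greenSlice ha r'‖ ^ 2 := by
    simp only [hsq]
    have h1 : Continuous (Function.uncurry fun r s : ℝ => green a r s - green a r' s) :=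
      (continuous_green ha).sub
        ((continuous_green ha).comp (continuous_const.prodMk continuous_snd))
    exact intervalIntegral.continuous_parametric_intervalIntegral_of_continuous' (h1.mul h1) 0 1
  rw [ContinuousAt, tendsto_iff_norm_sub_tendsto_zero]
  have h0 := (hc.tendsto r').sqrt
  simpa [Real.sqrt_sq_eq_abs] using h0

/-- The inverse of `-(r ^ a u')'` with Dirichlet conditions. -/
def greenOp {a : ℝ} (ha : a < 1) : L2I →L[ℝ] L2I :=
  sliceOp (greenSlice ha) (continuous_greenSlice ha)

theorem greenOp_ae {a : ℝ} (ha : a < 1) {f : L2I} {h : ℝ → ℝ}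
    (hf : f =ᵐ[volume.restrict (Ioo 0 1)] h) :
    greenOp ha f =ᵐ[volume.restrict (Ioo 0 1)] fun r => ∫ s in (0 : ℝ)..1, green a r s * h s := by
  filter_upwards [sliceOp_ae (greenSlice ha) (continuous_greenSlice ha) f] with r hr
  rw [greenOp, hr, L2I_inner_eq (greenSlice_ae ha r) hf]

theorem norm_greenOp_le {a : ℝ} (ha : a < 1) (f : L2I) : ‖greenOp ha f‖ ≤ 1 / (1 - a) * ‖f‖ := by
  refine L2I_norm_le ?_
  filter_upwards [sliceOp_ae (greenSlice ha) (continuous_greenSlice ha) f,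
    ae_restrict_mem measurableSet_Ioo] with r hr hr'
  rw [greenOp, hr]
  refine (norm_inner_le_norm _ _).trans (mul_le_mul_of_nonneg_right (L2I_norm_le ?_)
    (norm_nonneg _))
  filter_upwards [greenSlice_ae ha r, ae_restrict_mem measurableSet_Ioo] with s hs hs'
  rw [hs]
  exact abs_green_le ha (Ioo_subset_Icc_self hr') (Ioo_subset_Icc_self hs')

/-- Fubini combined with the symmetry of the Green function, which is bounded on the square. -/
theorem greenOp_isSymmetric {a : ℝ} (ha : a < 1) :
    ((greenOp ha : L2I →L[ℝ] L2I) : L2I →ₗ[ℝ] L2I).IsSymmetric := by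
  intro f g
  have e1 : ∀ f g : L2I, inner ℝ (greenOp ha f) g =
      ∫ r in Ioo (0 : ℝ) 1, ∫ s in Ioo (0 : ℝ) 1, green a r s * f s * g r := by
    intro f g
    rw [L2I_inner_eq (greenOp_ae ha Filter.EventuallyEq.rfl) (Filter.EventuallyEq.rfl (f := g)),
      ← integral_Ioo_eq_interval zero_le_one]
    simp only [← integral_Ioo_eq_interval zero_le_one, ← integral_mul_const]
  rw [ContinuousLinearMap.coe_coe, real_inner_comm (greenOp ha g) f, e1, e1, integral_integral_swap]
  · refine integral_congr_ae (Filter.Eventually.of_forall fun r => ?_)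
    refine integral_congr_ae (Filter.Eventually.of_forall fun s => ?_)
    simp only [green_comm a s r]
    ring
  · have hfi : Integrable f (volume.restrict (Ioo (0 : ℝ) 1)) :=
      (Lp.memLp f).integrable (by norm_num)
    have hgi : Integrable g (volume.restrict (Ioo (0 : ℝ) 1)) :=
      (Lp.memLp g).integrable (by norm_num)
    have h1 := (hgi.mul_prod hfi).bdd_mul (c := 1 / (1 - a))
      (f := fun x : ℝ × ℝ => green a x.1 x.2) (continuous_green ha).aestronglyMeasurable (by
        rw [Measure.prod_restrict]
        filter_upwards [ae_restrict_mem (measurableSet_Ioo.prod measurableSet_Ioo)] with x hx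
        exact abs_green_le ha (Ioo_subset_Icc_self hx.1) (Ioo_subset_Icc_self hx.2))
    refine h1.congr (Filter.Eventually.of_forall fun x => ?_)
    simp only [Function.uncurry]
    ring

/-- The weight r^a is singular only at r = 0, away from the support of v', so the flux r^a v' is
smooth. -/
theorem IsTestFunction.exists_flux {v : ℝ → ℝ} (a : ℝ) (hv : IsTestFunction (Ioo 0 1) v) :
    ∃ h : ℝ → ℝ, Continuous h ∧ ∀ r ∈ Ioo (0 : ℝ) 1,
      HasDerivAt (fun r => r ^ a * _root_.deriv v r) (-h r) r := by
  have hs : ContDiff ℝ ∞ fun r => r ^ a * _root_.deriv v r := by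
    rw [contDiff_iff_contDiffAt]
    intro r
    by_cases hr : r ∈ tsupport (_root_.deriv v)
    · have hr0 : r ≠ 0 := (hv.deriv.tsupport_subset hr).1.ne'
      exact (Real.contDiffAt_rpow_const_of_ne hr0).mul hv.deriv.contDiff.contDiffAt
    · refine (contDiffAt_const (c := (0 : ℝ))).congr_of_eventuallyEq ?_
      filter_upwards [notMem_tsupport_iff_eventuallyEq.1 hr] with x hx
      simp [hx]
  refine ⟨fun r => -_root_.deriv (fun r => r ^ a * _root_.deriv v r) r,
    ((contDiff_infty_iff_deriv.1 hs).2.continuous).neg, fun r _ => ?_⟩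
  rw [neg_neg]
  exact (hs.differentiable (by simp) r).hasDerivAt

/-- Every test function is in the range of the Green operator. -/
theorem IsTestFunction.exists_green {a : ℝ} (ha : a < 1) {v : ℝ → ℝ}
    (hv : IsTestFunction (Ioo 0 1) v) :
    ∃ h : ℝ → ℝ, Continuous h ∧
      ∀ r ∈ Icc (0 : ℝ) 1, ∫ s in (0 : ℝ)..1, green a r s * h s = v r := by
  obtain ⟨h, hh, hd⟩ := hv.exists_flux a
  refine ⟨h, hh, ?_⟩
  obtain ⟨q, hqc, hu, hq, hu0, hu1⟩ := green_solution ha hh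
  set u : ℝ → ℝ := fun r => ∫ s in (0 : ℝ)..1, green a r s * h s with hu_def
  have hcu : Continuous u := by
    have h1 : Continuous (Function.uncurry fun r s : ℝ => green a r s * h s) :=
      (continuous_green ha).mul (hh.comp continuous_snd)
    exact intervalIntegral.continuous_parametric_intervalIntegral_of_continuous' h1 0 1
  have hcw : ContinuousOn (fun r => u r - v r) (Icc 0 1) := (hcu.sub hv.continuous).continuousOn
  have hv0 : v 0 = 0 := hv.eq_zero (by simp)
  have hv1 : v 1 = 0 := hv.eq_zero (by simp)
  -- Uniqueness for the boundary value problem: the flux of u - v is constant, Rolle's theorem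
  -- produces a point where it vanishes, and then the mean value theorem gives u = v.
  have hdv : ∀ r ∈ Ioo (0 : ℝ) 1, HasDerivAt (fun r => u r - v r)
      (r ^ (-a) * (q r - r ^ a * _root_.deriv v r)) r := by
    intro r hr
    refine ((hu r hr).fun_sub (hv.hasDerivAt r)).congr_deriv ?_
    rw [mul_sub, ← mul_assoc, ← Real.rpow_add hr.1]
    simp
  obtain ⟨c, hc, hc0⟩ := exists_hasDerivAt_eq_zero zero_lt_one hcw
    (by rw [show u 0 = 0 from hu0, show u 1 = 0 from hu1, hv0, hv1]) hdv
  have hconst : ∀ r ∈ Ioo (0 : ℝ) 1, q r - r ^ a * _root_.deriv v r = 0 := by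
    intro r hr
    have h1 : (fun r => q r - r ^ a * _root_.deriv v r) r =
        (fun r => q r - r ^ a * _root_.deriv v r) c := by
      exact isOpen_Ioo.is_const_of_deriv_eq_zero isPreconnected_Ioo
        (fun x hx => ((hq x).fun_sub (hd x hx)).differentiableAt.differentiableWithinAt)
        (fun x hx => (((hq x).fun_sub (hd x hx)).congr_deriv (by simp)).deriv) hr hc
    have h2 : c ^ (-a) ≠ 0 := (Real.rpow_pos_of_pos hc.1 _).ne'
    have h3 := (mul_eq_zero.1 hc0).resolve_left h2
    simp only at h1
    rw [h1, h3]
  intro r hr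
  rcases eq_or_lt_of_le hr.1 with h0 | h0
  · rw [← h0]
    exact hu0.trans hv0.symm
  · obtain ⟨x, hx, hx'⟩ := exists_hasDerivAt_eq_slope _ _ h0
      (hcw.mono (Icc_subset_Icc_right hr.2)) fun x hx => hdv x ⟨hx.1, hx.2.trans_le hr.2⟩
    have hx1 : x ∈ Ioo (0 : ℝ) 1 := ⟨hx.1, hx.2.trans_le hr.2⟩
    rw [hconst x hx1, mul_zero, eq_comm, div_eq_zero_iff] at hx'
    have := hx'.resolve_right (by linarith)
    have hu0' : u 0 = 0 := hu0
    simp only [hu0', hv0] at this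
    show u r = v r
    linarith

/-- The kernel of a symmetric operator is orthogonal to its range, and the range contains all test
functions. -/
theorem greenOp_injective {a : ℝ} (ha : a < 1) (f : L2I) (hf : greenOp ha f = 0) : f = 0 := by
  have key := isOpen_Ioo.ae_eq_zero_of_integral_contDiff_smul_eq_zero
    (μ := volume.restrict (Ioo (0 : ℝ) 1)) (U := Ioo 0 1) (f := f)
    (((Lp.memLp f).integrable (by norm_num)).locallyIntegrable.locallyIntegrableOn _) ?_
  · refine Lp.ext ?_
    filter_upwards [key, ae_restrict_mem measurableSet_Ioo, Lp.coeFn_zero ℝ 2 _] with x hx hx' h0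
    rw [hx hx', h0, Pi.zero_apply]
  · intro v h1 h2 h3
    have hv : IsTestFunction (Ioo 0 1) v := ⟨h1, h2, h3⟩
    obtain ⟨h, hh, hgv⟩ := hv.exists_green ha
    have hhL := memLp_Ioo_of_continuousOn hh.continuousOn
    have h4 : inner ℝ (greenOp ha hhL.toLp) f = 0 := by
      have := greenOp_isSymmetric ha hhL.toLp f
      simp only [ContinuousLinearMap.coe_coe] at this
      rw [this, hf, inner_zero_right]
    have h5 : greenOp ha hhL.toLp =ᵐ[volume.restrict (Ioo 0 1)] v := by
      filter_upwards [greenOp_ae ha hhL.coeFn_toLp, ae_restrict_mem measurableSet_Ioo] with r hr hr'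
      rw [hr, hgv r (Ioo_subset_Icc_self hr')]
    rw [L2I_inner_eq h5 (Filter.EventuallyEq.rfl (f := f))] at h4
    rw [integral_Ioo_eq_interval zero_le_one]
    exact h4

theorem IsMode.intervalIntegrable_deriv {a l : ℝ} {e q : ℝ → ℝ} (h : IsMode a l e q) (ha : a < 1) :
    IntervalIntegrable (fun r => r ^ (-a) * q r) volume 0 1 :=
  (intervalIntegral.intervalIntegrable_rpow' (by linarith)).mul_continuousOn
    h.cont_flux.continuousOn

/-- `∫ r ^ a e₁' e₂' = l₁ ∫ e₁ e₂`. -/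
theorem IsMode.integral_flux_mul {a l₁ l₂ : ℝ} {e₁ q₁ e₂ q₂ : ℝ → ℝ} (h₁ : IsMode a l₁ e₁ q₁)
    (h₂ : IsMode a l₂ e₂ q₂) (ha : a < 1) :
    ∫ r in (0 : ℝ)..1, r ^ (-a) * (q₁ r * q₂ r) = l₁ * ∫ r in (0 : ℝ)..1, e₁ r * e₂ r := by
  have h := intervalIntegral.integral_deriv_mul_eq_sub_of_hasDerivAt (a := 0) (b := 1)
    (u := q₁) (v := e₂) (u' := fun r => -(l₁ * e₁ r)) (v' := fun r => r ^ (-a) * q₂ r)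
    h₁.cont_flux.continuousOn h₂.cont.continuousOn
    (by simpa using h₁.hasDerivAt_flux) (by simpa using h₂.hasDerivAt)
    ((continuous_const.mul h₁.cont).neg.intervalIntegrable _ _) (h₂.intervalIntegrable_deriv ha)
  rw [intervalIntegral.integral_add
    (Continuous.intervalIntegrable (u := fun r => -(l₁ * e₁ r) * e₂ r)
      ((continuous_const.mul h₁.cont).neg.mul h₂.cont) _ _)
    ((h₂.intervalIntegrable_deriv ha).continuousOn_mul h₁.cont_flux.continuousOn),
    h₂.zero, h₂.one] at h
  have e1 : ∫ r in (0 : ℝ)..1, -(l₁ * e₁ r) * e₂ r = -(l₁ * ∫ r in (0 : ℝ)..1, e₁ r * e₂ r) := by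
    rw [← intervalIntegral.integral_const_mul, ← intervalIntegral.integral_neg]
    congr 1
    ext r
    ring
  have e2 : ∫ r in (0 : ℝ)..1, r ^ (-a) * (q₁ r * q₂ r) =
      ∫ r in (0 : ℝ)..1, q₁ r * (r ^ (-a) * q₂ r) := by
    congr 1
    ext r
    ring
  rw [e1] at h
  rw [e2]
  linarith

/-- A Hilbert basis of `L²(0,1)` consisting of Dirichlet eigenfunctions of `-(r ^ a u')'`. -/
theorem exists_mode_basis {a : ℝ} (ha : a < 1) :
    ∃ (ι : Type) (_ : Countable ι) (b : HilbertBasis ι ℝ L2I) (l : ι → ℝ) (e q : ι → ℝ → ℝ),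
      ∀ i, IsMode a (l i) (e i) (q i) ∧ (b i =ᵐ[volume.restrict (Ioo 0 1)] e i) ∧ 1 - a ≤ l i := by
  have : Fact ((2 : ENNReal) ≠ ⊤) := ⟨by simp⟩
  obtain ⟨ι, hι, b, μ, hb⟩ := exists_hilbertBasis_of_isCompactOperator
    (sliceOp_isCompact _ (continuous_greenSlice ha)) (greenOp_isSymmetric ha)
    (greenOp_injective ha)
  have hmode : ∀ i, ∃ e q : ℝ → ℝ, IsMode a (1 / μ i) e q ∧
      (b i =ᵐ[volume.restrict (Ioo 0 1)] e) := by
    intro i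
    have hμ := (hb i).1
    -- The eigenvalue equation read pointwise through the kernel picks a continuous representative,
    -- which then satisfies the integral equation at every r rather than almost every r.
    let e : ℝ → ℝ := fun r => (1 / μ i) * inner ℝ (greenSlice ha r) (b i)
    have he : Continuous e :=
      continuous_const.mul ((continuous_greenSlice ha).inner continuous_const)
    have hbe : b i =ᵐ[volume.restrict (Ioo 0 1)] e := by
      filter_upwards [sliceOp_ae (greenSlice ha) (continuous_greenSlice ha) (b i),
        Lp.coeFn_smul (μ i) (b i)] with r h1 h2
      have h3 : sliceOp (greenSlice ha) (continuous_greenSlice ha) (b i) = μ i • b i := (hb i).2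
      rw [h3, h2, Pi.smul_apply, smul_eq_mul] at h1
      simp only [e]
      rw [← h1]
      field_simp
    have hee : ∀ r, e r = (1 / μ i) * ∫ s in (0 : ℝ)..1, green a r s * e s := fun r => by
      simp only [e]
      rw [L2I_inner_eq (greenSlice_ae ha r) hbe]
    obtain ⟨q, hqc, hu, hq, hu0, hu1⟩ := green_solution ha he
    refine ⟨e, fun r => (1 / μ i) * q r, ⟨he, continuous_const.mul hqc, ?_, ?_, ?_, ?_⟩, hbe⟩
    · intro r hr
      have := ((hu r hr).const_mul (1 / μ i))
      rw [show e = _ from funext hee]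
      refine this.congr_deriv ?_
      ring
    · intro r _
      refine ((hq r).const_mul (1 / μ i)).congr_deriv ?_
      ring
    · rw [hee, hu0, mul_zero]
    · rw [hee, hu1, mul_zero]
  choose e q hm hbe using hmode
  refine ⟨ι, hι, b, fun i => 1 / μ i, e, q, fun i => ⟨hm i, hbe i, ?_⟩⟩
  have hnorm : ‖b i‖ = 1 := b.orthonormal.1 i
  have hee : ∫ r in (0 : ℝ)..1, e i r * e i r = 1 := by
    rw [← L2I_inner_eq (hbe i) (hbe i), real_inner_self_eq_norm_sq, hnorm, one_pow]
  -- The eigenvalue equals the Dirichlet integral of the normalised mode, hence is nonnegative; with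
  -- positivity known, the norm bound on `greenOp` turns into 1 / μ i ≥ 1 - a.
  have hpos : 0 ≤ 1 / μ i := by
    have h1 := (hm i).integral_flux_mul (hm i) ha
    rw [hee, mul_one] at h1
    rw [← h1]
    refine intervalIntegral.integral_nonneg zero_le_one fun r hr => ?_
    exact mul_nonneg (Real.rpow_nonneg hr.1 _) (mul_self_nonneg _)
  have hμ : 0 < μ i := lt_of_le_of_ne (by simpa using hpos) (hb i).1.symm
  have h2 := norm_greenOp_le ha (b i)
  have h3 : greenOp ha (b i) = μ i • b i := (hb i).2
  rw [h3, norm_smul, hnorm, mul_one, mul_one, Real.norm_of_nonneg hμ.le,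
    le_one_div hμ (by linarith)] at h2
  exact h2

/-! ### Integral identities for pairs of eigenfunctions -/

/-- Fundamental theorem of calculus on `[0,1]` for integrands of the form `r ^ (-a)` times a
continuous function plus a continuous function. -/
theorem integral_eq_sub_of_weighted {a : ℝ} (ha : a < 1) {F f g : ℝ → ℝ} (hF : Continuous F)
    (hf : Continuous f) (hg : Continuous g)
    (hd : ∀ r ∈ Ioo (0 : ℝ) 1, HasDerivAt F (r ^ (-a) * f r + g r) r) :
    (∫ r in (0 : ℝ)..1, r ^ (-a) * f r) + ∫ r in (0 : ℝ)..1, g r = F 1 - F 0 := by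
  have h1 : IntervalIntegrable (fun r => r ^ (-a) * f r) volume 0 1 :=
    (intervalIntegral.intervalIntegrable_rpow' (by linarith)).mul_continuousOn hf.continuousOn
  rw [← intervalIntegral.integral_add h1 (hg.intervalIntegrable _ _)]
  exact intervalIntegral.integral_eq_sub_of_hasDerivAt_of_le zero_le_one hF.continuousOn hd
    (h1.add (hg.intervalIntegrable _ _))

theorem integral_eq_sub_of_continuous {F f : ℝ → ℝ} (hF : Continuous F) (hf : Continuous f)
    (hd : ∀ r ∈ Ioo (0 : ℝ) 1, HasDerivAt F (f r) r) :
    ∫ r in (0 : ℝ)..1, f r = F 1 - F 0 :=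
  intervalIntegral.integral_eq_sub_of_hasDerivAt_of_le zero_le_one hF.continuousOn hd
    (hf.intervalIntegrable _ _)

section Uniform

variable {k₁ k₂ : ℝ} {s₁ p₁ s₂ p₂ : ℝ → ℝ}

theorem IsMode.hasDerivAt_zero (h₁ : IsMode 0 k₁ s₁ p₁) :
    ∀ r ∈ Ioo (0 : ℝ) 1, HasDerivAt s₁ (p₁ r) r := fun r hr =>
  (h₁.hasDerivAt r hr).congr_deriv (by simp)

/-- Integrate the derivative of A s₁ s₂, whose boundary values vanish with the modes. -/
theorem integral_mul_deriv_add (h₁ : IsMode 0 k₁ s₁ p₁) (h₂ : IsMode 0 k₂ s₂ p₂) {A A' : ℝ → ℝ}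
    (hA : Continuous A) (hA' : Continuous A') (hd : ∀ x, HasDerivAt A (A' x) x) :
    (∫ x in (0 : ℝ)..1, A x * (s₁ x * p₂ x)) + ∫ x in (0 : ℝ)..1, A x * (s₂ x * p₁ x) =
      -∫ x in (0 : ℝ)..1, A' x * (s₁ x * s₂ x) := by
  have c1 := h₁.cont
  have c2 := h₂.cont
  have c3 := h₁.cont_flux
  have c4 := h₂.cont_flux
  have key := integral_eq_sub_of_continuous (F := fun x => A x * (s₁ x * s₂ x))
    (f := fun x => A x * (s₁ x * p₂ x) + A x * (s₂ x * p₁ x) + A' x * (s₁ x * s₂ x))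
    (by fun_prop) (by fun_prop) fun x hx =>
      ((hd x).fun_mul ((h₁.hasDerivAt_zero x hx).fun_mul (h₂.hasDerivAt_zero x hx))).congr_deriv
        (by ring)
  rw [intervalIntegral.integral_add (Continuous.intervalIntegrable (by fun_prop) _ _)
      (Continuous.intervalIntegrable (by fun_prop) _ _),
    intervalIntegral.integral_add (Continuous.intervalIntegrable (by fun_prop) _ _)
      (Continuous.intervalIntegrable (by fun_prop) _ _), h₁.zero, h₁.one] at key
  linarith

/-- Integrate the derivative of A p₁ p₂. The fluxes need not vanish at the endpoints, so A must;
geometrically, the field is tangential on the sides θ = 0 and θ = 1. -/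
theorem integral_mul_deriv_weighted_add (h₁ : IsMode 0 k₁ s₁ p₁) (h₂ : IsMode 0 k₂ s₂ p₂)
    {A A' : ℝ → ℝ} (hA : Continuous A) (hA' : Continuous A') (hd : ∀ x, HasDerivAt A (A' x) x)
    (hA0 : A 0 = 0) (hA1 : A 1 = 0) :
    k₁ * (∫ x in (0 : ℝ)..1, A x * (s₁ x * p₂ x)) + k₂ * ∫ x in (0 : ℝ)..1, A x * (s₂ x * p₁ x) =
      ∫ x in (0 : ℝ)..1, A' x * (p₁ x * p₂ x) := by
  have c1 := h₁.cont
  have c2 := h₂.cont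
  have c3 := h₁.cont_flux
  have c4 := h₂.cont_flux
  have key := integral_eq_sub_of_continuous (F := fun x => A x * (p₁ x * p₂ x))
    (f := fun x => (-k₁) * (A x * (s₁ x * p₂ x)) + (-k₂) * (A x * (s₂ x * p₁ x)) +
      A' x * (p₁ x * p₂ x))
    (by fun_prop) (by fun_prop) fun x hx =>
      ((hd x).fun_mul ((h₁.hasDerivAt_flux x hx).fun_mul (h₂.hasDerivAt_flux x hx))).congr_deriv
        (by ring)
  rw [intervalIntegral.integral_add (Continuous.intervalIntegrable (by fun_prop) _ _)
      (Continuous.intervalIntegrable (by fun_prop) _ _),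
    intervalIntegral.integral_add (Continuous.intervalIntegrable (by fun_prop) _ _)
      (Continuous.intervalIntegrable (by fun_prop) _ _), hA0, hA1,
    intervalIntegral.integral_const_mul, intervalIntegral.integral_const_mul] at key
  linarith

/-- Integrate the derivative of b p₁ s₂. -/
theorem integral_mul_mul_eq (h₁ : IsMode 0 k₁ s₁ p₁) (h₂ : IsMode 0 k₂ s₂ p₂)
    {b b' : ℝ → ℝ} (hb : Continuous b) (hb' : Continuous b') (hd : ∀ x, HasDerivAt b (b' x) x) :
    k₁ * (∫ x in (0 : ℝ)..1, b x * (s₁ x * s₂ x)) =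
      (∫ x in (0 : ℝ)..1, b' x * (p₁ x * s₂ x)) + ∫ x in (0 : ℝ)..1, b x * (p₁ x * p₂ x) := by
  have c1 := h₁.cont
  have c2 := h₂.cont
  have c3 := h₁.cont_flux
  have c4 := h₂.cont_flux
  have key := integral_eq_sub_of_continuous (F := fun x => b x * (p₁ x * s₂ x))
    (f := fun x => (-k₁) * (b x * (s₁ x * s₂ x)) + b' x * (p₁ x * s₂ x) +
      b x * (p₁ x * p₂ x))
    (by fun_prop) (by fun_prop) fun x hx =>
      ((hd x).fun_mul ((h₁.hasDerivAt_flux x hx).fun_mul (h₂.hasDerivAt_zero x hx))).congr_deriv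
        (by ring)
  rw [intervalIntegral.integral_add (Continuous.intervalIntegrable (by fun_prop) _ _)
      (Continuous.intervalIntegrable (by fun_prop) _ _),
    intervalIntegral.integral_add (Continuous.intervalIntegrable (by fun_prop) _ _)
      (Continuous.intervalIntegrable (by fun_prop) _ _), h₂.zero, h₂.one,
    intervalIntegral.integral_const_mul] at key
  linarith

end Uniform

section Weighted

variable {a l₁ l₂ : ℝ} {e₁ q₁ e₂ q₂ : ℝ → ℝ}

theorem rpow_one_sub_mul {r : ℝ} (hr : 0 < r) (a : ℝ) : r ^ (1 - a) = r * r ^ (-a) := by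
  rw [sub_eq_add_neg, Real.rpow_add hr, Real.rpow_one]

/-- Integrate the derivative of r e₁ e₂; the factor r turns the singular weight r^(-a) into the
continuous r^(1 - a). -/
theorem integral_radial_add (h₁ : IsMode a l₁ e₁ q₁) (h₂ : IsMode a l₂ e₂ q₂) (ha : a < 1) :
    (∫ r in (0 : ℝ)..1, r ^ (1 - a) * (e₁ r * q₂ r)) +
      (∫ r in (0 : ℝ)..1, r ^ (1 - a) * (e₂ r * q₁ r)) = -∫ r in (0 : ℝ)..1, e₁ r * e₂ r := by
  have c0 : Continuous fun r : ℝ => r ^ (1 - a) := Real.continuous_rpow_const (by linarith)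
  have c1 := h₁.cont
  have c2 := h₂.cont
  have c3 := h₁.cont_flux
  have c4 := h₂.cont_flux
  have key := integral_eq_sub_of_continuous (F := fun x => x * (e₁ x * e₂ x))
    (f := fun x => x ^ (1 - a) * (e₁ x * q₂ x) + x ^ (1 - a) * (e₂ x * q₁ x) + e₁ x * e₂ x)
    (by fun_prop) (by fun_prop) fun x hx =>
      ((hasDerivAt_id' x).fun_mul
        ((h₁.hasDerivAt x hx).fun_mul (h₂.hasDerivAt x hx))).congr_deriv
        (by rw [rpow_one_sub_mul hx.1]; ring)
  rw [intervalIntegral.integral_add (Continuous.intervalIntegrable (by fun_prop) _ _)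
      (Continuous.intervalIntegrable (by fun_prop) _ _),
    intervalIntegral.integral_add (Continuous.intervalIntegrable (by fun_prop) _ _)
      (Continuous.intervalIntegrable (by fun_prop) _ _), h₁.zero, h₁.one] at key
  linarith

/-- A Pohozaev identity, from the derivative of r^(1 - a) q₁ q₂. The weight kills the boundary term
at the degenerate end r = 0, while the one at r = 1 survives: it is the source of the normal
derivative in the observability inequality. -/
theorem integral_radial_weighted_add (h₁ : IsMode a l₁ e₁ q₁) (h₂ : IsMode a l₂ e₂ q₂)
    (ha : a < 1) :
    l₁ * (∫ r in (0 : ℝ)..1, r ^ (1 - a) * (e₁ r * q₂ r)) +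
      l₂ * (∫ r in (0 : ℝ)..1, r ^ (1 - a) * (e₂ r * q₁ r)) =
      (1 - a) * (∫ r in (0 : ℝ)..1, r ^ (-a) * (q₁ r * q₂ r)) - q₁ 1 * q₂ 1 := by
  have c0 : Continuous fun r : ℝ => r ^ (1 - a) := Real.continuous_rpow_const (by linarith)
  have c1 := h₁.cont
  have c2 := h₂.cont
  have c3 := h₁.cont_flux
  have c4 := h₂.cont_flux
  have key := integral_eq_sub_of_weighted ha (F := fun x => x ^ (1 - a) * (q₁ x * q₂ x))
    (f := fun x => (1 - a) * (q₁ x * q₂ x))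
    (g := fun x => (-l₁) * (x ^ (1 - a) * (e₁ x * q₂ x)) + (-l₂) * (x ^ (1 - a) * (e₂ x * q₁ x)))
    (by fun_prop) (by fun_prop) (by fun_prop) fun x hx => by
      have d : HasDerivAt (fun r : ℝ => r ^ (1 - a)) ((1 - a) * x ^ (-a)) x := by
        refine (Real.hasDerivAt_rpow_const (x := x) (p := 1 - a) (Or.inl hx.1.ne')).congr_deriv ?_
        congr 2
        ring
      exact (d.fun_mul
        ((h₁.hasDerivAt_flux x hx).fun_mul (h₂.hasDerivAt_flux x hx))).congr_deriv (by ring)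
  rw [intervalIntegral.integral_add (Continuous.intervalIntegrable (by fun_prop) _ _)
      (Continuous.intervalIntegrable (by fun_prop) _ _),
    intervalIntegral.integral_const_mul, intervalIntegral.integral_const_mul,
    Real.zero_rpow (by linarith), Real.one_rpow] at key
  have e1 : ∫ r in (0 : ℝ)..1, r ^ (-a) * ((1 - a) * (q₁ r * q₂ r)) =
      (1 - a) * ∫ r in (0 : ℝ)..1, r ^ (-a) * (q₁ r * q₂ r) := by
    rw [← intervalIntegral.integral_const_mul]
    congr 1
    ext r
    ring
  rw [e1] at key
  linarith

end Weighted

/-! ### Approximation of eigenfunctions by test functions -/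

/-- Integration by parts for primitives of integrable functions. -/
theorem integral_primitive_mul {f g : ℝ → ℝ} (hf : IntervalIntegrable f volume 0 1)
    (hg : IntervalIntegrable g volume 0 1) :
    ∫ x in (0 : ℝ)..1, (∫ t in (0 : ℝ)..x, f t) * g x =
      (∫ x in (0 : ℝ)..1, f x) * (∫ x in (0 : ℝ)..1, g x) -
        ∫ x in (0 : ℝ)..1, f x * ∫ t in (0 : ℝ)..x, g t := by
  have h := (hf.absolutelyContinuousOnInterval_intervalIntegral (c := 0)
    (by simp)).integral_mul_deriv_eq_deriv_mul
    (hg.absolutelyContinuousOnInterval_intervalIntegral (c := 0) (by simp))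
  have hm : ∀ {x : ℝ}, x ∈ uIoc (0 : ℝ) 1 → x ∈ uIcc (0 : ℝ) 1 := fun hx => uIoc_subset_uIcc hx
  have e1 : ∫ x in (0 : ℝ)..1, (∫ t in (0 : ℝ)..x, f t) * g x =
      ∫ x in (0 : ℝ)..1, (∫ t in (0 : ℝ)..x, f t) * deriv (fun x => ∫ t in (0 : ℝ)..x, g t) x := by
    refine intervalIntegral.integral_congr_ae ?_
    filter_upwards [hg.ae_hasDerivAt_integral] with x hx hx'
    rw [(hx (hm hx') 0 (by simp)).deriv]
  have e2 : ∫ x in (0 : ℝ)..1, f x * (∫ t in (0 : ℝ)..x, g t) =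
      ∫ x in (0 : ℝ)..1, deriv (fun x => ∫ t in (0 : ℝ)..x, f t) x * ∫ t in (0 : ℝ)..x, g t := by
    refine intervalIntegral.integral_congr_ae ?_
    filter_upwards [hf.ae_hasDerivAt_integral] with x hx hx'
    rw [(hx (hm hx') 0 (by simp)).deriv]
  rw [e1, h, e2]
  simp

theorem sq_rpow_neg_half {r : ℝ} (hr : 0 < r) (a : ℝ) :
    r ^ (-(a / 2)) * r ^ (-(a / 2)) = r ^ (-a) := by
  rw [← Real.rpow_add hr]
  congr 1
  ring

theorem rpow_half_mul_neg_half {r : ℝ} (hr : 0 < r) (a : ℝ) :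
    r ^ (a / 2) * r ^ (-(a / 2)) = 1 := by
  rw [← Real.rpow_add hr]
  simp

theorem memLp_weighted_flux {a : ℝ} (ha : a < 1) {q : ℝ → ℝ} (hq : Continuous q) :
    MemLp (fun r => r ^ (-(a / 2)) * q r) 2 (volume.restrict (Ioo (0 : ℝ) 1)) := by
  have hm : AEStronglyMeasurable (fun r : ℝ => r ^ (-(a / 2)) * q r)
      (volume.restrict (Ioo (0 : ℝ) 1)) :=
    ((measurable_id.pow_const _).mul hq.measurable).aestronglyMeasurable
  rw [memLp_two_iff_integrable_sq hm]
  have h1 : IntervalIntegrable (fun r => r ^ (-a) * (q r * q r)) volume 0 1 :=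
    (intervalIntegral.intervalIntegrable_rpow' (by linarith)).mul_continuousOn
      (hq.mul hq).continuousOn
  rw [intervalIntegrable_iff_integrableOn_Ioo_of_le zero_le_one] at h1
  refine Integrable.congr h1 ?_
  filter_upwards [ae_restrict_mem measurableSet_Ioo] with r hr
  rw [← sq_rpow_neg_half hr.1]
  ring

/-- The pairs `(ψ, r ^ (a / 2) ψ')` with `ψ ∈ C₀^∞(0,1)`. -/
def testGraphI (a : ℝ) : Submodule ℝ (WithLp 2 (L2I × L2I)) where
  carrier := {x | ∃ ψ : ℝ → ℝ, IsTestFunction (Ioo 0 1) ψ ∧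
    (x.fst =ᵐ[volume.restrict (Ioo 0 1)] ψ) ∧
    (x.snd =ᵐ[volume.restrict (Ioo 0 1)] fun r => r ^ (a / 2) * deriv ψ r)}
  zero_mem' := by
    refine ⟨fun _ => 0, ⟨contDiff_const, HasCompactSupport.zero, by simp [tsupport]⟩, ?_, ?_⟩
    · exact Lp.coeFn_zero ℝ 2 _
    · simp only [deriv_const', mul_zero]
      exact Lp.coeFn_zero ℝ 2 _
  add_mem' := by
    rintro x y ⟨ψ, hψ, h1, h2⟩ ⟨ξ, hξ, h3, h4⟩
    refine ⟨_, hψ.add hξ, ?_, ?_⟩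
    · filter_upwards [Lp.coeFn_add x.fst y.fst, h1, h3] with r h5 h6 h7
      rw [WithLp.add_fst, h5, Pi.add_apply, h6, h7]
    · filter_upwards [Lp.coeFn_add x.snd y.snd, h2, h4] with r h5 h6 h7
      rw [WithLp.add_snd, h5, Pi.add_apply, h6, h7,
        ((hψ.hasDerivAt r).fun_add (hξ.hasDerivAt r)).deriv]
      ring
  smul_mem' := by
    rintro c x ⟨ψ, hψ, h1, h2⟩
    refine ⟨_, hψ.mul_left (contDiff_const (c := c)), ?_, ?_⟩
    · filter_upwards [Lp.coeFn_smul c x.fst, h1] with r h5 h6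
      rw [WithLp.smul_fst, h5, Pi.smul_apply, h6, smul_eq_mul]
    · filter_upwards [Lp.coeFn_smul c x.snd, h2] with r h5 h6
      rw [WithLp.smul_snd, h5, Pi.smul_apply, h6, smul_eq_mul,
        ((hψ.hasDerivAt r).const_mul c).deriv]
      ring

theorem IsMode.primitive {a l : ℝ} {e q : ℝ → ℝ} (h : IsMode a l e q) (ha : a < 1) {x : ℝ}
    (hx : x ∈ Icc (0 : ℝ) 1) : ∫ t in (0 : ℝ)..x, t ^ (-a) * q t = e x := by
  rw [intervalIntegral.integral_eq_sub_of_hasDerivAt_of_le hx.1 h.cont.continuousOn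
    (fun t ht => h.hasDerivAt t ⟨ht.1, ht.2.trans_le hx.2⟩)
    ((h.intervalIntegrable_deriv ha).mono_set (by
      rw [uIcc_of_le hx.1, uIcc_of_le zero_le_one]; exact Icc_subset_Icc_right hx.2)), h.zero,
    sub_zero]

/-- A pair orthogonal to all `(ψ, r ^ (a / 2) ψ')`, `ψ ∈ C₀^∞(0,1)`, is of the form
`(f, r ^ (-a / 2) (C + ∫₀ʳ f))`. -/
theorem exists_primitive_of_orthogonal {a : ℝ} (ha0 : 0 ≤ a) {f h : L2I}
    (H : ∀ ψ : ℝ → ℝ, IsTestFunction (Ioo 0 1) ψ →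
      (∫ r in (0 : ℝ)..1, f r * ψ r) + ∫ r in (0 : ℝ)..1, h r * (r ^ (a / 2) * deriv ψ r) = 0) :
    ∃ C : ℝ, ∀ᵐ r ∂volume.restrict (Ioo (0 : ℝ) 1),
      r ^ (a / 2) * h r = C + ∫ t in (0 : ℝ)..r, f t := by
  have hfi : IntervalIntegrable f volume 0 1 :=
    (intervalIntegrable_iff_integrableOn_Ioo_of_le zero_le_one).2
      ((Lp.memLp f).integrable (by norm_num))
  have hcw : Continuous fun r : ℝ => r ^ (a / 2) := Real.continuous_rpow_const (by linarith)
  have hh0 : IntervalIntegrable h volume 0 1 :=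
    (intervalIntegrable_iff_integrableOn_Ioo_of_le zero_le_one).2
      ((Lp.memLp h).integrable (by norm_num))
  have hhi : IntervalIntegrable (fun r => r ^ (a / 2) * h r) volume 0 1 :=
    hh0.continuousOn_mul hcw.continuousOn
  have hFc : ContinuousOn (fun r => ∫ t in (0 : ℝ)..r, f t) (uIcc 0 1) :=
    (hfi.absolutelyContinuousOnInterval_intervalIntegral (c := 0) (by simp)).continuousOn
  have hFi : IntervalIntegrable (fun r => ∫ t in (0 : ℝ)..r, f t) volume 0 1 :=
    hFc.intervalIntegrable
  -- After integrating f ψ by parts, orthogonality says that r^(a/2) h minus the primitive of f has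
  -- zero weak derivative.
  obtain ⟨C, hC⟩ := ae_const_of_integral_deriv_mul_eq_zero zero_lt_one
    (f := fun r => r ^ (a / 2) * h r - ∫ t in (0 : ℝ)..r, f t)
    ((intervalIntegrable_iff_integrableOn_Ioo_of_le zero_le_one).1 (hhi.sub hFi)) (by
      intro ψ hψ
      have hψi : IntervalIntegrable (deriv ψ) volume 0 1 :=
        hψ.deriv.continuous.intervalIntegrable _ _
      have hprim : ∀ x, ∫ t in (0 : ℝ)..x, deriv ψ t = ψ x := fun x => by
        rw [intervalIntegral.integral_deriv_eq_sub (fun x _ => (hψ.hasDerivAt x).differentiableAt)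
          (hψ.deriv.continuous.intervalIntegrable _ _), hψ.eq_zero (x := 0) (by simp), sub_zero]
      have h1 := integral_primitive_mul hfi hψi
      simp only [hprim, hψ.eq_zero (x := 1) (by simp), mul_zero, zero_sub] at h1
      have h2 := H ψ hψ
      rw [integral_Ioo_eq_interval zero_le_one]
      have e : ∀ r, deriv ψ r * (r ^ (a / 2) * h r - ∫ t in (0 : ℝ)..r, f t) =
          h r * (r ^ (a / 2) * deriv ψ r) - (∫ t in (0 : ℝ)..r, f t) * deriv ψ r := fun r => by ring
      simp only [e]
      rw [intervalIntegral.integral_sub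
        (hh0.mul_continuousOn (g := fun r => r ^ (a / 2) * deriv ψ r)
          (hcw.mul hψ.deriv.continuous).continuousOn)
        (hFi.mul_continuousOn hψ.deriv.continuous.continuousOn), h1]
      linarith)
  refine ⟨C, ?_⟩
  filter_upwards [hC] with r hr
  linarith

/-- Duality replaces any cutoff near r = 0: the closure is the double orthogonal complement. A pair
orthogonal to the test graph has the form (f, r^(-a/2)(C + ∫₀ʳ f)), and its product with the graph
of the mode vanishes after one integration by parts, because the mode is zero at both ends. -/
theorem IsMode.mem_closure {a l : ℝ} {e q : ℝ → ℝ} (hm : IsMode a l e q) (ha0 : 0 ≤ a)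
    (ha : a < 1) :
    WithLp.toLp 2 ((memLp_Ioo_of_continuousOn hm.cont.continuousOn).toLp,
      (memLp_weighted_flux ha hm.cont_flux).toLp) ∈ closure (testGraphI a : Set _) := by
  rw [← Submodule.topologicalClosure_coe, ← Submodule.orthogonal_orthogonal_eq_closure,
    SetLike.mem_coe, Submodule.mem_orthogonal]
  intro x hx
  rw [Submodule.mem_orthogonal] at hx
  set f : L2I := x.fst with hf
  set h : L2I := x.snd with hh
  have hcw : Continuous fun r : ℝ => r ^ (a / 2) := Real.continuous_rpow_const (by linarith)
  obtain ⟨C, hC⟩ := exists_primitive_of_orthogonal (f := f) (h := h) ha0 (by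
    intro ψ hψ
    have m1 : MemLp ψ 2 (volume.restrict (Ioo (0 : ℝ) 1)) :=
      memLp_Ioo_of_continuousOn hψ.continuous.continuousOn
    have m2 : MemLp (fun r => r ^ (a / 2) * deriv ψ r) 2 (volume.restrict (Ioo (0 : ℝ) 1)) :=
      memLp_Ioo_of_continuousOn (hcw.mul hψ.deriv.continuous).continuousOn
    have h1 := hx (WithLp.toLp 2 (m1.toLp, m2.toLp)) ⟨ψ, hψ, m1.coeFn_toLp, m2.coeFn_toLp⟩
    rw [real_inner_comm, WithLp.prod_inner_apply] at h1
    rw [← L2I_inner_eq (Filter.EventuallyEq.rfl (f := f)) m1.coeFn_toLp,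
      ← L2I_inner_eq (Filter.EventuallyEq.rfl (f := h)) m2.coeFn_toLp]
    exact h1)
  have hfi : IntervalIntegrable f volume 0 1 :=
    (intervalIntegrable_iff_integrableOn_Ioo_of_le zero_le_one).2
      ((Lp.memLp f).integrable (by norm_num))
  rw [WithLp.prod_inner_apply]
  show inner ℝ f _ + inner ℝ h _ = 0
  have h2 : h =ᵐ[volume.restrict (Ioo 0 1)]
      fun r => r ^ (-(a / 2)) * (C + ∫ t in (0 : ℝ)..r, f t) := by
    filter_upwards [hC, ae_restrict_mem measurableSet_Ioo] with r hr hr'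
    rw [← hr, ← mul_assoc, mul_comm (r ^ (-(a / 2))), rpow_half_mul_neg_half hr'.1, one_mul]
  rw [L2I_inner_eq (Filter.EventuallyEq.rfl (f := f)) (MemLp.coeFn_toLp _),
    L2I_inner_eq h2 (MemLp.coeFn_toLp _)]
  have hqi := hm.intervalIntegrable_deriv ha
  have h3 := integral_primitive_mul hfi hqi
  rw [hm.primitive ha ⟨zero_le_one, le_rfl⟩, hm.one, mul_zero, zero_sub] at h3
  have e1 : ∫ r in (0 : ℝ)..1, f r * ∫ t in (0 : ℝ)..r, t ^ (-a) * q t =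
      ∫ r in (0 : ℝ)..1, f r * e r := by
    refine intervalIntegral.integral_congr fun r hr => ?_
    rw [uIcc_of_le zero_le_one] at hr
    simp only [hm.primitive ha hr]
  have e2 : ∫ r in (0 : ℝ)..1, r ^ (-(a / 2)) * (C + ∫ t in (0 : ℝ)..r, f t) *
      (r ^ (-(a / 2)) * q r) = ∫ r in (0 : ℝ)..1, (C * (r ^ (-a) * q r) +
        (∫ t in (0 : ℝ)..r, f t) * (r ^ (-a) * q r)) := by
    rw [← integral_Ioo_eq_interval zero_le_one, ← integral_Ioo_eq_interval zero_le_one]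
    refine setIntegral_congr_fun measurableSet_Ioo fun r hr => ?_
    have h4 := sq_rpow_neg_half hr.1 a
    rw [← h4]
    ring
  have hFc : ContinuousOn (fun r => ∫ t in (0 : ℝ)..r, f t) (uIcc 0 1) :=
    (hfi.absolutelyContinuousOnInterval_intervalIntegral (c := 0) (by simp)).continuousOn
  rw [e2, intervalIntegral.integral_add (hqi.const_mul C) (hqi.continuousOn_mul hFc),
    intervalIntegral.integral_const_mul, hm.primitive ha ⟨zero_le_one, le_rfl⟩, hm.one, h3, e1]
  ring

/-! ### Tensor products in `L²(Ω)` -/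

theorem measurableSet_Dom : MeasurableSet Dom := measurableSet_Ioo.prod measurableSet_Ioo

theorem restrict_Dom : (volume.restrict Dom : Measure (ℝ × ℝ)) =
    (volume.restrict (Ioo (0 : ℝ) 1)).prod (volume.restrict (Ioo (0 : ℝ) 1)) := by
  rw [Measure.prod_restrict, ← Measure.volume_eq_prod, Dom]

instance : IsProbabilityMeasure (volume.restrict Dom : Measure (ℝ × ℝ)) := by
  rw [restrict_Dom]
  infer_instance

theorem memLp_tensor {f g : ℝ → ℝ} (hf : MemLp f 2 (volume.restrict (Ioo (0 : ℝ) 1)))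
    (hg : MemLp g 2 (volume.restrict (Ioo (0 : ℝ) 1))) :
    MemLp (fun z : ℝ × ℝ => f z.1 * g z.2) 2 (volume.restrict Dom) := by
  rw [restrict_Dom]
  have hm : AEStronglyMeasurable (fun z : ℝ × ℝ => f z.1 * g z.2)
      ((volume.restrict (Ioo (0 : ℝ) 1)).prod (volume.restrict (Ioo (0 : ℝ) 1))) :=
    hf.1.comp_fst.mul hg.1.comp_snd
  rw [memLp_two_iff_integrable_sq hm]
  simp only [mul_pow]
  exact hf.integrable_sq.mul_prod hg.integrable_sq

theorem integral_Dom_mul (f g : ℝ → ℝ) :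
    ∫ z in Dom, f z.1 * g z.2 = (∫ x in (0 : ℝ)..1, f x) * ∫ x in (0 : ℝ)..1, g x := by
  rw [restrict_Dom, integral_prod_mul, integral_Ioo_eq_interval zero_le_one,
    integral_Ioo_eq_interval zero_le_one]

theorem ae_Dom_fst {P : ℝ → Prop} (h : ∀ᵐ x ∂volume.restrict (Ioo (0 : ℝ) 1), P x) :
    ∀ᵐ z ∂(volume.restrict Dom : Measure (ℝ × ℝ)), P z.1 := by
  rw [restrict_Dom]
  exact Measure.quasiMeasurePreserving_fst.ae h

theorem ae_Dom_snd {P : ℝ → Prop} (h : ∀ᵐ x ∂volume.restrict (Ioo (0 : ℝ) 1), P x) :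
    ∀ᵐ z ∂(volume.restrict Dom : Measure (ℝ × ℝ)), P z.2 := by
  rw [restrict_Dom]
  exact Measure.quasiMeasurePreserving_snd.ae h

theorem L2Dom_inner_eq {f g : L2Dom} {f' g' : ℝ × ℝ → ℝ} (hf : f =ᵐ[volume.restrict Dom] f')
    (hg : g =ᵐ[volume.restrict Dom] g') : inner ℝ f g = ∫ z in Dom, f' z * g' z := by
  rw [L2.inner_def]
  refine integral_congr_ae ?_
  filter_upwards [hf, hg] with x h1 h2
  simp [h1, h2, mul_comm]

/-- The function `(θ, r) ↦ f(θ) g(r)`. -/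
def tensor (f g : L2I) : L2Dom := (memLp_tensor (Lp.memLp f) (Lp.memLp g)).toLp

theorem tensor_ae {f g : L2I} {f' g' : ℝ → ℝ} (hf : f =ᵐ[volume.restrict (Ioo 0 1)] f')
    (hg : g =ᵐ[volume.restrict (Ioo 0 1)] g') :
    tensor f g =ᵐ[volume.restrict Dom] fun z => f' z.1 * g' z.2 := by
  filter_upwards [(memLp_tensor (Lp.memLp f) (Lp.memLp g)).coeFn_toLp, ae_Dom_fst hf,
    ae_Dom_snd hg] with z h1 h2 h3
  rw [tensor, h1, h2, h3]

theorem inner_tensor (f g f' g' : L2I) :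
    inner ℝ (tensor f g) (tensor f' g') = inner ℝ f f' * inner ℝ g g' := by
  rw [L2Dom_inner_eq (tensor_ae Filter.EventuallyEq.rfl Filter.EventuallyEq.rfl)
    (tensor_ae Filter.EventuallyEq.rfl Filter.EventuallyEq.rfl),
    L2I_inner_eq (Filter.EventuallyEq.rfl (f := f)) (Filter.EventuallyEq.rfl (f := f')),
    L2I_inner_eq (Filter.EventuallyEq.rfl (f := g)) (Filter.EventuallyEq.rfl (f := g')),
    ← integral_Dom_mul]
  congr 1
  ext z
  ring

theorem norm_tensor (f g : L2I) : ‖tensor f g‖ = ‖f‖ * ‖g‖ := by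
  have h := inner_tensor f g f g
  rw [real_inner_self_eq_norm_sq, real_inner_self_eq_norm_sq, real_inner_self_eq_norm_sq,
    ← mul_pow] at h
  exact (pow_left_inj₀ (norm_nonneg _) (by positivity) two_ne_zero).1 h

/-- `tensor` as a continuous bilinear map. -/
def tensorL : L2I →L[ℝ] L2I →L[ℝ] L2Dom :=
  LinearMap.mkContinuous₂
    (LinearMap.mk₂ ℝ tensor
      (fun f f' g => by
        refine Lp.ext ?_
        filter_upwards [tensor_ae (Lp.coeFn_add f f') (Filter.EventuallyEq.rfl (f := g)),
          Lp.coeFn_add (tensor f g) (tensor f' g),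
          tensor_ae (Filter.EventuallyEq.rfl (f := f)) (Filter.EventuallyEq.rfl (f := g)),
          tensor_ae (Filter.EventuallyEq.rfl (f := f')) (Filter.EventuallyEq.rfl (f := g))]
          with z h1 h2 h3 h4
        rw [h1, h2, Pi.add_apply, Pi.add_apply, h3, h4, add_mul])
      (fun c f g => by
        refine Lp.ext ?_
        filter_upwards [tensor_ae (Lp.coeFn_smul c f) (Filter.EventuallyEq.rfl (f := g)),
          Lp.coeFn_smul c (tensor f g),
          tensor_ae (Filter.EventuallyEq.rfl (f := f)) (Filter.EventuallyEq.rfl (f := g))]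
          with z h1 h2 h3
        rw [h1, h2, Pi.smul_apply, Pi.smul_apply, h3, smul_eq_mul, smul_eq_mul, mul_assoc])
      (fun f g g' => by
        refine Lp.ext ?_
        filter_upwards [tensor_ae (Filter.EventuallyEq.rfl (f := f)) (Lp.coeFn_add g g'),
          Lp.coeFn_add (tensor f g) (tensor f g'),
          tensor_ae (Filter.EventuallyEq.rfl (f := f)) (Filter.EventuallyEq.rfl (f := g)),
          tensor_ae (Filter.EventuallyEq.rfl (f := f)) (Filter.EventuallyEq.rfl (f := g'))]
          with z h1 h2 h3 h4
        rw [h1, h2, Pi.add_apply, Pi.add_apply, h3, h4, mul_add])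
      (fun c f g => by
        refine Lp.ext ?_
        filter_upwards [tensor_ae (Filter.EventuallyEq.rfl (f := f)) (Lp.coeFn_smul c g),
          Lp.coeFn_smul c (tensor f g),
          tensor_ae (Filter.EventuallyEq.rfl (f := f)) (Filter.EventuallyEq.rfl (f := g))]
          with z h1 h2 h3
        rw [h1, h2, Pi.smul_apply, Pi.smul_apply, h3, smul_eq_mul, smul_eq_mul]
        ring))
    1 fun f g => by
      rw [LinearMap.mk₂_apply, norm_tensor, one_mul]

/-- Tensor products of two Hilbert bases are complete. -/
theorem eq_zero_of_inner_tensor {ι ι' : Type} (b : HilbertBasis ι ℝ L2I)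
    (b' : HilbertBasis ι' ℝ L2I) (U : L2Dom) (h : ∀ i j, inner ℝ U (tensor (b i) (b' j)) = 0) :
    U = 0 := by
  have dense_ext : ∀ {κ : Type} (B : HilbertBasis κ ℝ L2I) (L : L2I →L[ℝ] ℝ),
      (∀ i, L (B i) = 0) → L = 0 := by
    intro κ B L hL
    refine ContinuousLinearMap.ext_on
      (Submodule.dense_iff_topologicalClosure_eq_top.2 B.dense_span) ?_
    rintro _ ⟨i, rfl⟩
    simpa using hL i
  have h1 : ∀ j f, inner ℝ U (tensor f (b' j)) = 0 := by
    intro j f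
    have := dense_ext b ((innerSL ℝ U).comp (tensorL.flip (b' j))) fun i => h i j
    exact congrArg (fun L : L2I →L[ℝ] ℝ => L f) this
  have h2 : ∀ f g, inner ℝ U (tensor f g) = 0 := by
    intro f g
    have := dense_ext b' ((innerSL ℝ U).comp (tensorL f)) fun j => h1 j f
    exact congrArg (fun L : L2I →L[ℝ] ℝ => L g) this
  have hUi : Integrable U (volume.restrict Dom) := (Lp.memLp U).integrable (by norm_num)
  -- Indicators of rectangles are themselves tensor products. They form a π-system generating the
  -- Borel sets, so U integrates to zero over every measurable set.
  have hrect : ∀ s t : Set ℝ, MeasurableSet s → MeasurableSet t →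
      ∫ z in s ×ˢ t, U z ∂(volume.restrict Dom) = 0 := by
    intro s t hs ht
    have ms : MemLp (s.indicator fun _ => (1 : ℝ)) 2 (volume.restrict (Ioo (0 : ℝ) 1)) :=
      (memLp_const 1).indicator hs
    have mt : MemLp (t.indicator fun _ => (1 : ℝ)) 2 (volume.restrict (Ioo (0 : ℝ) 1)) :=
      (memLp_const 1).indicator ht
    have h3 := h2 ms.toLp mt.toLp
    rw [L2Dom_inner_eq (Filter.EventuallyEq.rfl (f := U))
      (tensor_ae ms.coeFn_toLp mt.coeFn_toLp)] at h3
    rw [← integral_indicator (hs.prod ht), ← h3]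
    congr 1
    ext z
    by_cases h4 : z.1 ∈ s <;> by_cases h5 : z.2 ∈ t <;> simp [indicator, h4, h5]
  have hall : ∀ S : Set (ℝ × ℝ), MeasurableSet S → ∫ z in S, U z ∂(volume.restrict Dom) = 0 := by
    intro S hS
    induction S, hS using MeasurableSpace.induction_on_inter generateFrom_prod.symm isPiSystem_prod
      with
    | empty => simp
    | basic t ht =>
      obtain ⟨s, hs, t, ht, rfl⟩ := ht
      exact hrect s t hs ht
    | compl t ht h3 =>
      have h4 := integral_add_compl ht hUi
      have h5 := hrect univ univ MeasurableSet.univ MeasurableSet.univ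
      rw [univ_prod_univ, setIntegral_univ] at h5
      linarith
    | iUnion f hd hf h3 =>
      rw [integral_iUnion hf hd hUi.integrableOn]
      simp [h3]
  refine Lp.ext ?_
  have h6 := hUi.ae_eq_zero_of_forall_setIntegral_eq_zero fun S hS _ => hall S hS
  filter_upwards [h6, Lp.coeFn_zero ℝ 2 (volume.restrict Dom)] with z h7 h8
  rw [h7, h8]

/-! ### Product eigenfunctions in `H₀¹(Ω; w)` -/

/-- The graph triple built from a pair of one-dimensional graphs. -/
def graphTensor (x y : WithLp 2 (L2I × L2I)) : GraphSpace :=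
  WithLp.toLp 2 ![tensor x.fst y.fst, tensor x.snd y.fst, tensor x.fst y.snd]

theorem continuous_graphTensor :
    Continuous (Function.uncurry graphTensor) := by
  have ht : Continuous (Function.uncurry tensor) := tensorL.continuous₂
  have h1 : Continuous fun x : WithLp 2 (L2I × L2I) => x.fst :=
    continuous_fst.comp (WithLp.prod_continuous_ofLp 2 L2I L2I)
  have h2 : Continuous fun x : WithLp 2 (L2I × L2I) => x.snd :=
    continuous_snd.comp (WithLp.prod_continuous_ofLp 2 L2I L2I)
  refine (PiLp.continuous_toLp 2 _).comp (continuous_pi fun i => ?_)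
  fin_cases i
  · exact ht.comp ((h1.comp continuous_fst).prodMk (h1.comp continuous_snd))
  · exact ht.comp ((h2.comp continuous_fst).prodMk (h1.comp continuous_snd))
  · exact ht.comp ((h1.comp continuous_fst).prodMk (h2.comp continuous_snd))

theorem IsTestFunction.tensor {u v : ℝ → ℝ} (hu : IsTestFunction (Ioo 0 1) u)
    (hv : IsTestFunction (Ioo 0 1) v) : IsTestFunction Dom fun z => u z.1 * v z.2 := by
  have hsub : tsupport (fun z : ℝ × ℝ => u z.1 * v z.2) ⊆ tsupport u ×ˢ tsupport v := by
    refine closure_minimal (fun z hz => ?_) ((isClosed_tsupport u).prod (isClosed_tsupport v))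
    have := mul_ne_zero_iff.1 (Function.mem_support.1 hz)
    exact ⟨subset_tsupport _ this.1, subset_tsupport _ this.2⟩
  exact ⟨(hu.contDiff.comp contDiff_fst).mul (hv.contDiff.comp contDiff_snd),
    (hu.hasCompactSupport.prod hv.hasCompactSupport).of_isClosed_subset (isClosed_tsupport _) hsub,
    hsub.trans (prod_mono hu.tsupport_subset hv.tsupport_subset)⟩

theorem hasFDerivAt_tensor {u v : ℝ → ℝ} {u' v' : ℝ} {z : ℝ × ℝ} (hu : HasDerivAt u u' z.1)
    (hv : HasDerivAt v v' z.2) (w : ℝ × ℝ) :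
    fderiv ℝ (fun z : ℝ × ℝ => u z.1 * v z.2) z w = u' * v z.2 * w.1 + u z.1 * v' * w.2 := by
  have h1 : HasFDerivAt (fun z : ℝ × ℝ => u z.1) _ z :=
    hu.hasFDerivAt.comp z (hasFDerivAt_fst (𝕜 := ℝ) (p := z))
  have h2 : HasFDerivAt (fun z : ℝ × ℝ => v z.2) _ z :=
    hv.hasFDerivAt.comp z (hasFDerivAt_snd (𝕜 := ℝ) (p := z))
  rw [(h1.fun_mul h2).fderiv]
  simp
  ring

theorem graphTensor_mem_testGraph {α : ℝ} {x y : WithLp 2 (L2I × L2I)} (hx : x ∈ testGraphI 0)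
    (hy : y ∈ testGraphI α) : graphTensor x y ∈ testGraph α := by
  obtain ⟨u, hu, hu1, hu2⟩ := hx
  obtain ⟨v, hv, hv1, hv2⟩ := hy
  refine ⟨_, hu.tensor hv, tensor_ae hu1 hv1, (tensor_ae hu2 hv1).trans ?_,
    (tensor_ae hu1 hv2).trans ?_⟩
  · refine Filter.Eventually.of_forall fun z => ?_
    simp only [hasFDerivAt_tensor (hu.hasDerivAt z.1) (hv.hasDerivAt z.2)]
    simp
  · refine Filter.Eventually.of_forall fun z => ?_
    simp only [hasFDerivAt_tensor (hu.hasDerivAt z.1) (hv.hasDerivAt z.2)]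
    ring

/-- The `L²(0,1)` class of a mode. -/
def IsMode.val {a l : ℝ} {e q : ℝ → ℝ} (h : IsMode a l e q) : L2I :=
  (memLp_Ioo_of_continuousOn h.cont.continuousOn).toLp

/-- The `L²(0,1)` class of `r ^ (a / 2) e' = r ^ (-a / 2) q`. -/
def IsMode.wder {a l : ℝ} {e q : ℝ → ℝ} (h : IsMode a l e q) (ha : a < 1) : L2I :=
  (memLp_weighted_flux ha h.cont_flux).toLp

/-- Products of test graphs are test graphs, and `graphTensor` is jointly continuous, so
one-dimensional approximability passes to products. The θ factor is the unweighted case a = 0. -/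
theorem graphTensor_mem_H01 {α k l : ℝ} {s p e q : ℝ → ℝ} (hα0 : 0 ≤ α) (hα : α < 1)
    (hs : IsMode 0 k s p) (he : IsMode α l e q) :
    graphTensor (WithLp.toLp 2 (hs.val, hs.wder zero_lt_one))
      (WithLp.toLp 2 (he.val, he.wder hα)) ∈ H01 α := by
  have h := map_mem_closure₂ continuous_graphTensor (hs.mem_closure le_rfl zero_lt_one)
    (he.mem_closure hα0 hα) fun x hx y hy => graphTensor_mem_testGraph hx hy
  exact closure_mono Submodule.subset_span h

/-- The eigenfunction `s(θ) e(r)` of `-div(A∇)` as an element of `H₀¹(Ω; w)`. -/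
def prodMode {α k l : ℝ} {s p e q : ℝ → ℝ} (hα0 : 0 ≤ α) (hα : α < 1)
    (hs : IsMode 0 k s p) (he : IsMode α l e q) : H01 α :=
  ⟨_, graphTensor_mem_H01 hα0 hα hs he⟩

section

variable {α k l : ℝ} {s p e q : ℝ → ℝ} (hα0 : 0 ≤ α) (hα : α < 1) (hs : IsMode 0 k s p)
  (he : IsMode α l e q)

theorem IsMode.val_ae {a l : ℝ} {e q : ℝ → ℝ} (h : IsMode a l e q) :
    h.val =ᵐ[volume.restrict (Ioo 0 1)] e := MemLp.coeFn_toLp _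

theorem IsMode.wder_ae {a l : ℝ} {e q : ℝ → ℝ} (h : IsMode a l e q) (ha : a < 1) :
    h.wder ha =ᵐ[volume.restrict (Ioo 0 1)] fun r => r ^ (-(a / 2)) * q r := MemLp.coeFn_toLp _

theorem prodMode_val_ae : H01.val α (prodMode hα0 hα hs he) =ᵐ[volume.restrict Dom]
    fun z => s z.1 * e z.2 := tensor_ae hs.val_ae he.val_ae

theorem prodMode_dTheta_ae : H01.dTheta α (prodMode hα0 hα hs he) =ᵐ[volume.restrict Dom]
    fun z => p z.1 * e z.2 := by
  refine (tensor_ae (hs.wder_ae zero_lt_one) he.val_ae).trans ?_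
  refine Filter.Eventually.of_forall fun z => ?_
  simp

theorem prodMode_wdR_ae : H01.wdR α (prodMode hα0 hα hs he) =ᵐ[volume.restrict Dom]
    fun z => s z.1 * (z.2 ^ (-(α / 2)) * q z.2) := tensor_ae hs.val_ae (he.wder_ae hα)

end

/-! ### Green's formula for product eigenfunctions -/

theorem integrableOn_Dom {F : ℝ × ℝ → ℝ} (hF : Continuous F) : IntegrableOn F Dom :=
  (hF.continuousOn.integrableOn_compact (isCompact_Icc.prod isCompact_Icc)).mono_set
    (prod_mono Ioo_subset_Icc_self Ioo_subset_Icc_self)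

theorem integral_Dom_eq {F : ℝ × ℝ → ℝ} (hF : Continuous F) :
    ∫ z in Dom, F z = ∫ x in (0 : ℝ)..1, ∫ y in (0 : ℝ)..1, F (x, y) := by
  have h := integrableOn_Dom hF
  rw [Dom, Measure.volume_eq_prod] at h ⊢
  rw [setIntegral_prod _ h]
  simp only [integral_Ioo_eq_interval zero_le_one]

theorem integral_Dom_eq_swap {F : ℝ × ℝ → ℝ} (hF : Continuous F) :
    ∫ z in Dom, F z = ∫ y in (0 : ℝ)..1, ∫ x in (0 : ℝ)..1, F (x, y) := by
  rw [← integral_Dom_eq (F := fun z => F (z.2, z.1)) (by fun_prop)]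
  have h := integrableOn_Dom hF
  rw [Dom, Measure.volume_eq_prod] at h ⊢
  exact (setIntegral_prod_swap (Ioo (0 : ℝ) 1) (Ioo (0 : ℝ) 1) F).symm

section

variable {ψ : ℝ × ℝ → ℝ} {S : Set (ℝ × ℝ)}

theorem IsTestFunction.continuous_fderiv (hψ : IsTestFunction S ψ) (w : ℝ × ℝ) :
    Continuous fun z => fderiv ℝ ψ z w :=
  (hψ.contDiff.continuous_fderiv (by simp)).clm_apply continuous_const

theorem IsTestFunction.hasDerivAt_fst (hψ : IsTestFunction S ψ) (x y : ℝ) :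
    HasDerivAt (fun x => ψ (x, y)) (fderiv ℝ ψ (x, y) (1, 0)) x :=
  ((hψ.contDiff.differentiable (by simp)) (x, y)).hasFDerivAt.comp_hasDerivAt x
    ((hasDerivAt_id x).prodMk (hasDerivAt_const x y))

theorem IsTestFunction.hasDerivAt_snd (hψ : IsTestFunction S ψ) (x y : ℝ) :
    HasDerivAt (fun y => ψ (x, y)) (fderiv ℝ ψ (x, y) (0, 1)) y :=
  ((hψ.contDiff.differentiable (by simp)) (x, y)).hasFDerivAt.comp_hasDerivAt y
    ((hasDerivAt_const y x).prodMk (hasDerivAt_id y))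

variable {α k l : ℝ} {s p e q : ℝ → ℝ}

/-- Integration by parts in θ on each horizontal line; the test function vanishes on both vertical
sides. -/
theorem integral_dTheta_test (hs : IsMode 0 k s p) (he : Continuous e)
    (hψ : IsTestFunction (Ioo 0 1 ×ˢ Ioi 0) ψ) :
    ∫ z in Dom, p z.1 * e z.2 * fderiv ℝ ψ z (1, 0) = k * ∫ z in Dom, s z.1 * e z.2 * ψ z := by
  have c1 := hs.cont
  have c2 := hs.cont_flux
  have c3 := hψ.continuous
  have c4 := hψ.continuous_fderiv (1, 0)
  rw [integral_Dom_eq_swap (by fun_prop), integral_Dom_eq_swap (by fun_prop),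
    ← intervalIntegral.integral_const_mul]
  refine intervalIntegral.integral_congr fun y _ => ?_
  have key := integral_eq_sub_of_continuous (F := fun x => e y * (p x * ψ (x, y)))
    (f := fun x => p x * e y * fderiv ℝ ψ (x, y) (1, 0) - k * (s x * e y * ψ (x, y)))
    (by fun_prop) (by fun_prop) fun x hx =>
      (((hs.hasDerivAt_flux x hx).fun_mul (hψ.hasDerivAt_fst x y)).const_mul (e y)).congr_deriv
        (by ring)
  rw [intervalIntegral.integral_sub (Continuous.intervalIntegrable (by fun_prop) _ _)
      (Continuous.intervalIntegrable (by fun_prop) _ _), intervalIntegral.integral_const_mul,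
    hψ.eq_zero (x := (0, y)) (by simp), hψ.eq_zero (x := (1, y)) (by simp)] at key
  simp only at key ⊢
  linarith

/-- Integration by parts in r. The test function vanishes at r = 0 but may be nonzero at r = 1,
where the flux q 1 is the normal derivative of the mode. -/
theorem integral_dR_test (hs : Continuous s) (he : IsMode α l e q)
    (hψ : IsTestFunction (Ioo 0 1 ×ˢ Ioi 0) ψ) :
    ∫ z in Dom, s z.1 * q z.2 * fderiv ℝ ψ z (0, 1) = (l * ∫ z in Dom, s z.1 * e z.2 * ψ z) +
      ∫ x in (0 : ℝ)..1, s x * q 1 * ψ (x, 1) := by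
  have c1 := he.cont
  have c2 := he.cont_flux
  have c3 := hψ.continuous
  have c4 := hψ.continuous_fderiv (0, 1)
  have c5 : Continuous fun x : ℝ => ∫ y in (0 : ℝ)..1, s x * e y * ψ (x, y) :=
    intervalIntegral.continuous_parametric_intervalIntegral_of_continuous'
      (f := fun x y => s x * e y * ψ (x, y)) (by unfold Function.uncurry; fun_prop) 0 1
  rw [integral_Dom_eq (by fun_prop), integral_Dom_eq (by fun_prop),
    ← intervalIntegral.integral_const_mul, ← intervalIntegral.integral_add
      (Continuous.intervalIntegrable (u := fun x => l * ∫ y in (0 : ℝ)..1, s x * e y * ψ (x, y))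
        (continuous_const.mul c5) _ _)
      (Continuous.intervalIntegrable (by fun_prop) _ _)]
  refine intervalIntegral.integral_congr fun x _ => ?_
  have key := integral_eq_sub_of_continuous (F := fun y => s x * (q y * ψ (x, y)))
    (f := fun y => s x * q y * fderiv ℝ ψ (x, y) (0, 1) - l * (s x * e y * ψ (x, y)))
    (by fun_prop) (by fun_prop) fun y hy =>
      (((he.hasDerivAt_flux y hy).fun_mul (hψ.hasDerivAt_snd x y)).const_mul (s x)).congr_deriv
        (by ring)
  rw [intervalIntegral.integral_sub (Continuous.intervalIntegrable (by fun_prop) _ _)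
      (Continuous.intervalIntegrable (by fun_prop) _ _), intervalIntegral.integral_const_mul,
    hψ.eq_zero (x := (x, 0)) (by simp)] at key
  simp only at key ⊢
  linarith

theorem aForm_eq_inner (u v : H01 α) : aForm u v =
    inner ℝ (H01.dTheta α u) (H01.dTheta α v) + inner ℝ (H01.wdR α u) (H01.wdR α v) := by
  rw [L2Dom_inner_eq Filter.EventuallyEq.rfl Filter.EventuallyEq.rfl,
    L2Dom_inner_eq Filter.EventuallyEq.rfl Filter.EventuallyEq.rfl, ← integral_add]
  · rfl
  · exact (Lp.memLp (H01.dTheta α u)).integrable_mul (Lp.memLp (H01.dTheta α v))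
  · exact (Lp.memLp (H01.wdR α u)).integrable_mul (Lp.memLp (H01.wdR α v))

/-- `s(θ) e(r)` is an eigenfunction of `-div(A∇)` with eigenvalue `k + l`. -/
theorem aForm_prodMode (hα0 : 0 ≤ α) (hα : α < 1) (hs : IsMode 0 k s p) (he : IsMode α l e q)
    (u : H01 α) : aForm u (prodMode hα0 hα hs he) =
      (k + l) * inner ℝ (H01.val α u) (H01.val α (prodMode hα0 hα hs he)) := by
  set E := prodMode hα0 hα hs he with hE
  -- The claim says that this continuous functional vanishes on u. Its kernel is closed, so it is
  -- enough to check test functions, for which the boundary term on r = 1 is absent.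
  let L : GraphSpace →L[ℝ] ℝ :=
    (innerSL ℝ (H01.dTheta α E)).comp (PiLp.proj 2 (fun _ : Fin 3 => L2Dom) 1) +
      (innerSL ℝ (H01.wdR α E)).comp (PiLp.proj 2 (fun _ : Fin 3 => L2Dom) 2) -
      (k + l) • (innerSL ℝ (H01.val α E)).comp (PiLp.proj 2 (fun _ : Fin 3 => L2Dom) 0)
  have hL : ∀ V : GraphSpace, L V = inner ℝ (V 1) (H01.dTheta α E) +
      inner ℝ (V 2) (H01.wdR α E) - (k + l) * inner ℝ (V 0) (H01.val α E) := by
    intro V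
    rw [real_inner_comm, real_inner_comm _ (V 2), real_inner_comm _ (V 0)]
    rfl
  have hle : H01 α ≤ LinearMap.ker L.toLinearMap := by
    refine Submodule.topologicalClosure_minimal _ ?_ (ContinuousLinearMap.isClosed_ker L)
    refine Submodule.span_le.2 fun V hV => ?_
    obtain ⟨ψ, hψ, h0, h1, h2⟩ := hV
    have hψ' : IsTestFunction (Ioo 0 1 ×ˢ Ioi 0) ψ :=
      ⟨hψ.contDiff, hψ.hasCompactSupport,
        hψ.tsupport_subset.trans (prod_mono le_rfl fun x hx => hx.1)⟩
    show L V = 0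
    rw [hL, L2Dom_inner_eq h1 (prodMode_dTheta_ae hα0 hα hs he),
      L2Dom_inner_eq h2 (prodMode_wdR_ae hα0 hα hs he),
      L2Dom_inner_eq h0 (prodMode_val_ae hα0 hα hs he)]
    have e1 := integral_dTheta_test hs he.cont hψ'
    have e2 := integral_dR_test hs.cont he hψ'
    have e3 : ∫ x in (0 : ℝ)..1, s x * q 1 * ψ (x, 1) = 0 := by
      refine intervalIntegral.integral_zero_ae (Filter.Eventually.of_forall fun x _ => ?_)
      rw [hψ.eq_zero (x := (x, 1)) (by simp [Dom]), mul_zero]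
    have e4 : ∫ z in Dom, z.2 ^ (α / 2) * fderiv ℝ ψ z (0, 1) *
        (s z.1 * (z.2 ^ (-(α / 2)) * q z.2)) =
        ∫ z in Dom, s z.1 * q z.2 * fderiv ℝ ψ z (0, 1) := by
      refine setIntegral_congr_fun measurableSet_Dom fun z hz => ?_
      have := rpow_half_mul_neg_half hz.2.1 α
      linear_combination (s z.1 * q z.2 * fderiv ℝ ψ z (0, 1)) * this
    rw [e4, e2, e3]
    simp only [mul_comm (fderiv ℝ ψ _ (1, 0)), mul_comm (ψ _)]
    rw [e1]
    ring
  have h3 : L (u : GraphSpace) = 0 := hle u.2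
  rw [hL] at h3
  rw [aForm_eq_inner]
  have h4 : inner ℝ (H01.dTheta α u) (H01.dTheta α E) + inner ℝ (H01.wdR α u) (H01.wdR α E) -
    (k + l) * inner ℝ (H01.val α u) (H01.val α E) = 0 := h3
  linarith

end

theorem H01.inner_eq {α : ℝ} (u v : H01 α) :
    inner ℝ u v = inner ℝ (H01.val α u) (H01.val α v) + aForm u v := by
  rw [aForm_eq_inner, Submodule.coe_inner, PiLp.inner_apply, Fin.sum_univ_three, add_assoc]
  rfl

/-- An element of `H₀¹(Ω; w)` is determined by its function. -/
theorem H01.eq_zero_of_val_eq_zero {α : ℝ} {u : H01 α} (hu : H01.val α u = 0) : u = 0 := by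
  have hD : IsOpen Dom := isOpen_Ioo.prod isOpen_Ioo
  have hval : H01.val α u =ᵐ[volume.restrict Dom] 0 := by
    rw [hu]
    exact Lp.coeFn_zero ℝ 2 _
  have h0 : ∀ w : ℝ × ℝ → ℝ, ∫ z in Dom, H01.val α u z * w z = 0 := by
    intro w
    refine integral_eq_zero_of_ae ?_
    filter_upwards [hval] with z hz
    simp [hz]
  have zero_of : ∀ (V : L2Dom), (∀ χ : ℝ × ℝ → ℝ, IsTestFunction Dom χ →
      ∫ z in Dom, V z * χ z = 0) → V = 0 := by
    intro V hV
    have key := hD.ae_eq_zero_of_integral_contDiff_smul_eq_zero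
      (μ := volume.restrict Dom) (f := V)
      (((Lp.memLp V).integrable (by norm_num)).locallyIntegrable.locallyIntegrableOn _)
      (fun χ h1 h2 h3 => by
        simpa only [smul_eq_mul, mul_comm] using hV χ ⟨h1, h2, h3⟩)
    refine Lp.ext ?_
    filter_upwards [key, ae_restrict_mem measurableSet_Dom,
      Lp.coeFn_zero ℝ 2 (volume.restrict Dom)] with z h1 h2 h3
    rw [h1 h2, h3, Pi.zero_apply]
  have hT : H01.dTheta α u = 0 := by
    refine zero_of _ fun χ hχ => ?_
    have := (H01.weak_gradient u hχ).1
    rw [h0] at this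
    linarith
  have hR : H01.wdR α u = 0 := by
    refine zero_of _ fun χ hχ => ?_
    -- The weak derivative formula pairs the third component with r^(-α/2) χ. Multiplying the test
    -- function by r^(α/2), smooth near its support, undoes this weight.
    have hw : ContDiff ℝ ∞ fun z : ℝ × ℝ => z.2 ^ (α / 2) * χ z := by
      rw [contDiff_iff_contDiffAt]
      intro z
      by_cases hz : z ∈ tsupport χ
      · have hz0 : z.2 ≠ 0 := (hχ.tsupport_subset hz).2.1.ne'
        exact ((Real.contDiffAt_rpow_const_of_ne hz0).comp z contDiffAt_snd).mul
          hχ.contDiff.contDiffAt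
      · refine (contDiffAt_const (c := (0 : ℝ))).congr_of_eventuallyEq ?_
        filter_upwards [notMem_tsupport_iff_eventuallyEq.1 hz] with x hx
        simp [hx]
    have hχ' : IsTestFunction Dom fun z : ℝ × ℝ => z.2 ^ (α / 2) * χ z :=
      ⟨hw, hχ.hasCompactSupport.mul_left,
        (closure_mono (Function.support_mul_subset_right _ χ)).trans hχ.tsupport_subset⟩
    have h1 := (H01.weak_gradient u hχ').2
    rw [h0] at h1
    have h2 : ∫ z in Dom, H01.wdR α u z * χ z =
        ∫ z in Dom, H01.wdR α u z * (z.2 ^ (-(α / 2)) * (z.2 ^ (α / 2) * χ z)) := by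
      refine setIntegral_congr_fun measurableSet_Dom fun z hz => ?_
      have := rpow_half_mul_neg_half hz.2.1 α
      linear_combination (-(H01.wdR α u z * χ z)) * this
    rw [h2]
    linarith
  have h1 : inner ℝ u u = 0 := by
    rw [H01.inner_eq, aForm_eq_inner, hu, hT, hR]
    simp
  exact inner_self_eq_zero.1 h1

/-! ### The eigenbasis of `-div(A∇)` -/

theorem H01.inner_smul_left {α : ℝ} (c : ℝ) (u v : H01 α) :
    inner ℝ (c • u) v = c * inner ℝ u v := real_inner_smul_left u v c

theorem H01.inner_smul_right {α : ℝ} (c : ℝ) (u v : H01 α) :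
    inner ℝ u (c • v) = c * inner ℝ u v := real_inner_smul_right u v c

/-- A complete orthonormal system of product eigenfunctions `s(θ) e(r)`. -/
structure ModeSystem (α : ℝ) (ι : Type) where
  nonneg : 0 ≤ α
  lt_one : α < 1
  (k l : ι → ℝ)
  (s p e q : ι → ℝ → ℝ)
  isMode_s : ∀ i, IsMode 0 (k i) (s i) (p i)
  isMode_e : ∀ i, IsMode α (l i) (e i) (q i)
  one_le : ∀ i, 1 ≤ k i
  pos : ∀ i, 0 < l i
  orthonormal' : Orthonormal ℝ fun i => tensor (isMode_s i).val (isMode_e i).val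
  complete' : ∀ U : L2Dom,
    (∀ i, inner ℝ U (tensor (isMode_s i).val (isMode_e i).val) = 0) → U = 0

/-- Tensor the bases for a = 0 and a = α. The eigenvalue bound 1 - a equals 1 in the angular
variable, which later serves as a Poincaré inequality with constant one. -/
theorem exists_modeSystem {α : ℝ} (hα0 : 0 ≤ α) (hα : α < 1) :
    ∃ (ι : Type) (_ : Countable ι), Nonempty (ModeSystem α ι) := by
  obtain ⟨ι, hι, b, k, s, p, hb⟩ := exists_mode_basis (a := 0) zero_lt_one
  obtain ⟨ι', hι', b', l, e, q, hb'⟩ := exists_mode_basis hα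
  have v1 : ∀ i, (hb i).1.val = b i := fun i =>
    Lp.ext ((hb i).1.val_ae.trans (hb i).2.1.symm)
  have v2 : ∀ i, (hb' i).1.val = b' i := fun i =>
    Lp.ext ((hb' i).1.val_ae.trans (hb' i).2.1.symm)
  refine ⟨ι × ι', inferInstance, ⟨⟨hα0, hα, fun i => k i.1, fun i => l i.2, fun i => s i.1,
    fun i => p i.1, fun i => e i.2, fun i => q i.2, fun i => (hb i.1).1, fun i => (hb' i.2).1,
    fun i => ?_, fun i => ?_, ?_, ?_⟩⟩⟩
  · simpa using (hb i.1).2.2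
  · linarith [(hb' i.2).2.2]
  · simp only [v1, v2]
    refine ⟨fun i => ?_, fun i j hij => ?_⟩
    · rw [norm_tensor, b.orthonormal.1, b'.orthonormal.1, one_mul]
    · simp only [inner_tensor]
      by_cases h : i.1 = j.1
      · have h' : i.2 ≠ j.2 := fun h' => hij (Prod.ext h h')
        rw [b'.orthonormal.2 h', mul_zero]
      · rw [b.orthonormal.2 h, zero_mul]
  · intro U hU
    simp only [v1, v2] at hU
    exact eq_zero_of_inner_tensor b b' U fun i j => hU (i, j)

namespace ModeSystem

variable {α : ℝ} {ι : Type} (M : ModeSystem α ι)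

/-- The eigenfunctions as elements of `H₀¹(Ω; w)`. -/
def mode (i : ι) : H01 α := prodMode M.nonneg M.lt_one (M.isMode_s i) (M.isMode_e i)

/-- The eigenvalues. -/
def eig (i : ι) : ℝ := M.k i + M.l i

/-- The frequencies. -/
def freq (i : ι) : ℝ := Real.sqrt (M.eig i)

theorem one_le_eig (i : ι) : 1 ≤ M.eig i := by
  have := M.one_le i
  have := M.pos i
  unfold eig
  linarith

theorem freq_pos (i : ι) : 0 < M.freq i := Real.sqrt_pos.2 (by linarith [M.one_le_eig i])

theorem freq_sq (i : ι) : M.freq i ^ 2 = M.eig i :=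
  Real.sq_sqrt (by linarith [M.one_le_eig i])

theorem orthonormal : Orthonormal ℝ fun i => H01.val α (M.mode i) := M.orthonormal'

theorem aForm_mode (u : H01 α) (i : ι) :
    aForm u (M.mode i) = M.eig i * inner ℝ (H01.val α u) (H01.val α (M.mode i)) :=
  aForm_prodMode _ _ _ _ u

theorem inner_mode (u : H01 α) (i : ι) :
    inner ℝ u (M.mode i) = (1 + M.eig i) * inner ℝ (H01.val α u) (H01.val α (M.mode i)) := by
  rw [H01.inner_eq, aForm_mode]
  ring

/-- The eigenfunctions as a Hilbert basis of `L²(Ω)`. -/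
def basisL2 : HilbertBasis ι ℝ L2Dom :=
  HilbertBasis.mkOfOrthogonalEqBot M.orthonormal (by
    rw [eq_bot_iff]
    intro U hU
    rw [Submodule.mem_orthogonal'] at hU
    exact M.complete' U fun i => hU _ (Submodule.subset_span ⟨i, rfl⟩))

theorem basisL2_apply (i : ι) : M.basisL2 i = H01.val α (M.mode i) := by
  rw [basisL2, HilbertBasis.coe_mkOfOrthogonalEqBot]

instance : CompleteSpace (H01 α) :=
  (Submodule.isClosed_topologicalClosure _).completeSpace_coe

/-- For eigenfunctions, L² orthogonality carries over to the graph inner product, where the squared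
norm becomes 1 + `M.eig i`. -/
theorem orthonormal_scaled :
    Orthonormal ℝ fun i => (Real.sqrt (1 + M.eig i))⁻¹ • M.mode i := by
  have hpos : ∀ i, 0 < 1 + M.eig i := fun i => by linarith [M.one_le_eig i]
  classical
  rw [orthonormal_iff_ite]
  intro i j
  rw [H01.inner_smul_left, H01.inner_smul_right, M.inner_mode,
    (orthonormal_iff_ite.1 M.orthonormal) i j]
  split_ifs with h
  · subst h
    have h1 := Real.sq_sqrt (hpos i).le
    have h2 := (Real.sqrt_pos.2 (hpos i)).ne'
    simp only [mul_one]
    field_simp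
    exact h1.symm
  · simp

/-- The normalized eigenfunctions as a Hilbert basis of `H₀¹(Ω; w)`. -/
def basisH01 : HilbertBasis ι ℝ (H01 α) :=
  HilbertBasis.mkOfOrthogonalEqBot M.orthonormal_scaled (by
    rw [eq_bot_iff]
    intro u hu
    rw [Submodule.mem_orthogonal'] at hu
    refine H01.eq_zero_of_val_eq_zero (M.complete' _ fun i => ?_)
    have h1 : inner ℝ u ((Real.sqrt (1 + M.eig i))⁻¹ • M.mode i) = 0 :=
      hu _ (Submodule.subset_span ⟨i, rfl⟩)
    have hpos : 0 < 1 + M.eig i := by linarith [M.one_le_eig i]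
    rw [H01.inner_smul_right, M.inner_mode] at h1
    have h2 := (Real.sqrt_pos.2 hpos).ne'
    have h3 := mul_eq_zero.1 h1
    exact (mul_eq_zero.1 (h3.resolve_left (inv_ne_zero h2))).resolve_left hpos.ne')

theorem basisH01_apply (i : ι) :
    M.basisH01 i = (Real.sqrt (1 + M.eig i))⁻¹ • M.mode i := by
  rw [basisH01, HilbertBasis.coe_mkOfOrthogonalEqBot]

/-- The coefficient of a function. -/
def coeff (U : L2Dom) (i : ι) : ℝ := inner ℝ U (H01.val α (M.mode i))

theorem hasSum_coeff_sq (U : L2Dom) : HasSum (fun i => M.coeff U i ^ 2) (‖U‖ ^ 2) := by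
  have h := M.basisL2.hasSum_inner_mul_inner U U
  rw [real_inner_self_eq_norm_sq] at h
  refine h.congr_fun fun i => ?_
  rw [basisL2_apply, real_inner_comm U, coeff]
  ring

theorem inner_basisH01_sq (u : H01 α) (i : ι) :
    inner ℝ u (M.basisH01 i) ^ 2 = (1 + M.eig i) * M.coeff (H01.val α u) i ^ 2 := by
  have hpos : 0 < 1 + M.eig i := by linarith [M.one_le_eig i]
  rw [basisH01_apply, H01.inner_smul_right, M.inner_mode, coeff, mul_pow, inv_pow,
    Real.sq_sqrt hpos.le]
  field_simp

/-- Parseval in H₀¹(Ω; w) minus Parseval in L²(Ω). -/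
theorem hasSum_eig_mul_coeff_sq (u : H01 α) :
    HasSum (fun i => M.eig i * M.coeff (H01.val α u) i ^ 2)
      (‖H01.dTheta α u‖ ^ 2 + ‖H01.wdR α u‖ ^ 2) := by
  have h := M.basisH01.hasSum_inner_mul_inner u u
  have h2 := h.sub (M.hasSum_coeff_sq (H01.val α u))
  rw [H01.inner_eq, aForm_eq_inner, real_inner_self_eq_norm_sq, real_inner_self_eq_norm_sq,
    real_inner_self_eq_norm_sq, add_sub_cancel_left] at h2
  refine h2.congr_fun fun i => ?_
  rw [real_inner_comm u, ← sq, M.inner_basisH01_sq]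
  ring

end ModeSystem

/-- The error of a partial sum of a Hilbert basis expansion. -/
theorem norm_sub_sum_sq_le {ι H : Type} [NormedAddCommGroup H] [InnerProductSpace ℝ H]
    (b : HilbertBasis ι ℝ H) (x : H) {d : ι → ℝ} {S : ℝ} (hd : ∀ i, inner ℝ x (b i) ^ 2 ≤ d i)
    (hS : HasSum d S) (F : Finset ι) :
    ‖x - ∑ i ∈ F, inner ℝ x (b i) • b i‖ ^ 2 ≤ S - ∑ i ∈ F, d i := by
  classical
  set y := x - ∑ i ∈ F, inner ℝ x (b i) • b i with hy
  have h1 := b.hasSum_inner_mul_inner y y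
  rw [real_inner_self_eq_norm_sq] at h1
  have hF : HasSum (fun i => if i ∈ F then d i else 0) (∑ i ∈ F, d i) := by
    have : HasSum (fun i => if i ∈ F then d i else 0) (∑ i ∈ F, if i ∈ F then d i else 0) :=
      hasSum_sum_of_ne_finset_zero fun i hi => if_neg hi
    rwa [Finset.sum_congr rfl fun i hi => if_pos hi] at this
  refine hasSum_le (fun i => ?_) h1 (hS.sub hF)
  -- The residual has no coefficients on F and keeps those of x elsewhere, so its Parseval series is
  -- dominated by the terms d outside F.
  have h2 : inner ℝ y (b i) = if i ∈ F then 0 else inner ℝ x (b i) := by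
    rw [hy, inner_sub_left, sum_inner]
    have : ∀ j ∈ F, inner ℝ (inner ℝ x (b j) • b j) (b i) =
        if j = i then inner ℝ x (b i) else 0 := by
      intro j _
      rw [inner_smul_left, (orthonormal_iff_ite.1 b.orthonormal) j i]
      split_ifs with h
      · subst h; simp
      · simp
    rw [Finset.sum_congr rfl this, Finset.sum_ite_eq' F i]
    split_ifs <;> simp
  rw [real_inner_comm y, h2]
  split_ifs with h
  · simp
  · rw [sub_zero, ← sq]
    exact hd i

namespace ModeSystem

variable {α : ℝ} {ι : Type} (M : ModeSystem α ι)

/-- The factor 2 comes from 1 + `M.eig i` ≤ 2 `M.eig i`. The majorant d is left free so that a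
time-independent one can be used. -/
theorem norm_sub_sum_H01_le (u : H01 α) {d : ι → ℝ} {S : ℝ}
    (hd : ∀ i, M.eig i * M.coeff (H01.val α u) i ^ 2 ≤ d i) (hS : HasSum d S) (F : Finset ι) :
    ‖u - ∑ i ∈ F, M.coeff (H01.val α u) i • M.mode i‖ ^ 2 ≤ 2 * (S - ∑ i ∈ F, d i) := by
  have h := norm_sub_sum_sq_le M.basisH01 u (d := fun i => 2 * d i) (S := 2 * S)
    (fun i => by
      rw [M.inner_basisH01_sq]
      nlinarith [hd i, M.one_le_eig i, sq_nonneg (M.coeff (H01.val α u) i)])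
    (hS.mul_left 2) F
  rw [← Finset.mul_sum, ← mul_sub] at h
  convert h using 5 with i hi
  have hpos : 0 < 1 + M.eig i := by linarith [M.one_le_eig i]
  rw [basisH01_apply, H01.inner_smul_right, M.inner_mode, coeff, smul_smul]
  congr 1
  have h1 := Real.sq_sqrt hpos.le
  have h2 := (Real.sqrt_pos.2 hpos).ne'
  field_simp
  rw [h1]

theorem norm_sub_sum_L2_le (U : L2Dom) {d : ι → ℝ} {S : ℝ}
    (hd : ∀ i, M.coeff U i ^ 2 ≤ d i) (hS : HasSum d S) (F : Finset ι) :
    ‖U - ∑ i ∈ F, M.coeff U i • H01.val α (M.mode i)‖ ^ 2 ≤ S - ∑ i ∈ F, d i := by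
  have h := norm_sub_sum_sq_le M.basisL2 U (d := d) (S := S)
    (fun i => by
      rw [basisL2_apply]
      exact hd i) hS F
  simp only [basisL2_apply] at h
  exact h

end ModeSystem

/-! ### Expansion of weak solutions -/

theorem energy_eq {α : ℝ} (u : H01 α) (v : L2Dom) :
    2 * energy u v = ‖v‖ ^ 2 + (‖H01.dTheta α u‖ ^ 2 + ‖H01.wdR α u‖ ^ 2) := by
  have h : ∀ U : L2Dom, ‖U‖ ^ 2 = ∫ z in Dom, U z ^ 2 := fun U => by
    rw [← real_inner_self_eq_norm_sq, L2Dom_inner_eq Filter.EventuallyEq.rfl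
      Filter.EventuallyEq.rfl]
    simp only [sq]
  have hi : ∀ U : L2Dom, Integrable (fun z => U z ^ 2) (volume.restrict Dom) := fun U =>
    (Lp.memLp U).integrable_sq
  have hi2 : Integrable (fun z => H01.dTheta α u z ^ 2 + H01.wdR α u z ^ 2)
      (volume.restrict Dom) := (hi _).add (hi _)
  rw [h, h, h, energy, integral_add (hi v) hi2, integral_add (hi _) (hi _)]
  ring

namespace ModeSystem

variable {α : ℝ} {ι : Type} (M : ModeSystem α ι)

/-- The coefficients of the solution with initial data `φ0`, `φ1`. -/
def sol (φ0 : H01 α) (φ1 : L2Dom) (i : ι) (t : ℝ) : ℝ :=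
  M.coeff (H01.val α φ0) i * Real.cos (M.freq i * t) +
    M.coeff φ1 i / M.freq i * Real.sin (M.freq i * t)

/-- The time derivatives of the coefficients of the solution. -/
def solt (φ0 : H01 α) (φ1 : L2Dom) (i : ι) (t : ℝ) : ℝ :=
  -(M.coeff (H01.val α φ0) i * M.freq i) * Real.sin (M.freq i * t) +
    M.coeff φ1 i * Real.cos (M.freq i * t)

/-- Twice the energy of a single mode of the solution. -/
def modeEnergy (φ0 : H01 α) (φ1 : L2Dom) (i : ι) : ℝ :=
  M.eig i * M.coeff (H01.val α φ0) i ^ 2 + M.coeff φ1 i ^ 2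

variable (φ0 : H01 α) (φ1 : L2Dom)

theorem modeEnergy_nonneg (i : ι) : 0 ≤ M.modeEnergy φ0 φ1 i := by
  have := M.one_le_eig i
  unfold modeEnergy
  positivity

theorem hasSum_modeEnergy : HasSum (M.modeEnergy φ0 φ1) (2 * energy φ0 φ1) := by
  rw [energy_eq, add_comm]
  exact (M.hasSum_eig_mul_coeff_sq φ0).add (M.hasSum_coeff_sq φ1)

theorem hasDerivAt_sol (i : ι) (t : ℝ) :
    HasDerivAt (M.sol φ0 φ1 i) (M.solt φ0 φ1 i t) t := by
  have h0 := (hasDerivAt_id t).const_mul (M.freq i)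
  have h1 := (Real.hasDerivAt_cos (M.freq i * t)).comp t h0
  have h2 := (Real.hasDerivAt_sin (M.freq i * t)).comp t h0
  have hf := (M.freq_pos i).ne'
  refine ((h1.const_mul (M.coeff (H01.val α φ0) i)).add
    (h2.const_mul (M.coeff φ1 i / M.freq i))).congr_deriv ?_
  unfold solt
  field_simp

theorem hasDerivAt_solt (i : ι) (t : ℝ) :
    HasDerivAt (M.solt φ0 φ1 i) (-(M.eig i * M.sol φ0 φ1 i t)) t := by
  have h0 := (hasDerivAt_id t).const_mul (M.freq i)
  have h1 := (Real.hasDerivAt_cos (M.freq i * t)).comp t h0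
  have h2 := (Real.hasDerivAt_sin (M.freq i * t)).comp t h0
  have hf := (M.freq_pos i).ne'
  refine ((h2.const_mul (-(M.coeff (H01.val α φ0) i * M.freq i))).add
    (h1.const_mul (M.coeff φ1 i))).congr_deriv ?_
  unfold sol
  rw [← M.freq_sq]
  field_simp
  ring

/-- Energy is conserved mode by mode; this supplies the time-independent majorant behind the uniform
convergence of the partial sums. -/
theorem sol_energy (i : ι) (t : ℝ) :
    M.eig i * M.sol φ0 φ1 i t ^ 2 + M.solt φ0 φ1 i t ^ 2 = M.modeEnergy φ0 φ1 i := by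
  have hcs := Real.sin_sq_add_cos_sq (M.freq i * t)
  have hf := (M.freq_pos i).ne'
  unfold sol solt modeEnergy
  rw [← M.freq_sq]
  field_simp
  linear_combination (M.freq i ^ 2 * M.coeff (H01.val α φ0) i ^ 2 + M.coeff φ1 i ^ 2) * hcs

/-- The partial sums of the solution. -/
def partialSol (F : Finset ι) (t : ℝ) : H01 α := ∑ i ∈ F, M.sol φ0 φ1 i t • M.mode i

/-- The partial sums of the time derivative of the solution. -/
def partialSolt (F : Finset ι) (t : ℝ) : L2Dom :=
  ∑ i ∈ F, M.solt φ0 φ1 i t • H01.val α (M.mode i)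

/-- The energy not captured by a partial sum. -/
def tailEnergy (F : Finset ι) : ℝ := 2 * energy φ0 φ1 - ∑ i ∈ F, M.modeEnergy φ0 φ1 i

theorem tendsto_tailEnergy :
    Filter.Tendsto (M.tailEnergy φ0 φ1) Filter.atTop (nhds 0) := by
  have h := (tendsto_const_nhds (x := 2 * energy φ0 φ1)).sub (M.hasSum_modeEnergy φ0 φ1)
  rw [sub_self] at h
  exact h

end ModeSystem

theorem integrableOn_of_memLp {E : Type*} [NormedAddCommGroup E] {T : ℝ} {f : ℝ → E}
    (hf : MemLp f 2 (volume.restrict (Ioo 0 T))) : IntegrableOn f (Ioo 0 T) :=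
  hf.integrable (by norm_num)

theorem IsTestFunction.integrableOn_smul {E : Type*} [NormedAddCommGroup E] [NormedSpace ℝ E]
    {T : ℝ} {u : ℝ → ℝ} {f : ℝ → E} (hu : IsTestFunction (Ioo 0 T) u)
    (hf : IntegrableOn f (Ioo 0 T)) : IntegrableOn (fun x => u x • f x) (Ioo 0 T) := by
  obtain ⟨C, hC⟩ := hu.continuous.bounded_above_of_compact_support hu.hasCompactSupport
  exact hf.bdd_smul C hu.continuous.aestronglyMeasurable (Filter.Eventually.of_forall hC)

theorem integrableOn_clm_comp {X Y : Type*} [NormedAddCommGroup X] [NormedSpace ℝ X]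
    [NormedAddCommGroup Y] [NormedSpace ℝ Y] (L : X →L[ℝ] Y) {f : ℝ → X} {s : Set ℝ}
    (hf : IntegrableOn f s) : IntegrableOn (fun t => L (f t)) s :=
  L.integrable_comp hf

/-- `toHneg1` as a bounded operator. -/
def toHneg1L (α : ℝ) : L2Dom →L[ℝ] Hneg1 α :=
  LinearMap.mkContinuous
    { toFun := toHneg1 α
      map_add' := fun f g => by
        ext v
        exact inner_add_left (𝕜 := ℝ) f g (H01.val α v)
      map_smul' := fun c f => by
        ext v
        exact real_inner_smul_left f (H01.val α v) c }
    ‖H01.val α‖ fun f => by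
      refine (ContinuousLinearMap.opNorm_comp_le _ _).trans ?_
      rw [innerSL_apply_norm, mul_comm]

/-- A bounded linear functional of a weakly differentiable curve is weakly differentiable. -/
theorem HasWeakTimeDeriv.clm_apply {X : Type*} [NormedAddCommGroup X] [NormedSpace ℝ X]
    [CompleteSpace X] {T : ℝ} {u u' : ℝ → X} (h : HasWeakTimeDeriv T u u')
    (hu : IntegrableOn u (Ioo 0 T)) (hu' : IntegrableOn u' (Ioo 0 T)) (L : X →L[ℝ] ℝ)
    {χ : ℝ → ℝ} (hχ : IsTestFunction (Ioo 0 T) χ) :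
    ∫ t in Ioo 0 T, deriv χ t * L (u t) = -∫ t in Ioo 0 T, χ t * L (u' t) := by
  have h1 := congrArg L (h χ hχ)
  rw [map_neg, ← L.integral_comp_comm (hχ.deriv.integrableOn_smul hu),
    ← L.integral_comp_comm (hχ.integrableOn_smul hu')] at h1
  simpa using h1

namespace ModeSystem

variable {α : ℝ} {ι : Type} (M : ModeSystem α ι)

/-- Testing the weak equation with an eigenfunction gives a scalar oscillator of frequency `M.freq
i`. Countability of the modes collects the exceptional times into one null set. -/
theorem coeff_eq_of_isWeakSolution [Countable ι] {T : ℝ} (hT : 0 < T) {φ0 : H01 α} {φ1 : L2Dom}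
    {φ : ℝ → H01 α} {φt : ℝ → L2Dom} {φtt : ℝ → Hneg1 α}
    (h : IsWeakSolution α T φ0 φ1 (fun _ => 0) φ φt φtt) :
    ∀ᵐ t ∂volume.restrict (Ioo 0 T), ∀ i, M.coeff (H01.val α (φ t)) i = M.sol φ0 φ1 i t ∧
      M.coeff (φt t) i = M.solt φ0 φ1 i t := by
  rw [ae_all_iff]
  intro i
  have hφ := integrableOn_of_memLp h.memLp
  have hφt := integrableOn_of_memLp h.memLp_dt
  have hφtt := integrableOn_of_memLp (E := Hneg1 α) h.memLp_dtt
  let L : L2Dom →L[ℝ] ℝ := innerSL ℝ (H01.val α (M.mode i))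
  have hL : ∀ U, L U = M.coeff U i := fun U => by
    rw [coeff, real_inner_comm]; rfl
  -- The second time derivative lives only in the dual space, so it is read through evaluation at
  -- the mode; on the image of L²(Ω) this is again the coefficient.
  let ev : Hneg1 α →L[ℝ] ℝ := ContinuousLinearMap.apply ℝ ℝ (M.mode i)
  have hev : ∀ g, ev (toHneg1 α g) = M.coeff g i := fun g => rfl
  obtain ⟨v, hv, hvφ, hv0⟩ := h.initial
  obtain ⟨w, hw, hwφ, hw0⟩ := h.initial_dt
  have hvalφ : IntegrableOn (fun t => H01.val α (φ t)) (Ioo 0 T) :=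
    (H01.val α).integrable_comp hφ
  have htoφt := integrableOn_clm_comp (Y := Hneg1 α) (toHneg1L α) hφt
  refine ae_eq_harmonic_oscillator hT (M.freq_pos i) (v := fun t => L (v t))
    (v₁ := fun t => ev (w t)) ?_ ?_ ?_ ?_ (L.continuous.comp_continuousOn hv) ?_ ?_
    (ev.continuous.comp_continuousOn hw) ?_ ?_
  · simp only [← hL]
    exact L.integrable_comp hvalφ
  · simp only [← hL]
    exact L.integrable_comp hφt
  · intro χ hχ
    simp only [← hL]
    exact h.weak_dt.clm_apply hvalφ hφt L hχ
  · intro χ hχ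
    have h1 := h.weak_dtt.clm_apply htoφt hφtt ev hχ
    simp only [hev] at h1
    rw [h1, ← integral_const_mul, ← integral_neg]
    refine integral_congr_ae ?_
    filter_upwards [h.equation (M.mode i)] with t ht
    have h2 : φtt t (M.mode i) + aForm (φ t) (M.mode i) = 0 := by
      rw [ht]
      simp
    rw [M.aForm_mode] at h2
    have h3 : ev (φtt t) = φtt t (M.mode i) := rfl
    rw [h3, M.freq_sq, coeff]
    linear_combination (-χ t) * h2
  · filter_upwards [hvφ] with t ht
    rw [ht, hL]
  · simp only [hv0, hL]
  · filter_upwards [hwφ] with t ht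
    rw [ht, hev]
  · simp only [hw0, hev]

/-- A weak solution is the limit of its partial sums, uniformly in time. -/
theorem norm_sub_partialSol_le [Countable ι] {T : ℝ} (hT : 0 < T) {φ0 : H01 α} {φ1 : L2Dom}
    {φ : ℝ → H01 α} {φt : ℝ → L2Dom} {φtt : ℝ → Hneg1 α}
    (h : IsWeakSolution α T φ0 φ1 (fun _ => 0) φ φt φtt) :
    ∀ᵐ t ∂volume.restrict (Ioo 0 T), ∀ F : Finset ι,
      ‖φ t - M.partialSol φ0 φ1 F t‖ ^ 2 ≤ 2 * M.tailEnergy φ0 φ1 F ∧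
      ‖φt t - M.partialSolt φ0 φ1 F t‖ ^ 2 ≤ M.tailEnergy φ0 φ1 F := by
  filter_upwards [M.coeff_eq_of_isWeakSolution hT h] with t ht F
  constructor
  · have h1 := M.norm_sub_sum_H01_le (φ t) (d := M.modeEnergy φ0 φ1) (fun i => by
      rw [(ht i).1, ← M.sol_energy φ0 φ1 i t]
      linarith [sq_nonneg (M.solt φ0 φ1 i t)]) (M.hasSum_modeEnergy φ0 φ1) F
    simp only [fun i => (ht i).1] at h1
    exact h1
  · have h1 := M.norm_sub_sum_L2_le (φt t) (d := M.modeEnergy φ0 φ1) (fun i => by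
      rw [(ht i).2, ← M.sol_energy φ0 φ1 i t]
      have := M.one_le_eig i
      nlinarith [sq_nonneg (M.sol φ0 φ1 i t)]) (M.hasSum_modeEnergy φ0 φ1) F
    simp only [fun i => (ht i).2] at h1
    exact h1

end ModeSystem

/-! ### Weighted forms on `L²(Ω)` -/

/-- `m` is measurable, and bounded by `C` on `Ω`. -/
structure IsWeight (m : ℝ × ℝ → ℝ) (C : ℝ) : Prop where
  measurable : Measurable m
  bound : ∀ z ∈ Dom, |m z| ≤ C

/-- `∫_Ω m U V`. -/
def wForm (m : ℝ × ℝ → ℝ) (U V : L2Dom) : ℝ := ∫ z in Dom, m z * (U z * V z)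

section

variable {m : ℝ × ℝ → ℝ} {C : ℝ}

theorem IsWeight.nonneg (hm : IsWeight m C) : 0 ≤ C :=
  (abs_nonneg _).trans (hm.bound (1 / 2, 1 / 2) (by constructor <;> constructor <;> norm_num))

theorem IsWeight.integrable (hm : IsWeight m C) (U V : L2Dom) :
    Integrable (fun z => m z * (U z * V z)) (volume.restrict Dom) := by
  refine ((Lp.memLp U).integrable_mul (Lp.memLp V)).bdd_mul hm.measurable.aestronglyMeasurable
    (c := C) ?_
  filter_upwards [ae_restrict_mem measurableSet_Dom] with z hz
  exact hm.bound z hz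

theorem IsWeight.abs_wForm_le (hm : IsWeight m C) (U V : L2Dom) :
    |wForm m U V| ≤ C * ‖U‖ * ‖V‖ := by
  have hW : MemLp (fun z => m z * V z) 2 (volume.restrict Dom) :=
    (Lp.memLp V).of_le_mul (c := C) (hm.measurable.aestronglyMeasurable.mul (Lp.memLp V).1) (by
      filter_upwards [ae_restrict_mem measurableSet_Dom] with z hz
      rw [norm_mul]
      exact mul_le_mul_of_nonneg_right (hm.bound z hz) (norm_nonneg _))
  have hn : ‖hW.toLp‖ ≤ C * ‖V‖ := by
    refine Lp.norm_le_mul_norm_of_ae_le_mul ?_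
    filter_upwards [ae_restrict_mem measurableSet_Dom, hW.coeFn_toLp] with z hz hz'
    rw [hz', norm_mul]
    exact mul_le_mul_of_nonneg_right (hm.bound z hz) (norm_nonneg _)
  have h : wForm m U V = inner ℝ U hW.toLp := by
    rw [L2Dom_inner_eq Filter.EventuallyEq.rfl hW.coeFn_toLp, wForm]
    congr 1
    ext z
    ring
  rw [h]
  refine (abs_real_inner_le_norm _ _).trans ?_
  calc ‖U‖ * ‖hW.toLp‖ ≤ ‖U‖ * (C * ‖V‖) := mul_le_mul_of_nonneg_left hn (norm_nonneg _)
    _ = C * ‖U‖ * ‖V‖ := by ring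

/-- `wForm` as a continuous bilinear map. -/
def wFormL (hm : IsWeight m C) : L2Dom →L[ℝ] L2Dom →L[ℝ] ℝ :=
  LinearMap.mkContinuous₂
    (LinearMap.mk₂ ℝ (wForm m)
      (fun U U' V => by
        rw [wForm, wForm, wForm, ← integral_add (hm.integrable U V) (hm.integrable U' V)]
        refine integral_congr_ae ?_
        filter_upwards [Lp.coeFn_add U U'] with z hz
        rw [hz, Pi.add_apply]
        ring)
      (fun c U V => by
        rw [wForm, wForm, smul_eq_mul, ← integral_const_mul]
        refine integral_congr_ae ?_
        filter_upwards [Lp.coeFn_smul c U] with z hz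
        rw [hz, Pi.smul_apply, smul_eq_mul]
        ring)
      (fun U V V' => by
        rw [wForm, wForm, wForm, ← integral_add (hm.integrable U V) (hm.integrable U V')]
        refine integral_congr_ae ?_
        filter_upwards [Lp.coeFn_add V V'] with z hz
        rw [hz, Pi.add_apply]
        ring)
      (fun c U V => by
        rw [wForm, wForm, smul_eq_mul, ← integral_const_mul]
        refine integral_congr_ae ?_
        filter_upwards [Lp.coeFn_smul c V] with z hz
        rw [hz, Pi.smul_apply, smul_eq_mul]
        ring))
    C fun U V => hm.abs_wForm_le U V

theorem wFormL_apply (hm : IsWeight m C) (U V : L2Dom) : wFormL hm U V = wForm m U V := rfl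

theorem IsWeight.wForm_sum (hm : IsWeight m C) {ι : Type} (F : Finset ι) (c d : ι → ℝ)
    (x y : ι → L2Dom) : wForm m (∑ i ∈ F, c i • x i) (∑ j ∈ F, d j • y j) =
      ∑ i ∈ F, ∑ j ∈ F, c i * d j * wForm m (x i) (y j) := by
  have h : wFormL hm (∑ i ∈ F, c i • x i) = ∑ i ∈ F, c i • wFormL hm (x i) := by
    simp only [map_sum, map_smul]
  rw [← wFormL_apply hm, h, _root_.sum_apply]
  refine Finset.sum_congr rfl fun i _ => ?_
  rw [_root_.smul_apply, map_sum, Finset.smul_sum]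
  refine Finset.sum_congr rfl fun j _ => ?_
  rw [map_smul, wFormL_apply, smul_eq_mul, smul_eq_mul]
  ring

theorem wForm_one (U V : L2Dom) : wForm (fun _ => 1) U V = inner ℝ U V := by
  rw [L2Dom_inner_eq Filter.EventuallyEq.rfl Filter.EventuallyEq.rfl]
  simp [wForm]

theorem isWeight_one : IsWeight (fun _ => 1) 1 := ⟨measurable_const, fun _ _ => by simp⟩

theorem exists_isWeight_fst {f : ℝ → ℝ} (hf : Continuous f) :
    ∃ C, IsWeight (fun z => f z.1) C := by
  obtain ⟨C, hC⟩ := isCompact_Icc.exists_bound_of_continuousOn (s := Icc (0 : ℝ) 1) hf.continuousOn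
  exact ⟨C, hf.measurable.comp measurable_fst, fun z hz => hC _ (Ioo_subset_Icc_self hz.1)⟩

/-- The exponent is the one with r ∂_r u = r^(1 - α/2) · r^(α/2) ∂_r u. It is positive, so the
radial field acts boundedly on the weighted derivative. -/
theorem exists_isWeight_radial {α : ℝ} (hα : α < 1) {f : ℝ → ℝ} (hf : Continuous f) :
    ∃ C, IsWeight (fun z => f z.1 * z.2 ^ (1 - α / 2)) C := by
  obtain ⟨C, hC⟩ := isCompact_Icc.exists_bound_of_continuousOn (s := Icc (0 : ℝ) 1) hf.continuousOn
  refine ⟨C, (hf.measurable.comp measurable_fst).mul (measurable_snd.pow_const _), fun z hz => ?_⟩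
  have h1 := hC _ (Ioo_subset_Icc_self hz.1)
  have h2 := Real.rpow_nonneg hz.2.1.le (1 - α / 2)
  have h3 := Real.rpow_le_one hz.2.1.le hz.2.2.le (by linarith : (0 : ℝ) ≤ 1 - α / 2)
  rw [abs_mul, abs_of_nonneg h2]
  rw [Real.norm_eq_abs] at h1
  nlinarith [abs_nonneg (f z.1)]

theorem wForm_tensor {U V : L2Dom} {u u' v v' : ℝ → ℝ} (f g : ℝ → ℝ)
    (hU : U =ᵐ[volume.restrict Dom] fun z => u z.1 * u' z.2)
    (hV : V =ᵐ[volume.restrict Dom] fun z => v z.1 * v' z.2) :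
    wForm (fun z => f z.1 * g z.2) U V =
      (∫ x in (0 : ℝ)..1, f x * (u x * v x)) * ∫ r in (0 : ℝ)..1, g r * (u' r * v' r) := by
  rw [← integral_Dom_mul, wForm]
  refine integral_congr_ae ?_
  filter_upwards [hU, hV] with z h1 h2
  rw [h1, h2]
  ring

theorem wForm_tensor_fst {U V : L2Dom} {u u' v v' : ℝ → ℝ} (f : ℝ → ℝ)
    (hU : U =ᵐ[volume.restrict Dom] fun z => u z.1 * u' z.2)
    (hV : V =ᵐ[volume.restrict Dom] fun z => v z.1 * v' z.2) :
    wForm (fun z => f z.1) U V =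
      (∫ x in (0 : ℝ)..1, f x * (u x * v x)) * ∫ r in (0 : ℝ)..1, u' r * v' r := by
  simpa using wForm_tensor f (fun _ => 1) hU hV

end

/-! ### The multiplier `A ∂_θ + b r ∂_r` on pairs of eigenfunctions -/

/-- The data of a vector field `(A(θ), b(θ) r)`, tangential on the sides of `Ω` other than
`r = 1`. -/
structure IsMultiplier (A A' b b' : ℝ → ℝ) : Prop where
  contA : Continuous A
  contA' : Continuous A'
  contb : Continuous b
  contb' : Continuous b'
  hasDerivAt_A : ∀ x, HasDerivAt A (A' x) x
  hasDerivAt_b : ∀ x, HasDerivAt b (b' x) x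
  A_zero : A 0 = 0
  A_one : A 1 = 0

namespace ModeSystem

variable {α : ℝ} {ι : Type} (M : ModeSystem α ι)

theorem val_ae (i : ι) : H01.val α (M.mode i) =ᵐ[volume.restrict Dom]
    fun z => M.s i z.1 * M.e i z.2 := prodMode_val_ae _ _ _ _

theorem dTheta_ae (i : ι) : H01.dTheta α (M.mode i) =ᵐ[volume.restrict Dom]
    fun z => M.p i z.1 * M.e i z.2 := prodMode_dTheta_ae _ _ _ _

/-- The weighted derivative `r ^ (α / 2) e'` of the radial part of a mode. -/
def w (i : ι) (r : ℝ) : ℝ := r ^ (-(α / 2)) * M.q i r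

theorem wdR_ae (i : ι) : H01.wdR α (M.mode i) =ᵐ[volume.restrict Dom]
    fun z => M.s i z.1 * M.w i z.2 := prodMode_wdR_ae _ _ _ _

/-- `∫_Ω E_i (A ∂_θ E_j + b r ∂_r E_j)`. -/
def mult (A b : ℝ → ℝ) (i j : ι) : ℝ :=
  wForm (fun z => A z.1) (H01.val α (M.mode i)) (H01.dTheta α (M.mode j)) +
    wForm (fun z => b z.1 * z.2 ^ (1 - α / 2)) (H01.val α (M.mode i)) (H01.wdR α (M.mode j))

theorem integral_radial (i j : ι) :
    ∫ r in (0 : ℝ)..1, r ^ (1 - α / 2) * (M.e i r * M.w j r) =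
      ∫ r in (0 : ℝ)..1, r ^ (1 - α) * (M.e i r * M.q j r) := by
  rw [← integral_Ioo_eq_interval zero_le_one, ← integral_Ioo_eq_interval zero_le_one]
  refine setIntegral_congr_fun measurableSet_Ioo fun r hr => ?_
  have h : r ^ (1 - α / 2) * r ^ (-(α / 2)) = r ^ (1 - α) := by
    rw [← Real.rpow_add hr.1]
    congr 1
    ring
  simp only [w]
  rw [← h]
  ring

theorem integral_weighted (i j : ι) :
    ∫ r in (0 : ℝ)..1, M.w i r * M.w j r =
      ∫ r in (0 : ℝ)..1, r ^ (-α) * (M.q i r * M.q j r) := by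
  rw [← integral_Ioo_eq_interval zero_le_one, ← integral_Ioo_eq_interval zero_le_one]
  refine setIntegral_congr_fun measurableSet_Ioo fun r hr => ?_
  have h := sq_rpow_neg_half hr.1 α
  simp only [w]
  rw [← h]
  ring

theorem mult_eq (A b : ℝ → ℝ) (i j : ι) : M.mult A b i j =
    (∫ x in (0 : ℝ)..1, A x * (M.s i x * M.p j x)) * (∫ r in (0 : ℝ)..1, M.e i r * M.e j r) +
    (∫ x in (0 : ℝ)..1, b x * (M.s i x * M.s j x)) *
      ∫ r in (0 : ℝ)..1, r ^ (1 - α) * (M.e i r * M.q j r) := by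
  rw [mult, wForm_tensor_fst A (M.val_ae i) (M.dTheta_ae j),
    wForm_tensor b (fun r => r ^ (1 - α / 2)) (M.val_ae i) (M.wdR_ae j), M.integral_radial]

theorem integral_mul_comm (f g h : ℝ → ℝ) :
    ∫ x in (0 : ℝ)..1, f x * (g x * h x) = ∫ x in (0 : ℝ)..1, f x * (h x * g x) := by
  simp only [mul_comm]

variable {A A' b b' : ℝ → ℝ}

/-- The divergence theorem for the field X = (A, b r), whose divergence is A' + b. Polarised to
pairs of modes, every integral factors into one-dimensional ones. -/
theorem mult_add (h : IsMultiplier A A' b b') (i j : ι) :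
    M.mult A b i j + M.mult A b j i =
      -wForm (fun z => A' z.1 + b z.1) (H01.val α (M.mode i)) (H01.val α (M.mode j)) := by
  have T1 := integral_mul_deriv_add (M.isMode_s i) (M.isMode_s j) h.contA h.contA' h.hasDerivAt_A
  have R1 := integral_radial_add (M.isMode_e i) (M.isMode_e j) M.lt_one
  have c1 := (M.isMode_s i).cont
  have c2 := (M.isMode_s j).cont
  have c3 := h.contA'
  have c4 := h.contb
  rw [mult_eq, mult_eq, wForm_tensor_fst (fun x => A' x + b x) (M.val_ae i) (M.val_ae j)]
  simp only [add_mul]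
  rw [intervalIntegral.integral_add (Continuous.intervalIntegrable (by fun_prop) _ _)
    (Continuous.intervalIntegrable (by fun_prop) _ _),
    integral_mul_comm b (M.s j) (M.s i)]
  have e1 : ∫ r in (0 : ℝ)..1, M.e j r * M.e i r = ∫ r in (0 : ℝ)..1, M.e i r * M.e j r := by
    simp only [mul_comm]
  rw [e1]
  linear_combination (∫ r in (0 : ℝ)..1, M.e i r * M.e j r) * T1 +
    (∫ x in (0 : ℝ)..1, b x * (M.s i x * M.s j x)) * R1

/-- The polarised Rellich identity: -div(A∇E_i) tested with X E_j, plus the same with i and j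
exchanged. The last term is the contribution of the side r = 1. -/
theorem eig_mult_add (h : IsMultiplier A A' b b') (i j : ι) :
    M.eig i * M.mult A b i j + M.eig j * M.mult A b j i =
      wForm (fun z => A' z.1 - b z.1) (H01.dTheta α (M.mode i)) (H01.dTheta α (M.mode j)) +
      wForm (fun z => (1 - α) * b z.1 - A' z.1) (H01.wdR α (M.mode i)) (H01.wdR α (M.mode j)) +
      wForm (fun z => b' z.1 * z.2 ^ (1 - α / 2)) (H01.dTheta α (M.mode i))
        (H01.wdR α (M.mode j)) +
      wForm (fun z => b' z.1 * z.2 ^ (1 - α / 2)) (H01.dTheta α (M.mode j))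
        (H01.wdR α (M.mode i)) -
      (∫ x in (0 : ℝ)..1, b x * (M.s i x * M.s j x)) * (M.q i 1 * M.q j 1) := by
  have T1 := integral_mul_deriv_add (M.isMode_s i) (M.isMode_s j) h.contA h.contA' h.hasDerivAt_A
  have T2 := integral_mul_deriv_weighted_add (M.isMode_s i) (M.isMode_s j) h.contA h.contA'
    h.hasDerivAt_A h.A_zero h.A_one
  have T3 := integral_mul_mul_eq (M.isMode_s i) (M.isMode_s j) h.contb h.contb' h.hasDerivAt_b
  have T3' := integral_mul_mul_eq (M.isMode_s j) (M.isMode_s i) h.contb h.contb' h.hasDerivAt_b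
  have R1 := integral_radial_add (M.isMode_e i) (M.isMode_e j) M.lt_one
  have R2 := (M.isMode_e i).integral_flux_mul (M.isMode_e j) M.lt_one
  have R2' := (M.isMode_e j).integral_flux_mul (M.isMode_e i) M.lt_one
  have R3 := integral_radial_weighted_add (M.isMode_e i) (M.isMode_e j) M.lt_one
  have c1 := (M.isMode_s i).cont
  have c2 := (M.isMode_s j).cont
  have c1' := (M.isMode_s i).cont_flux
  have c2' := (M.isMode_s j).cont_flux
  have c3 := h.contA'
  have c4 := h.contb
  have e1 : ∫ r in (0 : ℝ)..1, M.e j r * M.e i r = ∫ r in (0 : ℝ)..1, M.e i r * M.e j r := by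
    simp only [mul_comm]
  rw [integral_mul_comm b (M.s j) (M.s i), integral_mul_comm b (M.p j) (M.p i)] at T3'
  rw [integral_mul_comm _ (M.q j) (M.q i), e1] at R2'
  rw [mult_eq, mult_eq,
    wForm_tensor_fst (fun x => A' x - b x) (M.dTheta_ae i) (M.dTheta_ae j),
    wForm_tensor_fst (fun x => (1 - α) * b x - A' x) (M.wdR_ae i) (M.wdR_ae j),
    wForm_tensor b' (fun r => r ^ (1 - α / 2)) (M.dTheta_ae i) (M.wdR_ae j),
    wForm_tensor b' (fun r => r ^ (1 - α / 2)) (M.dTheta_ae j) (M.wdR_ae i),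
    M.integral_radial, M.integral_radial, M.integral_weighted,
    integral_mul_comm b (M.s j) (M.s i), e1]
  have e2 : ∫ x in (0 : ℝ)..1, (A' x - b x) * (M.p i x * M.p j x) =
      (∫ x in (0 : ℝ)..1, A' x * (M.p i x * M.p j x)) -
        ∫ x in (0 : ℝ)..1, b x * (M.p i x * M.p j x) := by
    rw [← intervalIntegral.integral_sub (Continuous.intervalIntegrable (by fun_prop) _ _)
      (Continuous.intervalIntegrable (by fun_prop) _ _)]
    simp only [sub_mul]
  have e3 : ∫ x in (0 : ℝ)..1, ((1 - α) * b x - A' x) * (M.s i x * M.s j x) =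
      (1 - α) * (∫ x in (0 : ℝ)..1, b x * (M.s i x * M.s j x)) -
        ∫ x in (0 : ℝ)..1, A' x * (M.s i x * M.s j x) := by
    rw [← intervalIntegral.integral_const_mul,
      ← intervalIntegral.integral_sub (Continuous.intervalIntegrable (by fun_prop) _ _)
      (Continuous.intervalIntegrable (by fun_prop) _ _)]
    simp only [sub_mul, mul_assoc]
  rw [e2, e3]
  unfold eig
  -- `T2` settles the angular eigenvalues in the A terms; `R2`, `R2'` and `T1` trade the radial
  -- eigenvalues there for weighted flux integrals. For the b terms `R3` handles the radial
  -- eigenvalues, `T3`, `T3'` the angular ones, and `R1` recombines the remaining radial integrals.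
  linear_combination (∫ r in (0 : ℝ)..1, M.e i r * M.e j r) * T2 -
    (∫ x in (0 : ℝ)..1, A x * (M.s i x * M.p j x)) * R2 -
    (∫ x in (0 : ℝ)..1, A x * (M.s j x * M.p i x)) * R2' +
    (∫ r in (0 : ℝ)..1, r ^ (-α) * (M.q i r * M.q j r)) * T1 +
    (∫ x in (0 : ℝ)..1, b x * (M.s i x * M.s j x)) * R3 +
    (∫ r in (0 : ℝ)..1, r ^ (1 - α) * (M.e i r * M.q j r)) * T3 +
    (∫ r in (0 : ℝ)..1, r ^ (1 - α) * (M.e j r * M.q i r)) * T3' +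
    (∫ x in (0 : ℝ)..1, b x * (M.p i x * M.p j x)) * R1

end ModeSystem

/-! ### The multiplier identity for finite sums of modes -/

namespace ModeSystem

variable {α : ℝ} {ι : Type} (M : ModeSystem α ι) (φ0 : H01 α) (φ1 : L2Dom)

theorem continuous_sol (i : ι) : Continuous (M.sol φ0 φ1 i) :=
  continuous_iff_continuousAt.2 fun t => (M.hasDerivAt_sol φ0 φ1 i t).continuousAt

theorem continuous_solt (i : ι) : Continuous (M.solt φ0 φ1 i) :=
  continuous_iff_continuousAt.2 fun t => (M.hasDerivAt_solt φ0 φ1 i t).continuousAt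

theorem continuous_partialSol (F : Finset ι) : Continuous (M.partialSol φ0 φ1 F) :=
  continuous_finsetSum _ fun i _ => (M.continuous_sol φ0 φ1 i).smul continuous_const

theorem continuous_partialSolt (F : Finset ι) : Continuous (M.partialSolt φ0 φ1 F) :=
  continuous_finsetSum _ fun i _ => (M.continuous_solt φ0 φ1 i).smul continuous_const

theorem map_partialSol (L : H01 α →L[ℝ] L2Dom) (F : Finset ι) (t : ℝ) :
    L (M.partialSol φ0 φ1 F t) = ∑ i ∈ F, M.sol φ0 φ1 i t • L (M.mode i) := by
  simp only [partialSol, map_sum, map_smul]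

/-- The normal derivative of a partial sum on the side `r = 1`. -/
def partialTrace (F : Finset ι) (t x : ℝ) : ℝ :=
  ∑ i ∈ F, M.sol φ0 φ1 i t * (M.q i 1 * M.s i x)

/-- The oscillator equation replaces the second time derivative of a coefficient by -`M.eig i` times
the coefficient. -/
theorem hasDerivAt_sum_solt_sol (F : Finset ι) (R : ι → ι → ℝ) (t : ℝ) :
    HasDerivAt (fun t => ∑ i ∈ F, ∑ j ∈ F, M.solt φ0 φ1 i t * M.sol φ0 φ1 j t * R i j)
      (∑ i ∈ F, ∑ j ∈ F, (M.solt φ0 φ1 i t * M.solt φ0 φ1 j t * R i j -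
        M.sol φ0 φ1 i t * M.sol φ0 φ1 j t * (M.eig i * R i j))) t := by
  refine HasDerivAt.fun_sum fun i _ => HasDerivAt.fun_sum fun j _ => ?_
  refine (((M.hasDerivAt_solt φ0 φ1 i t).fun_mul
    (M.hasDerivAt_sol φ0 φ1 j t)).mul_const (R i j)).congr_deriv ?_
  ring

/-- A quadratic form sees only the symmetric part of its matrix; hence the symmetrised identities
for pairs of modes are all that is needed. -/
theorem sum_symm (F : Finset ι) (x : ι → ℝ) (R : ι → ι → ℝ) :
    ∑ i ∈ F, ∑ j ∈ F, x i * x j * R i j =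
      1 / 2 * ∑ i ∈ F, ∑ j ∈ F, x i * x j * (R i j + R j i) := by
  have h : ∑ i ∈ F, ∑ j ∈ F, x i * x j * R j i = ∑ i ∈ F, ∑ j ∈ F, x i * x j * R i j := by
    rw [Finset.sum_comm]
    simp only [mul_comm]
  simp only [mul_add, Finset.sum_add_distrib]
  rw [h]
  ring

theorem integral_mul_partialTrace_sq {b : ℝ → ℝ} (hb : Continuous b) (F : Finset ι) (t : ℝ) :
    ∫ x in (0 : ℝ)..1, b x * M.partialTrace φ0 φ1 F t x ^ 2 =
      ∑ i ∈ F, ∑ j ∈ F, M.sol φ0 φ1 i t * M.sol φ0 φ1 j t *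
        ((∫ x in (0 : ℝ)..1, b x * (M.s i x * M.s j x)) * (M.q i 1 * M.q j 1)) := by
  have hs : ∀ i, Continuous (M.s i) := fun i => (M.isMode_s i).cont
  have h : ∀ x, b x * M.partialTrace φ0 φ1 F t x ^ 2 =
      ∑ i ∈ F, ∑ j ∈ F, M.sol φ0 φ1 i t * M.sol φ0 φ1 j t * (M.q i 1 * M.q j 1) *
        (b x * (M.s i x * M.s j x)) := fun x => by
    rw [partialTrace, sq, Finset.sum_mul_sum, Finset.mul_sum]
    refine Finset.sum_congr rfl fun i _ => ?_
    rw [Finset.mul_sum]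
    refine Finset.sum_congr rfl fun j _ => ?_
    ring
  simp only [h]
  rw [intervalIntegral.integral_finsetSum fun i _ => Continuous.intervalIntegrable
    (continuous_finsetSum _ fun j _ => by have := hs i; have := hs j; fun_prop) _ _]
  refine Finset.sum_congr rfl fun i _ => ?_
  rw [intervalIntegral.integral_finsetSum fun j _ => Continuous.intervalIntegrable
    (by have := hs i; have := hs j; fun_prop) _ _]
  refine Finset.sum_congr rfl fun j _ => ?_
  rw [intervalIntegral.integral_const_mul]
  ring

/-- `∫_Ω V (A ∂_θ U + b r ∂_r U + (c / 2) U)`. -/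
def multForm (A b : ℝ → ℝ) (c : ℝ) (V : L2Dom) (U : H01 α) : ℝ :=
  wForm (fun z => A z.1) V (H01.dTheta α U) +
    wForm (fun z => b z.1 * z.2 ^ (1 - α / 2)) V (H01.wdR α U) +
    c / 2 * inner ℝ V (H01.val α U)

/-- The quadratic form produced by the multiplier `A ∂_θ + b r ∂_r + c / 2`. -/
def multEnergy (A' b b' : ℝ → ℝ) (c : ℝ) (V : L2Dom) (U : H01 α) : ℝ :=
  wForm (fun z => A' z.1 - b z.1) (H01.dTheta α U) (H01.dTheta α U) +
    wForm (fun z => (1 - α) * b z.1 - A' z.1) (H01.wdR α U) (H01.wdR α U) +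
    2 * wForm (fun z => b' z.1 * z.2 ^ (1 - α / 2)) (H01.dTheta α U) (H01.wdR α U) +
    wForm (fun z => A' z.1 + b z.1) V V +
    c * (‖H01.dTheta α U‖ ^ 2 + ‖H01.wdR α U‖ ^ 2 - ‖V‖ ^ 2)

theorem eig_mul_inner (i j : ι) :
    M.eig i * inner ℝ (H01.val α (M.mode i)) (H01.val α (M.mode j)) =
      inner ℝ (H01.dTheta α (M.mode i)) (H01.dTheta α (M.mode j)) +
        inner ℝ (H01.wdR α (M.mode i)) (H01.wdR α (M.mode j)) := by
  have h := M.aForm_mode (M.mode j) i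
  rw [aForm_eq_inner, real_inner_comm (H01.dTheta α (M.mode i)),
    real_inner_comm (H01.wdR α (M.mode i)), real_inner_comm (H01.val α (M.mode i))] at h
  exact h.symm

variable {A A' b b' : ℝ → ℝ}

/-- The multiplier identity in differential form. The velocity part comes from `mult_add`, the
position part from `eig_mult_add`, and the zeroth-order term adds c/2 times the difference of
kinetic and potential energy. -/
theorem hasDerivAt_multForm (h : IsMultiplier A A' b b') (c : ℝ) (F : Finset ι) (t : ℝ) :
    HasDerivAt (fun t => multForm A b c (M.partialSolt φ0 φ1 F t) (M.partialSol φ0 φ1 F t))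
      (1 / 2 * (∫ x in (0 : ℝ)..1, b x * M.partialTrace φ0 φ1 F t x ^ 2) -
        1 / 2 * multEnergy A' b b' c (M.partialSolt φ0 φ1 F t) (M.partialSol φ0 φ1 F t)) t := by
  obtain ⟨_, hA⟩ := exists_isWeight_fst h.contA
  obtain ⟨_, hb⟩ := exists_isWeight_radial M.lt_one h.contb
  obtain ⟨_, hb'⟩ := exists_isWeight_radial M.lt_one h.contb'
  obtain ⟨_, w1⟩ := exists_isWeight_fst (f := fun x => A' x - b x) (h.contA'.sub h.contb)
  obtain ⟨_, w2⟩ := exists_isWeight_fst (f := fun x => (1 - α) * b x - A' x)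
    ((h.contb.const_mul _).sub h.contA')
  obtain ⟨_, w3⟩ := exists_isWeight_fst (f := fun x => A' x + b x) (h.contA'.add h.contb)
  let R : ι → ι → ℝ := fun i j =>
    M.mult A b i j + c / 2 * inner ℝ (H01.val α (M.mode i)) (H01.val α (M.mode j))
  have e1 : ∀ t, multForm A b c (M.partialSolt φ0 φ1 F t) (M.partialSol φ0 φ1 F t) =
      ∑ i ∈ F, ∑ j ∈ F, M.solt φ0 φ1 i t * M.sol φ0 φ1 j t * R i j := fun t => by
    rw [multForm, ← wForm_one, map_partialSol, map_partialSol, map_partialSol, partialSolt,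
      hA.wForm_sum, hb.wForm_sum, isWeight_one.wForm_sum]
    simp only [Finset.mul_sum, ← Finset.sum_add_distrib]
    refine Finset.sum_congr rfl fun i _ => Finset.sum_congr rfl fun j _ => ?_
    simp only [R, mult, wForm_one]
    ring
  simp only [e1]
  refine (M.hasDerivAt_sum_solt_sol φ0 φ1 F R t).congr_deriv ?_
  simp only [Finset.sum_sub_distrib]
  rw [sum_symm F (fun i => M.solt φ0 φ1 i t) R,
    sum_symm F (fun i => M.sol φ0 φ1 i t) (fun i j => M.eig i * R i j),
    M.integral_mul_partialTrace_sq φ0 φ1 h.contb, multEnergy,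
    ← real_inner_self_eq_norm_sq, ← real_inner_self_eq_norm_sq, ← real_inner_self_eq_norm_sq,
    ← wForm_one, ← wForm_one, ← wForm_one, two_mul (wForm _ _ _)]
  -- The mixed term occurs twice. Expanding one copy with the indices exchanged matches the two
  -- orderings in `eig_mult_add` summand by summand.
  have e2 : wForm (fun z => b' z.1 * z.2 ^ (1 - α / 2)) (H01.dTheta α (M.partialSol φ0 φ1 F t))
      (H01.wdR α (M.partialSol φ0 φ1 F t)) = ∑ i ∈ F, ∑ j ∈ F,
        M.sol φ0 φ1 i t * M.sol φ0 φ1 j t * wForm (fun z => b' z.1 * z.2 ^ (1 - α / 2))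
          (H01.dTheta α (M.mode j)) (H01.wdR α (M.mode i)) := by
    rw [map_partialSol, map_partialSol, hb'.wForm_sum, Finset.sum_comm]
    refine Finset.sum_congr rfl fun i _ => Finset.sum_congr rfl fun j _ => ?_
    ring
  nth_rw 2 [e2]
  rw [map_partialSol, map_partialSol, partialSolt, w1.wForm_sum, w2.wForm_sum, w3.wForm_sum,
    hb'.wForm_sum, isWeight_one.wForm_sum, isWeight_one.wForm_sum, isWeight_one.wForm_sum]
  simp only [Finset.mul_sum, ← Finset.sum_add_distrib, ← Finset.sum_sub_distrib]
  refine Finset.sum_congr rfl fun i _ => Finset.sum_congr rfl fun j _ => ?_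
  have f1 := M.mult_add h i j
  have f2 := M.eig_mult_add h i j
  have f3 := M.eig_mul_inner i j
  have f4 := M.eig_mul_inner j i
  rw [real_inner_comm (H01.dTheta α (M.mode i)), real_inner_comm (H01.wdR α (M.mode i)),
    real_inner_comm (H01.val α (M.mode i))] at f4
  simp only [R, wForm_one]
  rw [real_inner_comm (H01.val α (M.mode i)) (H01.val α (M.mode j))]
  linear_combination (1 / 2 * M.solt φ0 φ1 i t * M.solt φ0 φ1 j t) * f1 -
    (1 / 2 * M.sol φ0 φ1 i t * M.sol φ0 φ1 j t) * (f2 + c / 2 * f3 + c / 2 * f4)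

end ModeSystem

theorem IsWeight.continuous_wForm {m : ℝ × ℝ → ℝ} {C : ℝ} (hm : IsWeight m C) {X : Type*}
    [TopologicalSpace X] {f g : X → L2Dom} (hf : Continuous f) (hg : Continuous g) :
    Continuous fun t => wForm m (f t) (g t) := by
  simp only [← wFormL_apply hm]
  exact ((wFormL hm).continuous.comp hf).clm_apply hg

/-- The integral over a rectangle as an iterated integral. -/
theorem integral_rectangle {T : ℝ} (hT : 0 ≤ T) {f : ℝ × ℝ → ℝ} (hf : Continuous f) :
    ∫ p in Ioo 0 1 ×ˢ Ioo 0 T, f p = ∫ t in (0 : ℝ)..T, ∫ x in (0 : ℝ)..1, f (x, t) := by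
  have hint : Integrable f ((volume.restrict (Ioo 0 1)).prod (volume.restrict (Ioo 0 T))) := by
    rw [Measure.prod_restrict]
    exact (hf.continuousOn.integrableOn_compact (isCompact_Icc.prod isCompact_Icc)).mono_set
      (prod_mono Ioo_subset_Icc_self Ioo_subset_Icc_self)
  rw [Measure.volume_eq_prod, ← Measure.prod_restrict, integral_prod_symm _ hint,
    ← integral_Ioo_eq_interval hT]
  simp only [← integral_Ioo_eq_interval zero_le_one]

namespace ModeSystem

variable {α : ℝ} {ι : Type} (M : ModeSystem α ι) (φ0 : H01 α) (φ1 : L2Dom)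

theorem sum_inner_mode (F : Finset ι) (x y : ι → ℝ) :
    ∑ i ∈ F, ∑ j ∈ F, x i * y j * inner ℝ (H01.val α (M.mode i)) (H01.val α (M.mode j)) =
      ∑ i ∈ F, x i * y i := by
  classical
  refine Finset.sum_congr rfl fun i hi => ?_
  simp only [(orthonormal_iff_ite.1 M.orthonormal) i]
  simp [hi]

theorem norm_partialSolt_sq (F : Finset ι) (t : ℝ) :
    ‖M.partialSolt φ0 φ1 F t‖ ^ 2 = ∑ i ∈ F, M.solt φ0 φ1 i t ^ 2 := by
  rw [← real_inner_self_eq_norm_sq, ← wForm_one, partialSolt, isWeight_one.wForm_sum]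
  simp only [wForm_one, sum_inner_mode, sq]

theorem norm_val_partialSol_sq (F : Finset ι) (t : ℝ) :
    ‖H01.val α (M.partialSol φ0 φ1 F t)‖ ^ 2 = ∑ i ∈ F, M.sol φ0 φ1 i t ^ 2 := by
  rw [← real_inner_self_eq_norm_sq, ← wForm_one, map_partialSol, isWeight_one.wForm_sum]
  simp only [wForm_one, sum_inner_mode, sq]

theorem norm_grad_partialSol_sq (F : Finset ι) (t : ℝ) :
    ‖H01.dTheta α (M.partialSol φ0 φ1 F t)‖ ^ 2 + ‖H01.wdR α (M.partialSol φ0 φ1 F t)‖ ^ 2 =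
      ∑ i ∈ F, M.eig i * M.sol φ0 φ1 i t ^ 2 := by
  rw [← real_inner_self_eq_norm_sq, ← real_inner_self_eq_norm_sq, ← wForm_one, ← wForm_one,
    map_partialSol, map_partialSol, isWeight_one.wForm_sum, isWeight_one.wForm_sum]
  simp only [wForm_one, ← Finset.sum_add_distrib, ← mul_add, ← eig_mul_inner]
  have h := M.sum_inner_mode F (fun i => M.sol φ0 φ1 i t * M.eig i) (fun i => M.sol φ0 φ1 i t)
  calc _ = ∑ i ∈ F, ∑ j ∈ F, M.sol φ0 φ1 i t * M.eig i * M.sol φ0 φ1 j t *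
        inner ℝ (H01.val α (M.mode i)) (H01.val α (M.mode j)) :=
        Finset.sum_congr rfl fun i _ => Finset.sum_congr rfl fun j _ => by ring
    _ = _ := h.trans (Finset.sum_congr rfl fun i _ => by ring)

/-- Conservation of energy. -/
theorem partial_energy (F : Finset ι) (t : ℝ) :
    ‖M.partialSolt φ0 φ1 F t‖ ^ 2 + (‖H01.dTheta α (M.partialSol φ0 φ1 F t)‖ ^ 2 +
      ‖H01.wdR α (M.partialSol φ0 φ1 F t)‖ ^ 2) = ∑ i ∈ F, M.modeEnergy φ0 φ1 i := by
  rw [norm_partialSolt_sq, norm_grad_partialSol_sq, ← Finset.sum_add_distrib]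
  refine Finset.sum_congr rfl fun i _ => ?_
  rw [← M.sol_energy φ0 φ1 i t, add_comm]

/-- The Poincaré inequality with constant one, since every eigenvalue is at least 1. -/
theorem norm_val_partialSol_sq_le (F : Finset ι) (t : ℝ) :
    ‖H01.val α (M.partialSol φ0 φ1 F t)‖ ^ 2 ≤ ‖H01.dTheta α (M.partialSol φ0 φ1 F t)‖ ^ 2 +
      ‖H01.wdR α (M.partialSol φ0 φ1 F t)‖ ^ 2 := by
  rw [norm_val_partialSol_sq, norm_grad_partialSol_sq]
  exact Finset.sum_le_sum fun i _ =>
    le_mul_of_one_le_left (sq_nonneg _) (M.one_le_eig i)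

/-- Young's inequality with the three cross terms costing 1/8, 1/2 and 3/8 of ‖V‖², which add up to
exactly one. The gradient terms then receive at most 7/8 each, the Poincaré hypothesis absorbing
‖u‖². -/
theorem abs_multForm_le {A b : ℝ → ℝ} {c : ℝ} (hA : IsWeight (fun z => A z.1) (1 / 2))
    (hb : IsWeight (fun z => b z.1 * z.2 ^ (1 - α / 2)) 1) (hc0 : 0 ≤ c) (hc : c ≤ 3 / 2)
    (V : L2Dom) (U : H01 α)
    (hU : ‖H01.val α U‖ ^ 2 ≤ ‖H01.dTheta α U‖ ^ 2 + ‖H01.wdR α U‖ ^ 2) :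
    |multForm A b c V U| ≤ ‖V‖ ^ 2 + (‖H01.dTheta α U‖ ^ 2 + ‖H01.wdR α U‖ ^ 2) := by
  have h1 := hA.abs_wForm_le V (H01.dTheta α U)
  have h2 := hb.abs_wForm_le V (H01.wdR α U)
  have h3 := abs_real_inner_le_norm V (H01.val α U)
  have h4 : |c / 2 * inner ℝ V (H01.val α U)| ≤ 3 / 4 * (‖V‖ * ‖H01.val α U‖) := by
    rw [abs_mul, abs_of_nonneg (by linarith : 0 ≤ c / 2)]
    exact mul_le_mul (by linarith) h3 (abs_nonneg _) (by norm_num)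
  have h5 := abs_add_three (wForm (fun z => A z.1) V (H01.dTheta α U))
    (wForm (fun z => b z.1 * z.2 ^ (1 - α / 2)) V (H01.wdR α U))
    (c / 2 * inner ℝ V (H01.val α U))
  rw [multForm]
  nlinarith [sq_nonneg (‖V‖ / 2 - ‖H01.dTheta α U‖), sq_nonneg (‖V‖ - ‖H01.wdR α U‖),
    sq_nonneg (‖V‖ - ‖H01.val α U‖)]

theorem continuous_partialTrace (F : Finset ι) :
    Continuous fun p : ℝ × ℝ => M.partialTrace φ0 φ1 F p.2 p.1 :=
  continuous_finsetSum _ fun i _ => ((M.continuous_sol φ0 φ1 i).comp continuous_snd).mul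
    (continuous_const.mul ((M.isMode_s i).cont.comp continuous_fst))

variable {A A' b b' : ℝ → ℝ}

theorem continuous_multEnergy (h : IsMultiplier A A' b b') (c : ℝ) (F : Finset ι) : Continuous
    fun t => multEnergy A' b b' c (M.partialSolt φ0 φ1 F t) (M.partialSol φ0 φ1 F t) := by
  obtain ⟨_, hb'⟩ := exists_isWeight_radial M.lt_one h.contb'
  obtain ⟨_, w1⟩ := exists_isWeight_fst (f := fun x => A' x - b x) (h.contA'.sub h.contb)
  obtain ⟨_, w2⟩ := exists_isWeight_fst (f := fun x => (1 - α) * b x - A' x)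
    ((h.contb.const_mul _).sub h.contA')
  obtain ⟨_, w3⟩ := exists_isWeight_fst (f := fun x => A' x + b x) (h.contA'.add h.contb)
  have c0 := M.continuous_partialSolt φ0 φ1 F
  have c1 := (H01.dTheta α).continuous.comp (M.continuous_partialSol φ0 φ1 F)
  have c2 := (H01.wdR α).continuous.comp (M.continuous_partialSol φ0 φ1 F)
  exact ((((w1.continuous_wForm c1 c1).add (w2.continuous_wForm c2 c2)).add
    ((hb'.continuous_wForm c1 c2).const_mul 2)).add (w3.continuous_wForm c0 c0)).add
    ((((c1.norm.pow 2).add (c2.norm.pow 2)).sub (c0.norm.pow 2)).const_mul c)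

theorem integral_partialTrace_sq (h : IsMultiplier A A' b b') (c : ℝ) (F : Finset ι) {T : ℝ}
    (hT : 0 ≤ T) :
    ∫ p in Ioo 0 1 ×ˢ Ioo 0 T, b p.1 * M.partialTrace φ0 φ1 F p.2 p.1 ^ 2 =
      (∫ t in (0 : ℝ)..T,
        multEnergy A' b b' c (M.partialSolt φ0 φ1 F t) (M.partialSol φ0 φ1 F t)) +
      2 * multForm A b c (M.partialSolt φ0 φ1 F T) (M.partialSol φ0 φ1 F T) -
      2 * multForm A b c (M.partialSolt φ0 φ1 F 0) (M.partialSol φ0 φ1 F 0) := by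
  have hp := M.continuous_partialTrace φ0 φ1 F
  have hf : Continuous fun p : ℝ × ℝ => b p.1 * M.partialTrace φ0 φ1 F p.2 p.1 ^ 2 :=
    (h.contb.comp continuous_fst).mul (hp.pow 2)
  have hc := M.continuous_multEnergy φ0 φ1 h c F
  have hg : Continuous fun t => ∫ x in (0 : ℝ)..1, b x * M.partialTrace φ0 φ1 F t x ^ 2 :=
    intervalIntegral.continuous_parametric_intervalIntegral_of_continuous'
      (f := fun t x => b x * M.partialTrace φ0 φ1 F t x ^ 2)
      (hf.comp (continuous_snd.prodMk continuous_fst)) 0 1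
  have hI := intervalIntegral.integral_eq_sub_of_hasDerivAt
    (fun t _ => M.hasDerivAt_multForm φ0 φ1 h c F t)
    (Continuous.intervalIntegrable ((hg.const_mul _).sub (hc.const_mul _)) 0 T)
  rw [intervalIntegral.integral_sub ((hg.const_mul _).intervalIntegrable _ _)
    ((hc.const_mul _).intervalIntegrable _ _), intervalIntegral.integral_const_mul,
    intervalIntegral.integral_const_mul] at hI
  rw [integral_rectangle hT hf]
  linear_combination 2 * hI

end ModeSystem

/-! ### Observability of finite sums of modes -/

/-- The indicator function of the strip. -/
def stripWeight (δ : ℝ) : ℝ × ℝ → ℝ := (strip δ).indicator fun _ => 1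

theorem measurableSet_strip (δ : ℝ) : MeasurableSet (strip δ) :=
  (measurableSet_Ioo.union measurableSet_Ioo).prod measurableSet_Ioo

theorem stripWeight_nonneg (δ : ℝ) (z : ℝ × ℝ) : 0 ≤ stripWeight δ z :=
  indicator_nonneg (fun _ _ => zero_le_one) z

theorem isWeight_strip (δ : ℝ) : IsWeight (stripWeight δ) 1 := by
  refine ⟨measurable_const.indicator (measurableSet_strip δ), fun z _ => ?_⟩
  rw [abs_of_nonneg (stripWeight_nonneg δ z)]
  exact indicator_le_self' (fun _ _ => zero_le_one) z

section

variable {δ μ C : ℝ} {m : ℝ × ℝ → ℝ}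

/-- Off the strip the weight is the constant μ; on the strip it is at least -C, and the strip term
pays for the deficit. -/
theorem IsWeight.le_wForm_add (hm : IsWeight m C) (h : ∀ z ∈ Dom, z ∉ strip δ → m z = μ)
    (U : L2Dom) : μ * ‖U‖ ^ 2 ≤ wForm m U U + (C + |μ|) * wForm (stripWeight δ) U U := by
  have i1 := isWeight_one.integrable U U
  have i2 := hm.integrable U U
  have i3 := (isWeight_strip δ).integrable U U
  rw [← real_inner_self_eq_norm_sq, ← wForm_one, wForm, wForm, wForm, ← integral_const_mul,
    ← integral_const_mul, ← integral_add i2 (i3.const_mul _)]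
  refine integral_mono_ae (i1.const_mul _) (i2.add (i3.const_mul _)) ?_
  filter_upwards [ae_restrict_mem measurableSet_Dom] with z hz
  have hU := mul_self_nonneg (U z)
  by_cases hs : z ∈ strip δ
  · have h1 := neg_le_of_abs_le (hm.bound z hz)
    simp only [stripWeight, indicator_of_mem hs]
    nlinarith [le_abs_self μ]
  · simp only [h z hz hs, stripWeight, indicator_of_notMem hs]
    linarith

/-- Serves for the mixed term, whose weight carries η' and therefore lives on the strip only. -/
theorem IsWeight.neg_le_two_mul_wForm (hm : IsWeight m C)
    (h : ∀ z ∈ Dom, z ∉ strip δ → m z = 0) (U V : L2Dom) :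
    -(C * (wForm (stripWeight δ) U U + wForm (stripWeight δ) V V)) ≤ 2 * wForm m U V := by
  have i1 := hm.integrable U V
  have i2 := (isWeight_strip δ).integrable U U
  have i3 := (isWeight_strip δ).integrable V V
  rw [wForm, wForm, wForm, ← integral_add i2 i3, ← integral_const_mul, ← integral_const_mul,
    ← integral_neg]
  refine integral_mono_ae ((i2.add i3).const_mul _).neg (i1.const_mul _) ?_
  filter_upwards [ae_restrict_mem measurableSet_Dom] with z hz
  by_cases hs : z ∈ strip δ
  · have h1 := abs_le.1 (hm.bound z hz)
    simp only [stripWeight, indicator_of_mem hs]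
    nlinarith [mul_nonneg (by linarith : 0 ≤ C + m z) (sq_nonneg (U z + V z)),
      mul_nonneg (by linarith : 0 ≤ C - m z) (sq_nonneg (U z - V z))]
  · simp [h z hz hs, stripWeight, indicator_of_notMem hs]

end

/-- A cutoff function that vanishes near the sides `θ = 0` and `θ = 1`. -/
theorem exists_cutoff {δ : ℝ} (hδ : δ ∈ Ioo (0 : ℝ) (1 / 32)) : ∃ η η' : ℝ → ℝ,
    Continuous η ∧ Continuous η' ∧ (∀ x, HasDerivAt η (η' x) x) ∧ (∀ x, 0 ≤ η x) ∧
    (∀ x, η x ≤ 1) ∧ (∀ x ∈ Icc (4 * δ) (1 - 4 * δ), η x = 1 ∧ η' x = 0) ∧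
    ∀ x, x ∉ Ioo δ (1 - δ) → η x = 0 := by
  obtain ⟨h0, h1⟩ := hδ
  let f : ContDiffBump (1 / 2 : ℝ) :=
    -- The inner radius exceeds 1/2 - 4δ strictly, so the bump is locally constant even at the
    -- endpoints of [4δ, 1 - 4δ] and its derivative vanishes there too. The outer radius places the
    -- support over [δ, 1 - δ].
    ⟨1 / 2 - 3 * δ, 1 / 2 - δ, by linarith, by linarith⟩
  have hf : ContDiff ℝ 1 f := f.contDiff
  refine ⟨f, deriv f, f.continuous, hf.continuous_deriv le_rfl,
    fun x => (hf.differentiable one_ne_zero x).hasDerivAt, fun x => f.nonneg, fun x => f.le_one,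
    fun x hx => ?_, fun x hx => ?_⟩
  · have hx' : x ∈ Metric.ball (1 / 2 : ℝ) f.rIn := by
      rw [Real.ball_eq_Ioo]
      change x ∈ Ioo (1 / 2 - (1 / 2 - 3 * δ)) (1 / 2 + (1 / 2 - 3 * δ))
      exact ⟨by linarith [hx.1], by linarith [hx.2]⟩
    have he : f =ᶠ[nhds x] fun _ => 1 := f.eventuallyEq_one_of_mem_ball hx'
    exact ⟨he.eq_of_nhds, by rw [he.deriv_eq, deriv_const]⟩
  · rw [← Function.notMem_support, f.support_eq, Real.ball_eq_Ioo]
    change x ∉ Ioo (1 / 2 - (1 / 2 - δ)) (1 / 2 + (1 / 2 - δ))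
    intro h
    exact hx ⟨by linarith [h.1], by linarith [h.2]⟩

theorem isWeight_radial_one {α : ℝ} (hα : α < 1) {f : ℝ → ℝ} (hf : Continuous f)
    (h0 : ∀ x, 0 ≤ f x) (h1 : ∀ x, f x ≤ 1) :
    IsWeight (fun z => f z.1 * z.2 ^ (1 - α / 2)) 1 := by
  refine ⟨(hf.measurable.comp measurable_fst).mul (measurable_snd.pow_const _), fun z hz => ?_⟩
  have h2 := Real.rpow_nonneg hz.2.1.le (1 - α / 2)
  have h3 := Real.rpow_le_one hz.2.1.le hz.2.2.le (by linarith : (0 : ℝ) ≤ 1 - α / 2)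
  rw [abs_of_nonneg (mul_nonneg (h0 _) h2)]
  exact mul_le_one₀ (h1 _) h2 h3

/-- `∫_ω (V² + A∇U · ∇U)`. -/
def stripForm {α : ℝ} (δ : ℝ) (V : L2Dom) (U : H01 α) : ℝ :=
  wForm (stripWeight δ) V V + wForm (stripWeight δ) (H01.dTheta α U) (H01.dTheta α U) +
    wForm (stripWeight δ) (H01.wdR α U) (H01.wdR α U)

theorem wForm_strip_nonneg (δ : ℝ) (U : L2Dom) : 0 ≤ wForm (stripWeight δ) U U :=
  integral_nonneg fun z => mul_nonneg (stripWeight_nonneg δ z) (mul_self_nonneg _)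

namespace ModeSystem

variable {α : ℝ} {ι : Type} (M : ModeSystem α ι)

/-- The hidden regularity of the normal derivative. -/
theorem integral_partialTrace_sq_le (φ0 : H01 α) (φ1 : L2Dom) (F : Finset ι) {T : ℝ}
    (hT : 0 ≤ T) : ∫ p in Ioo 0 1 ×ˢ Ioo 0 T, M.partialTrace φ0 φ1 F p.2 p.1 ^ 2 ≤
      (T + 4) * ∑ i ∈ F, M.modeEnergy φ0 φ1 i := by
  -- The purely radial field r ∂_r with c = 0. The resulting form is at most the energy sum at each
  -- time, giving the factor T, and the two endpoint terms contribute 2 each.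
  have h : IsMultiplier (fun _ => 0) (fun _ => 0) (fun _ => 1) (fun _ => 0) :=
    ⟨continuous_const, continuous_const, continuous_const, continuous_const,
      fun x => hasDerivAt_const x 0, fun x => hasDerivAt_const x 1, rfl, rfl⟩
  have hα0 := M.nonneg
  have hα := M.lt_one
  have hI := M.integral_partialTrace_sq φ0 φ1 h 0 F hT
  simp only [one_mul] at hI
  have hA : IsWeight (fun z => (fun _ : ℝ => (0 : ℝ)) z.1) (1 / 2) :=
    ⟨measurable_const, fun _ _ => by simp⟩
  have hb := isWeight_radial_one hα (f := fun _ => 1) continuous_const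
    (fun _ => zero_le_one) (fun _ => le_rfl)
  have hX : ∀ t, |multForm (fun _ => 0) (fun _ => 1) 0 (M.partialSolt φ0 φ1 F t)
      (M.partialSol φ0 φ1 F t)| ≤ ∑ i ∈ F, M.modeEnergy φ0 φ1 i := fun t => by
    rw [← M.partial_energy φ0 φ1 F t]
    exact abs_multForm_le hA hb le_rfl (by norm_num) _ _ (M.norm_val_partialSol_sq_le φ0 φ1 F t)
  have w1 : IsWeight (fun _ => (0 : ℝ) - 1) 1 := ⟨measurable_const, fun _ _ => by norm_num⟩
  have w2 : IsWeight (fun _ => (1 - α) * 1 - 0) 1 := ⟨measurable_const, fun _ _ => by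
    rw [abs_of_nonneg] <;> linarith⟩
  have w3 : IsWeight (fun _ => (0 : ℝ) + 1) 1 := ⟨measurable_const, fun _ _ => by norm_num⟩
  have hQ : ∀ t, multEnergy (fun _ => 0) (fun _ => 1) (fun _ => 0) 0 (M.partialSolt φ0 φ1 F t)
      (M.partialSol φ0 φ1 F t) ≤ ∑ i ∈ F, M.modeEnergy φ0 φ1 i := fun t => by
    rw [← M.partial_energy φ0 φ1 F t, multEnergy]
    have e1 := (le_abs_self _).trans (w1.abs_wForm_le (H01.dTheta α (M.partialSol φ0 φ1 F t))
      (H01.dTheta α (M.partialSol φ0 φ1 F t)))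
    have e2 := (le_abs_self _).trans (w2.abs_wForm_le (H01.wdR α (M.partialSol φ0 φ1 F t))
      (H01.wdR α (M.partialSol φ0 φ1 F t)))
    have e3 := (le_abs_self _).trans (w3.abs_wForm_le (M.partialSolt φ0 φ1 F t)
      (M.partialSolt φ0 φ1 F t))
    have e4 : wForm (fun z => 0 * z.2 ^ (1 - α / 2)) (H01.dTheta α (M.partialSol φ0 φ1 F t))
        (H01.wdR α (M.partialSol φ0 φ1 F t)) = 0 := by simp [wForm]
    rw [e4]
    linarith
  have hQI := intervalIntegral.integral_mono_on (μ := volume) hT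
    ((M.continuous_multEnergy φ0 φ1 h 0 F).intervalIntegrable 0 T)
    (Continuous.intervalIntegrable continuous_const 0 T) fun t _ => hQ t
  rw [intervalIntegral.integral_const, smul_eq_mul, sub_zero] at hQI
  rw [hI]
  linarith [le_of_abs_le (hX T), neg_le_of_abs_le (hX 0)]

theorem continuous_stripForm (δ : ℝ) (φ0 : H01 α) (φ1 : L2Dom) (F : Finset ι) : Continuous
    fun t => stripForm δ (M.partialSolt φ0 φ1 F t) (M.partialSol φ0 φ1 F t) := by
  have c0 := M.continuous_partialSolt φ0 φ1 F
  have c1 := (H01.dTheta α).continuous.comp (M.continuous_partialSol φ0 φ1 F)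
  have c2 := (H01.wdR α).continuous.comp (M.continuous_partialSol φ0 φ1 F)
  have h := isWeight_strip δ
  exact ((h.continuous_wForm c0 c0).add (h.continuous_wForm c1 c1)).add (h.continuous_wForm c2 c2)

/-- The choice c = 1 + α/2 balances kinetic and potential terms: off the strip the coefficients 0,
-α and 2 of a², b² and v² become 1 + α/2, 1 - α/2 and 1 - α/2, each at least 1/2 for α ≤ 1. -/
theorem strip_coercivity {α C₁ C₂ C₃ C₄ x₁ x₂ x₃ K q₁ q₂ q₃ W₁ W₂ W₃ W₄ a b v : ℝ} (h0 : 0 ≤ α)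
    (h1 : α ≤ 1) (e₁ : 0 * a ^ 2 ≤ W₁ + (C₁ + x₁) * q₁) (e₂ : -α * b ^ 2 ≤ W₂ + (C₂ + x₂) * q₂)
    (e₃ : 2 * v ^ 2 ≤ W₃ + (C₃ + x₃) * q₃) (e₄ : -(C₄ * (q₁ + q₂)) ≤ 2 * W₄)
    (k₁ : (C₁ + x₁ + C₄) * q₁ ≤ K * q₁) (k₂ : (C₂ + x₂ + C₄) * q₂ ≤ K * q₂)
    (k₃ : (C₃ + x₃) * q₃ ≤ K * q₃) :
    1 / 2 * (v ^ 2 + (a ^ 2 + b ^ 2)) - K * (q₃ + q₁ + q₂) ≤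
      W₁ + W₂ + 2 * W₄ + W₃ + (1 + α / 2) * (a ^ 2 + b ^ 2 - v ^ 2) := by
  have g1 := mul_nonneg h0 (sq_nonneg a)
  have g2 := mul_nonneg (sub_nonneg.2 h1) (sq_nonneg b)
  have g3 := mul_nonneg (sub_nonneg.2 h1) (sq_nonneg v)
  have g4 := sq_nonneg a
  linarith

/-- The observability inequality for finite sums of modes. -/
theorem observability_partialSol {δ T : ℝ} (hδ : δ ∈ Ioo (0 : ℝ) (1 / 32)) (hT : 10 ≤ T) :
    ∃ K, 0 ≤ K ∧ ∀ (φ0 : H01 α) (φ1 : L2Dom) (F : Finset ι), ∑ i ∈ F, M.modeEnergy φ0 φ1 i ≤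
      (∫ p in Ioo δ (1 - δ) ×ˢ Ioo 0 T, M.partialTrace φ0 φ1 F p.2 p.1 ^ 2) +
      K * ∫ t in (0 : ℝ)..T,
        stripForm δ (M.partialSolt φ0 φ1 F t) (M.partialSol φ0 φ1 F t) := by
  obtain ⟨η, η', cη, cη', dη, η0, η1, ηin, ηout⟩ := exists_cutoff hδ
  obtain ⟨hδ0, hδ1⟩ := hδ
  have hα0 := M.nonneg
  have hα := M.lt_one
  -- The cut-off dilation about the point (1/2, 0). Centering at θ = 1/2 keeps the angular component
  -- below 1/2 in modulus, and the cutoff makes it vanish on the vertical sides.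
  have h : IsMultiplier (fun x => η x * (x - 1 / 2)) (fun x => η' x * (x - 1 / 2) + η x) η η' :=
    { contA := by fun_prop
      contA' := by fun_prop
      contb := cη
      contb' := cη'
      hasDerivAt_A := fun x => by
        exact ((dη x).fun_mul ((hasDerivAt_id x).sub_const (1 / 2))).congr_deriv (by simp)
      hasDerivAt_b := dη
      A_zero := by simp [ηout 0 fun h => absurd h.1 (by linarith)]
      A_one := by simp [ηout 1 fun h => absurd h.2 (by linarith)] }
  have hA : IsWeight (fun z => η z.1 * (z.1 - 1 / 2)) (1 / 2) := by
    refine ⟨(h.contA.measurable.comp measurable_fst :), fun z hz => ?_⟩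
    rw [abs_mul, abs_of_nonneg (η0 _)]
    have h1 : |z.1 - 1 / 2| ≤ 1 / 2 := by
      rw [abs_le]
      constructor <;> linarith [hz.1.1, hz.1.2]
    nlinarith [η1 z.1, η0 z.1, abs_nonneg (z.1 - 1 / 2)]
  have hb := isWeight_radial_one hα cη η0 η1
  obtain ⟨C4, w4⟩ := exists_isWeight_radial hα cη'
  obtain ⟨C1, w1⟩ := exists_isWeight_fst (f := fun x => η' x * (x - 1 / 2) + η x - η x)
    (by fun_prop)
  obtain ⟨C2, w2⟩ := exists_isWeight_fst
    (f := fun x => (1 - α) * η x - (η' x * (x - 1 / 2) + η x)) (by fun_prop)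
  obtain ⟨C3, w3⟩ := exists_isWeight_fst (f := fun x => η' x * (x - 1 / 2) + η x + η x)
    (by fun_prop)
  have hz : ∀ z ∈ Dom, z ∉ strip δ → η z.1 = 1 ∧ η' z.1 = 0 := fun z hz hzs => by
    refine ηin z.1 ⟨?_, ?_⟩
    · by_contra hc
      exact hzs ⟨Or.inl ⟨hz.1.1, not_le.1 hc⟩, hz.2⟩
    · by_contra hc
      exact hzs ⟨Or.inr ⟨not_le.1 hc, hz.1.2⟩, hz.2⟩
  set K := C1 + (C2 + |(-α)|) + (C3 + |(2 : ℝ)|) + C4 with hK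
  have n1 := w1.nonneg
  have n2 := w2.nonneg
  have n3 := w3.nonneg
  have n4 := w4.nonneg
  have n5 := abs_nonneg (-α)
  have n6 := abs_nonneg (2 : ℝ)
  have hK0 : 0 ≤ K := by positivity
  refine ⟨K, hK0, fun φ0 φ1 F => ?_⟩
  set S := ∑ i ∈ F, M.modeEnergy φ0 φ1 i with hS
  have hS0 : 0 ≤ S := Finset.sum_nonneg fun i _ => M.modeEnergy_nonneg φ0 φ1 i
  have hX : ∀ t, |multForm (fun x => η x * (x - 1 / 2)) η (1 + α / 2) (M.partialSolt φ0 φ1 F t)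
      (M.partialSol φ0 φ1 F t)| ≤ S := fun t => by
    rw [hS, ← M.partial_energy φ0 φ1 F t]
    exact abs_multForm_le hA hb (by linarith) (by linarith) _ _
      (M.norm_val_partialSol_sq_le φ0 φ1 F t)
  have hQ : ∀ t, 1 / 2 * S - K * stripForm δ (M.partialSolt φ0 φ1 F t) (M.partialSol φ0 φ1 F t) ≤
      multEnergy (fun x => η' x * (x - 1 / 2) + η x) η η' (1 + α / 2)
        (M.partialSolt φ0 φ1 F t) (M.partialSol φ0 φ1 F t) := fun t => by
    rw [hS, ← M.partial_energy φ0 φ1 F t]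
    set V := M.partialSolt φ0 φ1 F t
    set U := M.partialSol φ0 φ1 F t
    have e1 := w1.le_wForm_add (δ := δ) (μ := 0) (fun z h1 h2 => by simp [hz z h1 h2])
      (H01.dTheta α U)
    have e2 := w2.le_wForm_add (δ := δ) (μ := -α) (fun z h1 h2 => by simp [hz z h1 h2])
      (H01.wdR α U)
    have e3 := w3.le_wForm_add (δ := δ) (μ := 2)
      (fun z h1 h2 => by simp only [hz z h1 h2]; norm_num) V
    have e4 := w4.neg_le_two_mul_wForm (δ := δ) (fun z h1 h2 => by simp [hz z h1 h2])
      (H01.dTheta α U) (H01.wdR α U)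
    have p1 := wForm_strip_nonneg δ (H01.dTheta α U)
    have p2 := wForm_strip_nonneg δ (H01.wdR α U)
    have p3 := wForm_strip_nonneg δ V
    have k1 : (C1 + |(0 : ℝ)| + C4) * wForm (stripWeight δ) (H01.dTheta α U) (H01.dTheta α U) ≤
        K * wForm (stripWeight δ) (H01.dTheta α U) (H01.dTheta α U) :=
      mul_le_mul_of_nonneg_right (by rw [abs_zero, hK]; linarith) p1
    have k2 : (C2 + |(-α)| + C4) * wForm (stripWeight δ) (H01.wdR α U) (H01.wdR α U) ≤
        K * wForm (stripWeight δ) (H01.wdR α U) (H01.wdR α U) :=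
      mul_le_mul_of_nonneg_right (by rw [hK]; linarith) p2
    have k3 : (C3 + |(2 : ℝ)|) * wForm (stripWeight δ) V V ≤ K * wForm (stripWeight δ) V V :=
      mul_le_mul_of_nonneg_right (by rw [hK]; linarith) p3
    rw [multEnergy, stripForm]
    exact strip_coercivity hα0 hα.le e1 e2 e3 e4 k1 k2 k3
  have hcs := M.continuous_stripForm δ φ0 φ1 F
  have hce := M.continuous_multEnergy φ0 φ1 h (1 + α / 2) F
  have hcl : Continuous fun t => 1 / 2 * S -
      K * stripForm δ (M.partialSolt φ0 φ1 F t) (M.partialSol φ0 φ1 F t) :=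
    continuous_const.sub (hcs.const_mul K)
  have hQI := intervalIntegral.integral_mono_on (μ := volume) (by linarith : (0 : ℝ) ≤ T)
    (hcl.intervalIntegrable 0 T) (hce.intervalIntegrable 0 T) fun t _ => hQ t
  rw [intervalIntegral.integral_sub (Continuous.intervalIntegrable continuous_const _ _)
    ((hcs.const_mul K).intervalIntegrable _ _), intervalIntegral.integral_const,
    intervalIntegral.integral_const_mul, smul_eq_mul, sub_zero] at hQI
  have hI := M.integral_partialTrace_sq φ0 φ1 h (1 + α / 2) F (by linarith : (0 : ℝ) ≤ T)
  have hp := M.continuous_partialTrace φ0 φ1 F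
  -- The cutoff is at most one and vanishes outside (δ, 1 - δ), which restricts the observation on r
  -- = 1 to that range of θ.
  have hle : ∫ p in Ioo 0 1 ×ˢ Ioo 0 T, η p.1 * M.partialTrace φ0 φ1 F p.2 p.1 ^ 2 ≤
      ∫ p in Ioo δ (1 - δ) ×ˢ Ioo 0 T, M.partialTrace φ0 φ1 F p.2 p.1 ^ 2 := by
    have hsub : Ioo δ (1 - δ) ×ˢ Ioo 0 T ⊆ Ioo 0 1 ×ˢ Ioo 0 T :=
      prod_mono (Ioo_subset_Ioo hδ0.le (by linarith)) le_rfl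
    have hint : ∀ f : ℝ × ℝ → ℝ, Continuous f → ∀ a b : ℝ, IntegrableOn f (Ioo a b ×ˢ Ioo 0 T) :=
      fun f hf a b => (hf.continuousOn.integrableOn_compact
        (isCompact_Icc.prod isCompact_Icc)).mono_set
        (prod_mono Ioo_subset_Icc_self Ioo_subset_Icc_self)
    have hc : Continuous fun p : ℝ × ℝ => η p.1 * M.partialTrace φ0 φ1 F p.2 p.1 ^ 2 :=
      (cη.comp continuous_fst).mul (hp.pow 2)
    rw [setIntegral_eq_of_subset_of_forall_sdiff_eq_zero (μ := volume)
      (f := fun p : ℝ × ℝ => η p.1 * M.partialTrace φ0 φ1 F p.2 p.1 ^ 2)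
      (measurableSet_Ioo.prod measurableSet_Ioo) hsub fun p hp => ?_]
    · refine setIntegral_mono (hint _ hc _ _) (hint _ (hp.pow 2) _ _) fun p => ?_
      exact mul_le_of_le_one_left (sq_nonneg _) (η1 _)
    · rw [ηout p.1 fun h1 => hp.2 ⟨h1, hp.1.2⟩, zero_mul]
  -- The time integral yields T S / 2 and the two endpoint terms cost 4 S, so ten is exactly what
  -- leaves one S over.
  have hTS : 10 * S ≤ T * S := mul_le_mul_of_nonneg_right hT hS0
  linarith [le_of_abs_le (hX 0), neg_le_of_abs_le (hX T)]

end ModeSystem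

/-! ### Green's formula for finite sums of modes -/

theorem memLp_Dom_of_continuous {f : ℝ × ℝ → ℝ} (hf : Continuous f) :
    MemLp f 2 (volume.restrict Dom) := by
  obtain ⟨C, hC⟩ := (isCompact_Icc.prod isCompact_Icc).exists_bound_of_continuousOn
    (s := Icc (0 : ℝ) 1 ×ˢ Icc (0 : ℝ) 1) hf.continuousOn
  refine MemLp.of_bound hf.aestronglyMeasurable C ?_
  filter_upwards [ae_restrict_mem measurableSet_Dom] with z hz
  exact hC z (prod_mono Ioo_subset_Icc_self Ioo_subset_Icc_self hz)

/-- The curve in `L²(Ω)` given by a continuous function on `Ω × ℝ`. -/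
def timeSlice {h : (ℝ × ℝ) × ℝ → ℝ} (hh : Continuous h) (t : ℝ) : L2Dom :=
  (memLp_Dom_of_continuous (f := fun z => h (z, t)) (by fun_prop)).toLp

theorem timeSlice_ae {h : (ℝ × ℝ) × ℝ → ℝ} (hh : Continuous h) (t : ℝ) :
    timeSlice hh t =ᵐ[volume.restrict Dom] fun z => h (z, t) := MemLp.coeFn_toLp _

/-- Compactness of the closed square makes the slices converge uniformly, and Ω has measure one. -/
theorem continuous_timeSlice {h : (ℝ × ℝ) × ℝ → ℝ} (hh : Continuous h) :
    Continuous (timeSlice hh) := by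
  rw [Metric.continuous_iff']
  intro t ε hε
  have hK : IsCompact (Icc (0 : ℝ) 1 ×ˢ Icc (0 : ℝ) 1) := isCompact_Icc.prod isCompact_Icc
  obtain ⟨v, hv, hvu⟩ := hK.mem_uniformity_of_prod (f := fun t z => h (z, t)) (s := univ)
    (q := t) (by unfold Function.uncurry; fun_prop) (mem_univ t)
    (Metric.dist_mem_uniformity (half_pos hε))
  rw [nhdsWithin_univ] at hv
  filter_upwards [hv] with t' ht'
  rw [dist_eq_norm]
  have hle : ‖timeSlice hh t' - timeSlice hh t‖ ≤
      measureUnivNNReal (volume.restrict Dom) ^ (2 : ENNReal).toReal⁻¹ * (ε / 2) := by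
    refine Lp.norm_le_of_ae_bound (half_pos hε).le ?_
    filter_upwards [ae_restrict_mem measurableSet_Dom, timeSlice_ae hh t', timeSlice_ae hh t,
      Lp.coeFn_sub (timeSlice hh t') (timeSlice hh t)] with z hz h1 h2 h3
    rw [h3, Pi.sub_apply, h1, h2, ← dist_eq_norm]
    exact (hvu t' ht' z (prod_mono Ioo_subset_Icc_self Ioo_subset_Icc_self hz)).le
  have h1 : measureUnivNNReal (volume.restrict Dom : Measure (ℝ × ℝ)) = 1 := by
    simp [measureUnivNNReal]
  rw [h1] at hle
  simp only [NNReal.coe_one, Real.one_rpow, one_mul] at hle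
  linarith

section

variable {T : ℝ} {χ : (ℝ × ℝ) × ℝ → ℝ} {S : Set (ℝ × ℝ)}

theorem IsTestFunction.slice (hχ : IsTestFunction (S ×ˢ Ioo 0 T) χ) (t : ℝ) :
    IsTestFunction S fun z => χ (z, t) where
  contDiff := hχ.contDiff.comp (contDiff_id.prodMk contDiff_const)
  hasCompactSupport := hχ.hasCompactSupport.comp_isClosedEmbedding
    (g := fun z : ℝ × ℝ => (z, t))
    (Topology.IsClosedEmbedding.of_continuous_injective_isClosedMap (by fun_prop)
      (fun _ _ h => (Prod.ext_iff.1 h).1) (isClosedMap_prodMk_right t))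
  tsupport_subset := fun z hz => (hχ.tsupport_subset
    (tsupport_comp_subset_preimage χ (f := fun z : ℝ × ℝ => (z, t)) (by fun_prop) hz)).1

theorem IsTestFunction.continuous_fderiv' (hχ : IsTestFunction (S ×ˢ Ioo 0 T) χ)
    (w : (ℝ × ℝ) × ℝ) : Continuous fun p => fderiv ℝ χ p w :=
  (hχ.contDiff.continuous_fderiv (by simp)).clm_apply continuous_const

theorem IsTestFunction.fderiv_slice (hχ : IsTestFunction (S ×ˢ Ioo 0 T) χ) (z w : ℝ × ℝ) (t : ℝ) :
    fderiv ℝ (fun z => χ (z, t)) z w = fderiv ℝ χ (z, t) (w, 0) := by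
  have h := HasFDerivAt.comp (g := χ) (f := fun z => (z, t)) z
    ((hχ.contDiff.differentiable (by simp)) (z, t)).hasFDerivAt
    ((hasFDerivAt_id (𝕜 := ℝ) z).prodMk (hasFDerivAt_const t z))
  exact congrArg (fun L => L w) h.fderiv

theorem IsTestFunction.hasDerivAt_time (hχ : IsTestFunction (S ×ˢ Ioo 0 T) χ) (z : ℝ × ℝ)
    (t : ℝ) : HasDerivAt (fun t => χ (z, t)) (fderiv ℝ χ (z, t) (0, 1)) t :=
  ((hχ.contDiff.differentiable (by simp)) (z, t)).hasFDerivAt.comp_hasDerivAt t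
    ((hasDerivAt_const t z).prodMk (hasDerivAt_id t))

theorem IsTestFunction.continuous_weighted_fderiv {a : ℝ} (ha : 0 ≤ a)
    (hχ : IsTestFunction (S ×ˢ Ioo 0 T) χ) :
    Continuous fun p : (ℝ × ℝ) × ℝ => p.1.2 ^ a * fderiv ℝ χ p ((0, 1), 0) :=
  ((continuous_fst.snd).rpow_const fun _ => Or.inr ha).mul (hχ.continuous_fderiv' _)

/-- Differentiation under the integral sign against a test function. -/
theorem IsTestFunction.hasDerivAt_inner (hχ : IsTestFunction (S ×ˢ Ioo 0 T) χ) (V : L2Dom)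
    (t : ℝ) : HasDerivAt (fun t => inner ℝ V (timeSlice hχ.continuous t))
      (inner ℝ V (timeSlice (hχ.continuous_fderiv' (0, 1)) t)) t := by
  have hc := hχ.continuous_fderiv' (0, 1)
  have hcs : HasCompactSupport fun p => fderiv ℝ χ p (0, 1) :=
    hχ.hasCompactSupport.fderiv_apply ℝ (0, 1)
  obtain ⟨C, hC⟩ := hc.bounded_above_of_compact_support hcs
  have e1 : ∀ t, inner ℝ V (timeSlice hχ.continuous t) = ∫ z in Dom, V z * χ (z, t) := fun t =>
    L2Dom_inner_eq Filter.EventuallyEq.rfl (timeSlice_ae _ t)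
  have e2 : inner ℝ V (timeSlice hc t) = ∫ z in Dom, V z * fderiv ℝ χ (z, t) (0, 1) :=
    L2Dom_inner_eq Filter.EventuallyEq.rfl (timeSlice_ae _ t)
  have hV : Integrable V (volume.restrict Dom) := (Lp.memLp V).integrable (by norm_num)
  simp only [e1]
  rw [e2]
  have hcχ := hχ.continuous
  refine (hasDerivAt_integral_of_dominated_loc_of_deriv_le (s := univ)
    (F := fun t z => V z * χ (z, t)) (F' := fun t z => V z * fderiv ℝ χ (z, t) (0, 1))
    (bound := fun z => C * ‖V z‖) Filter.univ_mem
    (Filter.Eventually.of_forall fun t => ?_) ?_ ?_ ?_ (hV.norm.const_mul C) ?_).2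
  · exact (Lp.aestronglyMeasurable V).mul
      (Continuous.aestronglyMeasurable (f := fun z => χ (z, t)) (by fun_prop))
  · exact (Lp.memLp V).integrable_mul
      (memLp_Dom_of_continuous (f := fun z => χ (z, t)) (by fun_prop))
  · exact (Lp.aestronglyMeasurable V).mul (Continuous.aestronglyMeasurable
      (f := fun z => fderiv ℝ χ (z, t) (0, 1)) (hc.comp (by fun_prop)))
  · refine Filter.Eventually.of_forall fun z t _ => ?_
    rw [norm_mul, mul_comm]
    exact mul_le_mul_of_nonneg_right (hC _) (norm_nonneg _)
  · exact Filter.Eventually.of_forall fun z t _ => (hχ.hasDerivAt_time z t).const_mul (V z)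

end

/-- The integrand of the right-hand side of Green's formula. -/
def greenForm {α T : ℝ} (hα : 0 ≤ α) {χ : (ℝ × ℝ) × ℝ → ℝ}
    (hχ : IsTestFunction ((Ioo 0 1 ×ˢ Ioi 0) ×ˢ Ioo 0 T) χ) (t : ℝ) (V : L2Dom) (U : H01 α) : ℝ :=
  -inner ℝ V (timeSlice (hχ.continuous_fderiv' (0, 1)) t) +
    inner ℝ (H01.dTheta α U) (timeSlice (hχ.continuous_fderiv' ((1, 0), 0)) t) +
    inner ℝ (H01.wdR α U)
      (timeSlice (hχ.continuous_weighted_fderiv (by linarith : 0 ≤ α / 2)) t)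

namespace ModeSystem

variable {α : ℝ} {ι : Type} (M : ModeSystem α ι) {T : ℝ} {χ : (ℝ × ℝ) × ℝ → ℝ}
  (hχ : IsTestFunction ((Ioo 0 1 ×ˢ Ioi 0) ×ˢ Ioo 0 T) χ)

/-- Green's formula in `Ω` for a single mode. -/
theorem inner_grad_mode_timeSlice (i : ι) (t : ℝ) :
    inner ℝ (H01.dTheta α (M.mode i)) (timeSlice (hχ.continuous_fderiv' ((1, 0), 0)) t) +
      inner ℝ (H01.wdR α (M.mode i))
        (timeSlice (hχ.continuous_weighted_fderiv (by linarith [M.nonneg] : 0 ≤ α / 2)) t) =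
    M.eig i * inner ℝ (H01.val α (M.mode i)) (timeSlice hχ.continuous t) +
      M.q i 1 * ∫ x in (0 : ℝ)..1, M.s i x * χ ((x, 1), t) := by
  have h1 := integral_dTheta_test (M.isMode_s i) (M.isMode_e i).cont (hχ.slice t)
  have h2 := integral_dR_test (M.isMode_s i).cont (M.isMode_e i) (hχ.slice t)
  simp only [hχ.fderiv_slice] at h1 h2
  rw [L2Dom_inner_eq (M.dTheta_ae i) (timeSlice_ae _ t),
    L2Dom_inner_eq (M.wdR_ae i) (timeSlice_ae _ t),
    L2Dom_inner_eq (M.val_ae i) (timeSlice_ae _ t), h1]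
  have e1 : ∫ z in Dom, M.s i z.1 * M.w i z.2 * (z.2 ^ (α / 2) * fderiv ℝ χ (z, t) ((0, 1), 0)) =
      ∫ z in Dom, M.s i z.1 * M.q i z.2 * fderiv ℝ χ (z, t) ((0, 1), 0) := by
    refine setIntegral_congr_fun measurableSet_Dom fun z hz => ?_
    have h3 := (Real.rpow_pos_of_pos hz.2.1 (α / 2)).ne'
    simp only [w]
    rw [Real.rpow_neg hz.2.1.le]
    field_simp
  have e2 : ∫ x in (0 : ℝ)..1, M.s i x * M.q i 1 * χ ((x, 1), t) =
      M.q i 1 * ∫ x in (0 : ℝ)..1, M.s i x * χ ((x, 1), t) := by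
    rw [← intervalIntegral.integral_const_mul]
    congr 1
    ext x
    ring
  rw [e1, h2, e2, eig]
  ring

variable (φ0 : H01 α) (φ1 : L2Dom)

/-- Separates, for each mode, the boundary contribution on r = 1 from the exact time derivative of
`solt` times the coefficient of the test function. -/
theorem greenForm_partialSol (F : Finset ι) (t : ℝ) :
    greenForm M.nonneg hχ t (M.partialSolt φ0 φ1 F t) (M.partialSol φ0 φ1 F t) =
      ∑ i ∈ F, (M.sol φ0 φ1 i t * (M.q i 1 * ∫ x in (0 : ℝ)..1, M.s i x * χ ((x, 1), t)) -
        (M.solt φ0 φ1 i t * inner ℝ (H01.val α (M.mode i))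
            (timeSlice (hχ.continuous_fderiv' (0, 1)) t) -
          M.eig i * M.sol φ0 φ1 i t *
            inner ℝ (H01.val α (M.mode i)) (timeSlice hχ.continuous t))) := by
  rw [greenForm, map_partialSol, map_partialSol, partialSolt, sum_inner, sum_inner, sum_inner,
    ← Finset.sum_neg_distrib, ← Finset.sum_add_distrib, ← Finset.sum_add_distrib]
  refine Finset.sum_congr rfl fun i _ => ?_
  rw [real_inner_smul_left, real_inner_smul_left, real_inner_smul_left]
  linear_combination M.sol φ0 φ1 i t * M.inner_grad_mode_timeSlice hχ i t

/-- The integrand is an exact time derivative, and the test function vanishes at t = 0 and t = T. -/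
theorem integral_deriv_solt_mul (i : ι) :
    ∫ t in (0 : ℝ)..T, (M.solt φ0 φ1 i t * inner ℝ (H01.val α (M.mode i))
        (timeSlice (hχ.continuous_fderiv' (0, 1)) t) -
      M.eig i * M.sol φ0 φ1 i t *
        inner ℝ (H01.val α (M.mode i)) (timeSlice hχ.continuous t)) = 0 := by
  have c1 := continuous_timeSlice (hχ.continuous_fderiv' (0, 1))
  have c2 := continuous_timeSlice hχ.continuous
  have c3 := M.continuous_sol φ0 φ1 i
  have c4 := M.continuous_solt φ0 φ1 i
  have h0 : ∀ t, t ∉ Ioo 0 T → inner ℝ (H01.val α (M.mode i)) (timeSlice hχ.continuous t) = 0 :=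
    fun t ht => by
      rw [L2Dom_inner_eq Filter.EventuallyEq.rfl (timeSlice_ae _ t)]
      simp only [hχ.eq_zero (x := ((_, t) : (ℝ × ℝ) × ℝ)) fun h => ht h.2]
      simp
  rw [intervalIntegral.integral_eq_sub_of_hasDerivAt (f := fun t => M.solt φ0 φ1 i t *
      inner ℝ (H01.val α (M.mode i)) (timeSlice hχ.continuous t)) (fun t _ =>
      ((M.hasDerivAt_solt φ0 φ1 i t).fun_mul (hχ.hasDerivAt_inner _ t)).congr_deriv (by ring))
      (Continuous.intervalIntegrable (by fun_prop) _ _)]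
  simp only [h0 0 fun h => h.1.false, h0 T fun h => h.2.false, mul_zero, sub_zero]

/-- Green's formula for finite sums of modes. -/
theorem integral_greenForm_partialSol (hT : 0 ≤ T) (F : Finset ι) :
    ∫ t in (0 : ℝ)..T,
        greenForm M.nonneg hχ t (M.partialSolt φ0 φ1 F t) (M.partialSol φ0 φ1 F t) =
      ∫ p in Ioo 0 1 ×ˢ Ioo 0 T, M.partialTrace φ0 φ1 F p.2 p.1 * χ ((p.1, 1), p.2) := by
  have c0 := hχ.continuous
  have c1 := continuous_timeSlice (hχ.continuous_fderiv' (0, 1))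
  have c2 := continuous_timeSlice hχ.continuous
  have c3 : ∀ i, Continuous (M.sol φ0 φ1 i) := M.continuous_sol φ0 φ1
  have c4 : ∀ i, Continuous (M.solt φ0 φ1 i) := M.continuous_solt φ0 φ1
  have c5 : ∀ i, Continuous (M.s i) := fun i => (M.isMode_s i).cont
  have c6 : ∀ i, Continuous fun t => ∫ x in (0 : ℝ)..1, M.s i x * χ ((x, 1), t) := fun i =>
    intervalIntegral.continuous_parametric_intervalIntegral_of_continuous'
      (f := fun t x => M.s i x * χ ((x, 1), t))
      (by have := c5 i; unfold Function.uncurry; fun_prop) 0 1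
  have c7 := M.continuous_partialTrace φ0 φ1 F
  have c8 : ∀ i, Continuous fun t => M.sol φ0 φ1 i t *
      (M.q i 1 * ∫ x in (0 : ℝ)..1, M.s i x * χ ((x, 1), t)) := fun i =>
    (c3 i).mul (continuous_const.mul (c6 i))
  have c9 : ∀ i, Continuous fun t => M.solt φ0 φ1 i t * inner ℝ (H01.val α (M.mode i))
        (timeSlice (hχ.continuous_fderiv' (0, 1)) t) -
      M.eig i * M.sol φ0 φ1 i t *
        inner ℝ (H01.val α (M.mode i)) (timeSlice hχ.continuous t) := fun i => by
    have := c3 i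
    have := c4 i
    fun_prop
  simp only [M.greenForm_partialSol hχ]
  rw [intervalIntegral.integral_finsetSum fun i _ =>
    ((c8 i).fun_sub (c9 i)).intervalIntegrable _ _]
  have e1 : ∀ i, ∫ t in (0 : ℝ)..T, (M.sol φ0 φ1 i t *
        (M.q i 1 * ∫ x in (0 : ℝ)..1, M.s i x * χ ((x, 1), t)) -
        (M.solt φ0 φ1 i t * inner ℝ (H01.val α (M.mode i))
            (timeSlice (hχ.continuous_fderiv' (0, 1)) t) -
          M.eig i * M.sol φ0 φ1 i t *
            inner ℝ (H01.val α (M.mode i)) (timeSlice hχ.continuous t))) =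
      ∫ t in (0 : ℝ)..T, M.sol φ0 φ1 i t *
        (M.q i 1 * ∫ x in (0 : ℝ)..1, M.s i x * χ ((x, 1), t)) := fun i => by
    rw [intervalIntegral.integral_sub ((c8 i).intervalIntegrable _ _)
      ((c9 i).intervalIntegrable _ _), M.integral_deriv_solt_mul hχ φ0 φ1 i, sub_zero]
  simp only [e1]
  rw [← intervalIntegral.integral_finsetSum fun i _ => (c8 i).intervalIntegrable _ _,
    integral_rectangle hT (by fun_prop)]
  refine intervalIntegral.integral_congr fun t _ => ?_
  simp only [partialTrace, Finset.sum_mul]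
  rw [intervalIntegral.integral_finsetSum fun i _ => Continuous.intervalIntegrable
    (by have := c5 i; fun_prop) _ _]
  refine Finset.sum_congr rfl fun i _ => ?_
  rw [← mul_assoc, ← intervalIntegral.integral_const_mul]
  congr 1
  ext x
  ring

end ModeSystem

/-! ### The normal derivative of a weak solution -/

theorem H01.norm_sq_eq {α : ℝ} (u : H01 α) :
    ‖u‖ ^ 2 = ‖H01.val α u‖ ^ 2 + (‖H01.dTheta α u‖ ^ 2 + ‖H01.wdR α u‖ ^ 2) := by
  have h := H01.inner_eq u u
  rw [aForm_eq_inner, real_inner_self_eq_norm_sq, real_inner_self_eq_norm_sq,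
    real_inner_self_eq_norm_sq, real_inner_self_eq_norm_sq] at h
  exact h

theorem H01.norm_dTheta_le {α : ℝ} (u : H01 α) : ‖H01.dTheta α u‖ ≤ ‖u‖ := by
  refine le_of_sq_le_sq ?_ (norm_nonneg _)
  rw [H01.norm_sq_eq u]
  nlinarith [sq_nonneg ‖H01.val α u‖, sq_nonneg ‖H01.wdR α u‖]

theorem H01.norm_wdR_le {α : ℝ} (u : H01 α) : ‖H01.wdR α u‖ ≤ ‖u‖ := by
  refine le_of_sq_le_sq ?_ (norm_nonneg _)
  rw [H01.norm_sq_eq u]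
  nlinarith [sq_nonneg ‖H01.val α u‖, sq_nonneg ‖H01.dTheta α u‖]

section

variable {α T : ℝ} (hα : 0 ≤ α) {χ : (ℝ × ℝ) × ℝ → ℝ}
  (hχ : IsTestFunction ((Ioo 0 1 ×ˢ Ioi 0) ×ˢ Ioo 0 T) χ)

theorem greenForm_eq (t : ℝ) (V : L2Dom) (U : H01 α) :
    ∫ z in Dom, (-(V z * fderiv ℝ χ (z, t) ((0, 0), 1))
          + H01.dTheta α U z * fderiv ℝ χ (z, t) ((1, 0), 0)
          + z.2 ^ (α / 2) * H01.wdR α U z * fderiv ℝ χ (z, t) ((0, 1), 0)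
          - (0 : L2Dom) z * χ (z, t)) = greenForm hα hχ t V U := by
  have hi : ∀ (W : L2Dom) {h : (ℝ × ℝ) × ℝ → ℝ}, Continuous h →
      Integrable (fun z => W z * h (z, t)) (volume.restrict Dom) := fun W h hh =>
    (Lp.memLp W).integrable_mul
      (memLp_Dom_of_continuous (f := fun z => h (z, t)) (by fun_prop))
  have h0 : 0 ≤ α / 2 := by linarith
  rw [greenForm, L2Dom_inner_eq (f := V) Filter.EventuallyEq.rfl (timeSlice_ae _ t),
    L2Dom_inner_eq (f := H01.dTheta α U) Filter.EventuallyEq.rfl (timeSlice_ae _ t),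
    L2Dom_inner_eq (f := H01.wdR α U) Filter.EventuallyEq.rfl (timeSlice_ae _ t),
    ← integral_neg, ← integral_add (hi V (hχ.continuous_fderiv' (0, 1))).fun_neg
      (hi _ (hχ.continuous_fderiv' ((1, 0), 0))),
    ← integral_add ((hi V (hχ.continuous_fderiv' (0, 1))).fun_neg.fun_add
      (hi _ (hχ.continuous_fderiv' ((1, 0), 0)))) (hi _ (hχ.continuous_weighted_fderiv h0))]
  refine integral_congr_ae ?_
  filter_upwards [Lp.coeFn_zero ℝ 2 (volume.restrict Dom)] with z hz
  rw [hz]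
  simp only [Pi.zero_apply, zero_mul, sub_zero]
  rw [mul_right_comm, mul_comm (H01.wdR α U z)]
  rfl

theorem greenForm_sub (t : ℝ) (V V' : L2Dom) (U U' : H01 α) :
    greenForm hα hχ t V U - greenForm hα hχ t V' U' = greenForm hα hχ t (V - V') (U - U') := by
  simp only [greenForm, map_sub, inner_sub_left]
  ring

/-- Continuity of Green's form, uniform in time, is what carries the formula from partial sums to
the solution. -/
theorem exists_abs_greenForm_le : ∃ C, 0 ≤ C ∧ ∀ t ∈ Icc 0 T, ∀ (V : L2Dom) (U : H01 α),
    |greenForm hα hχ t V U| ≤ C * (‖V‖ + ‖U‖) := by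
  have h0 : 0 ≤ α / 2 := by linarith
  have c1 := continuous_timeSlice (hχ.continuous_fderiv' (0, 1))
  have c2 := continuous_timeSlice (hχ.continuous_fderiv' ((1, 0), 0))
  have c3 := continuous_timeSlice (hχ.continuous_weighted_fderiv h0)
  obtain ⟨C1, h1⟩ := isCompact_Icc.exists_bound_of_continuousOn (s := Icc 0 T) c1.continuousOn
  obtain ⟨C2, h2⟩ := isCompact_Icc.exists_bound_of_continuousOn (s := Icc 0 T) c2.continuousOn
  obtain ⟨C3, h3⟩ := isCompact_Icc.exists_bound_of_continuousOn (s := Icc 0 T) c3.continuousOn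
  refine ⟨|C1| + |C2| + |C3|, by positivity, fun t ht V U => ?_⟩
  have b1 := (abs_real_inner_le_norm V _).trans
    (mul_le_mul_of_nonneg_left ((h1 t ht).trans (le_abs_self _)) (norm_nonneg V))
  have b2 := (abs_real_inner_le_norm (H01.dTheta α U) _).trans
    (mul_le_mul (H01.norm_dTheta_le U) ((h2 t ht).trans (le_abs_self _)) (norm_nonneg _)
      (norm_nonneg U))
  have b3 := (abs_real_inner_le_norm (H01.wdR α U) _).trans
    (mul_le_mul (H01.norm_wdR_le U) ((h3 t ht).trans (le_abs_self _)) (norm_nonneg _)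
      (norm_nonneg U))
  rw [greenForm]
  refine (abs_add_three _ _ _).trans ?_
  rw [abs_neg]
  have := norm_nonneg V
  have := norm_nonneg U
  nlinarith [abs_nonneg C1, abs_nonneg C2, abs_nonneg C3, mul_nonneg (abs_nonneg C2) (norm_nonneg V),
    mul_nonneg (abs_nonneg C3) (norm_nonneg V), mul_nonneg (abs_nonneg C1) (norm_nonneg U)]

theorem integrable_greenForm {φ : ℝ → H01 α} {φt : ℝ → L2Dom}
    (hφ : MemLp φ 2 (volume.restrict (Ioo 0 T))) (hφt : MemLp φt 2 (volume.restrict (Ioo 0 T))) :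
    IntegrableOn (fun t => greenForm hα hχ t (φt t) (φ t)) (Ioo 0 T) := by
  have h0 : 0 ≤ α / 2 := by linarith
  have c1 := continuous_timeSlice (hχ.continuous_fderiv' (0, 1))
  have c2 := continuous_timeSlice (hχ.continuous_fderiv' ((1, 0), 0))
  have c3 := continuous_timeSlice (hχ.continuous_weighted_fderiv h0)
  obtain ⟨C, hC0, hC⟩ := exists_abs_greenForm_le hα hχ
  refine Integrable.mono' (((integrableOn_of_memLp hφt).norm.add
    (integrableOn_of_memLp hφ).norm).const_mul C) ?_ ?_
  · exact (((hφt.1.inner (𝕜 := ℝ) c1.aestronglyMeasurable).neg.add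
      (((H01.dTheta α).continuous.comp_aestronglyMeasurable hφ.1).inner (𝕜 := ℝ)
        c2.aestronglyMeasurable)).add
      (((H01.wdR α).continuous.comp_aestronglyMeasurable hφ.1).inner (𝕜 := ℝ)
        c3.aestronglyMeasurable))
  · filter_upwards [ae_restrict_mem measurableSet_Ioo] with t ht
    exact hC t (Ioo_subset_Icc_self ht) _ _

end

/-- `L²((0,1) × (0,T))`. -/
abbrev L2Side (T : ℝ) : Type := Lp ℝ 2 (volume.restrict (Ioo (0 : ℝ) 1 ×ˢ Ioo (0 : ℝ) T))

theorem memLp_Ioo_of_continuous {E : Type*} [NormedAddCommGroup E] {T : ℝ} {f : ℝ → E}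
    (hf : Continuous f) : MemLp f 2 (volume.restrict (Ioo 0 T)) := by
  obtain ⟨C, hC⟩ := isCompact_Icc.exists_bound_of_continuousOn (s := Icc 0 T) hf.continuousOn
  refine MemLp.of_bound hf.aestronglyMeasurable C ?_
  filter_upwards [ae_restrict_mem measurableSet_Ioo] with x hx
  exact hC x (Ioo_subset_Icc_self hx)

instance (T : ℝ) : IsFiniteMeasure (volume.restrict (Ioo (0 : ℝ) 1 ×ˢ Ioo (0 : ℝ) T)) :=
  ⟨by
    rw [Measure.restrict_apply_univ]
    exact ((Metric.isBounded_Ioo 0 1).prod (Metric.isBounded_Ioo 0 T)).measure_lt_top⟩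

theorem memLp_side {T : ℝ} {f : ℝ × ℝ → ℝ} (hf : Continuous f) :
    MemLp f 2 (volume.restrict (Ioo (0 : ℝ) 1 ×ˢ Ioo (0 : ℝ) T)) := by
  obtain ⟨C, hC⟩ := (isCompact_Icc.prod isCompact_Icc).exists_bound_of_continuousOn
    (s := Icc (0 : ℝ) 1 ×ˢ Icc (0 : ℝ) T) hf.continuousOn
  refine MemLp.of_bound hf.aestronglyMeasurable C ?_
  filter_upwards [ae_restrict_mem (measurableSet_Ioo.prod measurableSet_Ioo)] with z hz
  exact hC z (prod_mono Ioo_subset_Icc_self Ioo_subset_Icc_self hz)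

namespace ModeSystem

variable {α : ℝ} {ι : Type} (M : ModeSystem α ι) (φ0 : H01 α) (φ1 : L2Dom) (T : ℝ)

/-- The normal derivative of a partial sum as an element of `L²`. -/
def traceL2 (F : Finset ι) : L2Side T :=
  (memLp_side (M.continuous_partialTrace φ0 φ1 F)).toLp

theorem traceL2_ae (F : Finset ι) :
    M.traceL2 φ0 φ1 T F =ᵐ[volume.restrict (Ioo 0 1 ×ˢ Ioo 0 T)]
      fun p => M.partialTrace φ0 φ1 F p.2 p.1 := MemLp.coeFn_toLp _

theorem traceL2_eq_sum (F : Finset ι) :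
    M.traceL2 φ0 φ1 T F = ∑ i ∈ F, M.traceL2 φ0 φ1 T {i} := by
  classical
  induction F using Finset.induction_on with
  | empty =>
    rw [Finset.sum_empty]
    refine Lp.ext ?_
    filter_upwards [M.traceL2_ae φ0 φ1 T ∅, Lp.coeFn_zero ℝ 2
      (volume.restrict (Ioo (0 : ℝ) 1 ×ˢ Ioo (0 : ℝ) T))] with p h1 h2
    rw [h1, h2]
    simp [partialTrace]
  | insert i F hi ih =>
    rw [Finset.sum_insert hi, ← ih]
    refine Lp.ext ?_
    filter_upwards [M.traceL2_ae φ0 φ1 T (insert i F), M.traceL2_ae φ0 φ1 T {i},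
      M.traceL2_ae φ0 φ1 T F,
      Lp.coeFn_add (M.traceL2 φ0 φ1 T {i}) (M.traceL2 φ0 φ1 T F)] with p h1 h2 h3 h4
    rw [h1, h4, Pi.add_apply, h2, h3]
    simp [partialTrace, Finset.sum_insert hi]

theorem norm_traceL2_sq (F : Finset ι) : ‖M.traceL2 φ0 φ1 T F‖ ^ 2 =
    ∫ p in Ioo 0 1 ×ˢ Ioo 0 T, M.partialTrace φ0 φ1 F p.2 p.1 ^ 2 := by
  rw [← real_inner_self_eq_norm_sq, L2.inner_def]
  refine integral_congr_ae ?_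
  filter_upwards [M.traceL2_ae φ0 φ1 T F] with p hp
  rw [hp, real_inner_self_eq_norm_sq, Real.norm_eq_abs, sq_abs]

/-- The normal derivatives of the partial sums converge. -/
theorem exists_tendsto_traceL2 {T : ℝ} (hT : 0 ≤ T) :
    ∃ g : L2Side T, Filter.Tendsto (M.traceL2 φ0 φ1 T) Filter.atTop (nhds g) := by
  -- The hidden regularity bound applied to a finite block of modes controls the block of traces by
  -- the energy of that block, so the Cauchy criterion transfers from the energy series.
  have hs : Summable fun i => M.traceL2 φ0 φ1 T {i} := by
    rw [summable_iff_vanishing_norm]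
    intro ε hε
    obtain ⟨s, hs⟩ := summable_iff_vanishing_norm.1 (M.hasSum_modeEnergy φ0 φ1).summable
      (ε ^ 2 / (T + 4)) (by positivity)
    refine ⟨s, fun t ht => ?_⟩
    have h1 := (le_abs_self _).trans_lt (hs t ht)
    rw [lt_div_iff₀ (by linarith)] at h1
    have h2 := M.integral_partialTrace_sq_le φ0 φ1 t hT
    rw [← norm_traceL2_sq, traceL2_eq_sum] at h2
    exact lt_of_pow_lt_pow_left₀ 2 hε.le (by linarith)
  refine ⟨_, hs.hasSum.congr fun F => ?_⟩
  exact (M.traceL2_eq_sum φ0 φ1 T F).symm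

/-- The limit of the normal derivatives of the partial sums is the normal derivative of the
solution. -/
theorem isNormalTrace_of_tendsto [Countable ι] {T : ℝ} (hT : 0 < T) {φ0 : H01 α} {φ1 : L2Dom}
    {φ : ℝ → H01 α} {φt : ℝ → L2Dom} {φtt : ℝ → Hneg1 α}
    (h : IsWeakSolution α T φ0 φ1 (fun _ => 0) φ φt φtt) {g : L2Side T}
    (hg : Filter.Tendsto (M.traceL2 φ0 φ1 T) Filter.atTop (nhds g)) :
    IsNormalTrace α T (fun _ => 0) φ φt g := by
  refine ⟨Lp.memLp g, fun χ hχ => ?_⟩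
  simp only [greenForm_eq M.nonneg hχ]
  have hc := hχ.continuous
  have hX := memLp_side (T := T) (f := fun p => χ ((p.1, 1), p.2)) (by fun_prop)
  have hin : ∀ G : L2Side T, inner ℝ G hX.toLp =
      ∫ p in Ioo 0 1 ×ˢ Ioo 0 T, G p * χ ((p.1, 1), p.2) := fun G => by
    rw [L2.inner_def]
    refine integral_congr_ae ?_
    filter_upwards [hX.coeFn_toLp] with p hp
    rw [hp]
    exact mul_comm _ _
  rw [← hin]
  -- Both sides of Green's formula are limits of the same quantities: the traces converge in L², and
  -- the forms converge because the error of the partial sums is small uniformly in time.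
  refine tendsto_nhds_unique (hg.inner tendsto_const_nhds) ?_
  obtain ⟨C, hC0, hC⟩ := exists_abs_greenForm_le M.nonneg hχ
  have hI := integrable_greenForm M.nonneg hχ h.memLp h.memLp_dt
  have hps : ∀ F, MemLp (M.partialSol φ0 φ1 F) 2 (volume.restrict (Ioo 0 T)) := fun F =>
    memLp_Ioo_of_continuous (M.continuous_partialSol φ0 φ1 F)
  have hpt : ∀ F, MemLp (M.partialSolt φ0 φ1 F) 2 (volume.restrict (Ioo 0 T)) := fun F =>
    memLp_Ioo_of_continuous (M.continuous_partialSolt φ0 φ1 F)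
  have e1 : ∀ F, inner ℝ (M.traceL2 φ0 φ1 T F) hX.toLp = ∫ t in Ioo 0 T,
      greenForm M.nonneg hχ t (M.partialSolt φ0 φ1 F t) (M.partialSol φ0 φ1 F t) := fun F => by
    rw [integral_Ioo_eq_interval hT.le, M.integral_greenForm_partialSol hχ φ0 φ1 hT.le, hin]
    refine integral_congr_ae ?_
    filter_upwards [M.traceL2_ae φ0 φ1 T F] with p hp
    rw [hp]
  simp only [e1]
  rw [tendsto_iff_norm_sub_tendsto_zero]
  have htail := M.tendsto_tailEnergy φ0 φ1
  have hlim : Filter.Tendsto (fun F => C * (Real.sqrt (M.tailEnergy φ0 φ1 F) +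
      Real.sqrt (2 * M.tailEnergy φ0 φ1 F)) * volume.real (Ioo 0 T)) Filter.atTop (nhds 0) := by
    have := ((htail.sqrt.add (htail.const_mul 2).sqrt).const_mul C).mul_const
      (volume.real (Ioo 0 T))
    simpa using this
  refine squeeze_zero (fun F => norm_nonneg _) (fun F => ?_) hlim
  rw [← integral_sub (integrable_greenForm M.nonneg hχ (hps F) (hpt F)) hI]
  refine norm_setIntegral_le_of_norm_le_const_ae measure_Ioo_lt_top ?_
  filter_upwards [M.norm_sub_partialSol_le hT h, ae_restrict_mem measurableSet_Ioo] with t ht htT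
  rw [greenForm_sub, Real.norm_eq_abs]
  refine (hC t (Ioo_subset_Icc_self htT) _ _).trans (mul_le_mul_of_nonneg_left ?_ hC0)
  rw [norm_sub_rev, norm_sub_rev (M.partialSol φ0 φ1 F t)]
  exact add_le_add (Real.le_sqrt_of_sq_le (ht F).2) (Real.le_sqrt_of_sq_le (ht F).1)

end ModeSystem

/-- The normal derivative is unique. -/
theorem IsNormalTrace.ae_eq {α T : ℝ} {f : ℝ → L2Dom} {φ : ℝ → H01 α} {φt : ℝ → L2Dom}
    {g g' : ℝ × ℝ → ℝ} (hg : IsNormalTrace α T f φ φt g) (hg' : IsNormalTrace α T f φ φt g') :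
    g =ᵐ[volume.restrict (Ioo 0 1 ×ˢ Ioo 0 T)] g' := by
  have hm : MeasurableSet (Ioo (0 : ℝ) 1 ×ˢ Ioo (0 : ℝ) T) :=
    measurableSet_Ioo.prod measurableSet_Ioo
  have hi : Integrable (fun p => g p - g' p) (volume.restrict (Ioo 0 1 ×ˢ Ioo 0 T)) :=
    (hg.memLp.sub hg'.memLp).integrable (by norm_num)
  have key := (isOpen_Ioo.prod isOpen_Ioo).ae_eq_zero_of_integral_contDiff_smul_eq_zero
    (U := Ioo (0 : ℝ) 1 ×ˢ Ioo (0 : ℝ) T) (f := fun p => g p - g' p) (μ := volume)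
    (IntegrableOn.locallyIntegrableOn hi) fun ψ h1 h2 h3 => ?_
  · rw [Filter.EventuallyEq, ae_restrict_iff' hm]
    filter_upwards [key] with p hp hpS
    exact sub_eq_zero.1 (hp hpS)
  -- A bump in r equal to 1 at r = 1 and supported in [1/2, 3/2] extends any test function ψ(θ, t)
  -- to an admissible χ with trace ψ.
  · let ρ : ContDiffBump (1 : ℝ) := ⟨1 / 4, 1 / 2, by norm_num, by norm_num⟩
    have hρ : ContDiff ℝ ∞ ρ := ρ.contDiff
    have hsub : tsupport (fun p : (ℝ × ℝ) × ℝ => ψ (p.1.1, p.2) * ρ p.1.2) ⊆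
        (fun p : (ℝ × ℝ) × ℝ => (p.1.1, p.2)) ⁻¹' tsupport ψ ∩
          (fun p : (ℝ × ℝ) × ℝ => p.1.2) ⁻¹' tsupport ρ := by
      refine closure_minimal (fun p hp => ?_) (((isClosed_tsupport ψ).preimage (by fun_prop)).inter
        ((isClosed_tsupport ρ).preimage (by fun_prop)))
      have := mul_ne_zero_iff.1 (Function.mem_support.1 hp)
      exact ⟨subset_tsupport _ this.1, subset_tsupport _ this.2⟩
    have hχ : IsTestFunction ((Ioo 0 1 ×ˢ Ioi 0) ×ˢ Ioo 0 T)
        (fun p : (ℝ × ℝ) × ℝ => ψ (p.1.1, p.2) * ρ p.1.2) := by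
      refine ⟨(h1.comp (by fun_prop)).mul (hρ.comp (by fun_prop)), ?_, fun p hp => ?_⟩
      · have hK : IsCompact ((fun q : (ℝ × ℝ) × ℝ => ((q.1.1, q.2), q.1.2)) ''
            (tsupport ψ ×ˢ tsupport ρ)) :=
          (h2.isCompact.prod ρ.hasCompactSupport.isCompact).image (by fun_prop)
        refine hK.of_isClosed_subset (isClosed_tsupport _) fun p hp => ?_
        exact ⟨((p.1.1, p.2), p.1.2), ⟨(hsub hp).1, (hsub hp).2⟩, rfl⟩
      · have h4 := h3 (hsub hp).1
        have h5 : p.1.2 ∈ tsupport ρ := (hsub hp).2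
        rw [ρ.tsupport_eq, Real.closedBall_eq_Icc] at h5
        have h6 : (1 : ℝ) - 1 / 2 ≤ p.1.2 := h5.1
        exact ⟨⟨h4.1, show (0 : ℝ) < p.1.2 by linarith⟩, h4.2⟩
    have hρ1 : ρ 1 = 1 := ρ.one_of_mem_closedBall (Metric.mem_closedBall_self ρ.rIn_pos.le)
    have e := (hg.green _ hχ).trans (hg'.green _ hχ).symm
    simp only [hρ1, mul_one] at e
    have hb : ∀ {u : ℝ × ℝ → ℝ}, MemLp u 2 (volume.restrict (Ioo 0 1 ×ˢ Ioo 0 T)) →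
        Integrable (fun p => u p * ψ p) (volume.restrict (Ioo 0 1 ×ˢ Ioo 0 T)) := fun hu =>
      hu.integrable_mul (memLp_side h1.continuous)
    rw [← setIntegral_eq_integral_of_forall_compl_eq_zero (s := Ioo (0 : ℝ) 1 ×ˢ Ioo (0 : ℝ) T)
      fun p hp => by rw [image_eq_zero_of_notMem_tsupport fun h => hp (h3 h), zero_smul]]
    have e2 := integral_sub (hb hg.memLp) (hb hg'.memLp)
    rw [sub_eq_zero.2 e] at e2
    refine Eq.trans (integral_congr_ae (Filter.Eventually.of_forall fun p => ?_)) e2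
    simp only [smul_eq_mul]
    ring

/-! ### The observability inequality -/

/-- The parallelogram identity for V ± (U - V), dropping one nonnegative term. -/
theorem wForm_strip_le_two_mul (δ : ℝ) (U V : L2Dom) : wForm (stripWeight δ) U U ≤
    2 * wForm (stripWeight δ) V V + 2 * ‖U - V‖ ^ 2 := by
  have h := isWeight_strip δ
  have h1 := wForm_strip_nonneg δ (V - (U - V))
  have h2 := (le_abs_self _).trans (h.abs_wForm_le (U - V) (U - V))
  simp only [← wFormL_apply h, map_sub, _root_.sub_apply] at h1 h2 ⊢
  linarith

theorem IsWeight.integrable_wForm {m : ℝ × ℝ → ℝ} {C T : ℝ} (hm : IsWeight m C) {U : ℝ → L2Dom}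
    (hU : MemLp U 2 (volume.restrict (Ioo 0 T))) :
    IntegrableOn (fun t => wForm m (U t) (U t)) (Ioo 0 T) := by
  refine Integrable.mono' ((hU.integrable_norm_pow (by norm_num)).const_mul C) ?_ ?_
  · exact (hm.continuous_wForm continuous_id continuous_id).comp_aestronglyMeasurable hU.1
  · refine Filter.Eventually.of_forall fun t => (hm.abs_wForm_le (U t) (U t)).trans_eq ?_
    ring

theorem MemLp.clm_comp {X Y : Type*} [NormedAddCommGroup X] [NormedSpace ℝ X]
    [NormedAddCommGroup Y] [NormedSpace ℝ Y] (L : X →L[ℝ] Y) {f : ℝ → X} {μ : Measure ℝ}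
    (hf : MemLp f 2 μ) : MemLp (fun t => L (f t)) 2 μ := L.comp_memLp' hf

theorem strip_subset_Dom {δ : ℝ} (hδ : δ ∈ Ioo (0 : ℝ) (1 / 32)) : strip δ ⊆ Dom := by
  refine prod_mono (union_subset ?_ ?_) le_rfl
  · exact Ioo_subset_Ioo_right (by linarith [hδ.2])
  · exact Ioo_subset_Ioo_left (by linarith [hδ.2])

theorem wForm_strip_eq {δ : ℝ} (hδ : δ ∈ Ioo (0 : ℝ) (1 / 32)) (U : L2Dom) :
    wForm (stripWeight δ) U U = ∫ z in strip δ, U z ^ 2 := by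
  have hsub := strip_subset_Dom hδ
  rw [wForm, ← integral_indicator (measurableSet_strip δ),
    ← integral_indicator measurableSet_Dom]
  congr 1
  ext z
  by_cases hz : z ∈ strip δ
  · rw [indicator_of_mem (hsub hz), indicator_of_mem hz, stripWeight, indicator_of_mem hz, one_mul,
      sq]
  · by_cases hzD : z ∈ Dom
    · rw [indicator_of_mem hzD, indicator_of_notMem hz, stripWeight, indicator_of_notMem hz,
        zero_mul]
    · rw [indicator_of_notMem hzD, indicator_of_notMem hz]

section

variable {α δ T : ℝ} {φ : ℝ → H01 α} {φt : ℝ → L2Dom}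

theorem integrable_stripForm (hφ : MemLp φ 2 (volume.restrict (Ioo 0 T)))
    (hφt : MemLp φt 2 (volume.restrict (Ioo 0 T))) :
    IntegrableOn (fun t => stripForm δ (φt t) (φ t)) (Ioo 0 T) :=
  (((isWeight_strip δ).integrable_wForm hφt).add
    ((isWeight_strip δ).integrable_wForm (MemLp.clm_comp (H01.dTheta α) hφ))).add
    ((isWeight_strip δ).integrable_wForm (MemLp.clm_comp (H01.wdR α) hφ))

/-- The multiplier argument needs no φ² on the strip; that part of the interior term is simply
discarded. -/
theorem integral_stripForm_le (hδ : δ ∈ Ioo (0 : ℝ) (1 / 32))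
    (hφ : MemLp φ 2 (volume.restrict (Ioo 0 T))) (hφt : MemLp φt 2 (volume.restrict (Ioo 0 T))) :
    ∫ t in Ioo 0 T, stripForm δ (φt t) (φ t) ≤ interiorTerm δ T φ φt := by
  have hsub := strip_subset_Dom hδ
  have hi : ∀ U : L2Dom, IntegrableOn (fun z => U z ^ 2) (strip δ) := fun U =>
    ((Lp.memLp U).integrable_sq).mono_measure (Measure.restrict_mono hsub le_rfl)
  have e : ∀ t, ∫ z in strip δ, (φt t z ^ 2 + (H01.dTheta α (φ t) z ^ 2 +
      H01.wdR α (φ t) z ^ 2) + H01.val α (φ t) z ^ 2) =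
      stripForm δ (φt t) (φ t) + wForm (stripWeight δ) (H01.val α (φ t)) (H01.val α (φ t)) :=
    fun t => by
    rw [stripForm, wForm_strip_eq hδ, wForm_strip_eq hδ, wForm_strip_eq hδ, wForm_strip_eq hδ,
      integral_add ((hi _).fun_add ((hi _).fun_add (hi _))) (hi _),
      integral_add (hi _) ((hi _).fun_add (hi _)), integral_add (hi _) (hi _)]
    ring
  simp only [interiorTerm, e]
  refine integral_mono (integrable_stripForm hφ hφt) ((integrable_stripForm hφ hφt).add
    ((isWeight_strip δ).integrable_wForm (MemLp.clm_comp (H01.val α) hφ))) fun t => ?_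
  exact le_add_of_nonneg_right (wForm_strip_nonneg δ _)

end

namespace ModeSystem

variable {α : ℝ} {ι : Type} (M : ModeSystem α ι)

/-- The constant 6 is twice the sum of the error bounds: one tail energy for the velocity and two
for the H₀¹ part. -/
theorem integral_stripForm_partialSol_le [Countable ι] {δ T : ℝ} (hT : 0 < T) {φ0 : H01 α}
    {φ1 : L2Dom} {φ : ℝ → H01 α} {φt : ℝ → L2Dom} {φtt : ℝ → Hneg1 α}
    (h : IsWeakSolution α T φ0 φ1 (fun _ => 0) φ φt φtt) (F : Finset ι) :
    ∫ t in (0 : ℝ)..T, stripForm δ (M.partialSolt φ0 φ1 F t) (M.partialSol φ0 φ1 F t) ≤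
      2 * (∫ t in Ioo 0 T, stripForm δ (φt t) (φ t)) + T * (6 * M.tailEnergy φ0 φ1 F) := by
  have hI := integrable_stripForm (δ := δ) h.memLp h.memLp_dt
  have hc : IntegrableOn (fun _ : ℝ => 6 * M.tailEnergy φ0 φ1 F) (Ioo 0 T) :=
    integrableOn_const measure_Ioo_lt_top.ne
  have e : T * (6 * M.tailEnergy φ0 φ1 F) = ∫ _t in Ioo 0 T, 6 * M.tailEnergy φ0 φ1 F := by
    rw [setIntegral_const, Real.volume_real_Ioo_of_le hT.le, sub_zero, smul_eq_mul]
  rw [← integral_Ioo_eq_interval hT.le, e, ← integral_const_mul,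
    ← integral_add (hI.const_mul 2) hc]
  refine integral_mono_ae (integrable_stripForm
    (memLp_Ioo_of_continuous (M.continuous_partialSol φ0 φ1 F))
    (memLp_Ioo_of_continuous (M.continuous_partialSolt φ0 φ1 F))) ((hI.const_mul 2).add hc) ?_
  filter_upwards [M.norm_sub_partialSol_le hT h] with t ht
  obtain ⟨h1, h2⟩ := ht F
  rw [norm_sub_rev, H01.norm_sq_eq] at h1
  rw [norm_sub_rev] at h2
  simp only [map_sub] at h1
  have k1 := wForm_strip_le_two_mul δ (M.partialSolt φ0 φ1 F t) (φt t)
  have k2 := wForm_strip_le_two_mul δ (H01.dTheta α (M.partialSol φ0 φ1 F t))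
    (H01.dTheta α (φ t))
  have k3 := wForm_strip_le_two_mul δ (H01.wdR α (M.partialSol φ0 φ1 F t)) (H01.wdR α (φ t))
  simp only [stripForm]
  nlinarith [sq_nonneg ‖H01.val α (M.partialSol φ0 φ1 F t) - H01.val α (φ t)‖]

theorem integral_partialTrace_sq_sub_le {δ T : ℝ} (hδ : 0 ≤ δ) (φ0 : H01 α) (φ1 : L2Dom)
    (F : Finset ι) (g : L2Side T) :
    ∫ p in Ioo δ (1 - δ) ×ˢ Ioo 0 T, M.partialTrace φ0 φ1 F p.2 p.1 ^ 2 ≤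
      2 * (∫ p in Ioo δ (1 - δ) ×ˢ Ioo 0 T, g p ^ 2) + 2 * ‖M.traceL2 φ0 φ1 T F - g‖ ^ 2 := by
  have hsub : Ioo δ (1 - δ) ×ˢ Ioo 0 T ⊆ Ioo 0 1 ×ˢ Ioo 0 T :=
    prod_mono (Ioo_subset_Ioo hδ (by linarith)) le_rfl
  have hmono : volume.restrict (Ioo δ (1 - δ) ×ˢ Ioo 0 T) ≤
    volume.restrict (Ioo (0 : ℝ) 1 ×ˢ Ioo (0 : ℝ) T) := Measure.restrict_mono hsub le_rfl
  have hi : ∀ G : L2Side T, Integrable (fun p => G p ^ 2)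
    (volume.restrict (Ioo 0 1 ×ˢ Ioo 0 T)) := fun G => (Lp.memLp G).integrable_sq
  have hn : ∫ p in Ioo δ (1 - δ) ×ˢ Ioo 0 T, (M.traceL2 φ0 φ1 T F - g : L2Side T) p ^ 2 ≤
      ‖M.traceL2 φ0 φ1 T F - g‖ ^ 2 := by
    rw [← real_inner_self_eq_norm_sq, L2.inner_def]
    simp only [real_inner_self_eq_norm_sq, Real.norm_eq_abs, sq_abs]
    exact setIntegral_mono_set (hi _) (Filter.Eventually.of_forall fun p => sq_nonneg _)
      hsub.eventuallyLE
  refine le_trans ?_ (add_le_add_right (mul_le_mul_of_nonneg_left hn zero_le_two) _)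
  rw [← integral_const_mul, ← integral_const_mul, ← integral_add
    (((hi _).mono_measure hmono).const_mul _) (((hi _).mono_measure hmono).const_mul _)]
  have htr := ae_mono hmono (M.traceL2_ae φ0 φ1 T F)
  refine integral_mono_ae (((hi (M.traceL2 φ0 φ1 T F)).mono_measure hmono).congr ?_)
    ((((hi _).mono_measure hmono).const_mul _).add (((hi _).mono_measure hmono).const_mul _)) ?_
  · filter_upwards [htr] with p hp
    rw [hp]
  · filter_upwards [htr, ae_mono hmono (Lp.coeFn_sub (M.traceL2 φ0 φ1 T F) g)] with p h1 h2
    simp only [h2, Pi.sub_apply, h1]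
    nlinarith [sq_nonneg (M.partialTrace φ0 φ1 F p.2 p.1 - 2 * g p)]

/-- The observability inequality, in terms of the limit of the normal derivatives. -/
theorem exists_observability [Countable ι] {δ T : ℝ} (hδ : δ ∈ Ioo (0 : ℝ) (1 / 32))
    (hT : 10 ≤ T) : ∃ K, 0 ≤ K ∧ ∀ {φ0 : H01 α} {φ1 : L2Dom} {φ : ℝ → H01 α} {φt : ℝ → L2Dom}
      {φtt : ℝ → Hneg1 α} {g : L2Side T},
      IsWeakSolution α T φ0 φ1 (fun _ => 0) φ φt φtt →
      Filter.Tendsto (M.traceL2 φ0 φ1 T) Filter.atTop (nhds g) →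
      energy φ0 φ1 ≤ (∫ p in Ioo δ (1 - δ) ×ˢ Ioo 0 T, g p ^ 2) + K * interiorTerm δ T φ φt := by
  obtain ⟨K, hK0, hK⟩ := M.observability_partialSol hδ hT
  have hT0 : 0 < T := by linarith
  refine ⟨K, hK0, fun {φ0 φ1 φ φt φtt g} h hg => ?_⟩
  have htail := M.tendsto_tailEnergy φ0 φ1
  have hnorm := (tendsto_iff_norm_sub_tendsto_zero.1 hg).pow 2
  have hR : Filter.Tendsto (fun F => 2 * (∫ p in Ioo δ (1 - δ) ×ˢ Ioo 0 T, g p ^ 2) +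
      2 * ‖M.traceL2 φ0 φ1 T F - g‖ ^ 2 + K * (2 * interiorTerm δ T φ φt +
        T * (6 * M.tailEnergy φ0 φ1 F))) Filter.atTop
      (nhds (2 * (∫ p in Ioo δ (1 - δ) ×ˢ Ioo 0 T, g p ^ 2) + 2 * 0 ^ 2 +
        K * (2 * interiorTerm δ T φ φt + T * (6 * 0)))) :=
    (tendsto_const_nhds.add (hnorm.const_mul 2)).add
      ((tendsto_const_nhds.add ((htail.const_mul 6).const_mul T)).const_mul K)
  -- The mode energies sum to twice the energy, which cancels the factor 2 lost in comparing the
  -- partial sums with the solution.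
  have hle := le_of_tendsto_of_tendsto' (M.hasSum_modeEnergy φ0 φ1) hR fun F => by
    have h1 := hK φ0 φ1 F
    have h2 := M.integral_partialTrace_sq_sub_le hδ.1.le φ0 φ1 F g
    have h3 := M.integral_stripForm_partialSol_le (δ := δ) hT0 h F
    have h4 := integral_stripForm_le hδ h.memLp h.memLp_dt
    have h5 := mul_le_mul_of_nonneg_left (h3.trans
      (add_le_add_left (mul_le_mul_of_nonneg_left h4 zero_le_two) _)) hK0
    linarith
  linarith

end ModeSystem

theorem interiorTerm_nonneg {α : ℝ} (δ T : ℝ) (φ : ℝ → H01 α) (φt : ℝ → L2Dom) :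
    0 ≤ interiorTerm δ T φ φt :=
  integral_nonneg fun _ => integral_nonneg fun _ => by positivity

/-- The observation time exceeds the time needed by the multiplier argument. -/
theorem ten_le_of_rpow_lt {δ T : ℝ} (hδ : δ ∈ Ioo (0 : ℝ) (1 / 32))
    (hT : 4 * δ ^ (-(1 / 2) : ℝ) < T) : 10 ≤ T := by
  have h1 : (1 / 32 : ℝ) ^ (-(1 / 2) : ℝ) ≤ δ ^ (-(1 / 2) : ℝ) :=
    Real.rpow_le_rpow_of_nonpos hδ.1 hδ.2.le (by norm_num)
  -- The right side is √32 > 5, so T even exceeds 20.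
  have h2 : (5 : ℝ) ≤ (1 / 32 : ℝ) ^ (-(1 / 2) : ℝ) := by
    rw [Real.rpow_neg (by norm_num), ← Real.sqrt_eq_rpow, one_div, Real.sqrt_inv, inv_inv]
    exact Real.le_sqrt_of_sq_le (by norm_num)
  linarith

end DegenerateWave

end

theorem theorem04p05 (α δ₀ β T : ℝ) (hα : α ∈ Ioo (0 : ℝ) 1) (hδ₀ : δ₀ ∈ Ioo (0 : ℝ) (1 / 32))
    (hβ : β ∈ Ioo (0 : ℝ) (1 / 2 * min (1 / 8 * (2 - α) ^ 2) δ₀))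
    (hT : max (4 * δ₀ ^ (-(1 / 2) : ℝ)) (Real.sqrt (8 / β)) < T) :
    ∃ C : ℝ, 0 < C ∧
      ∀ (φ0 : H01 α) (φ1 : L2Dom) (φ : ℝ → H01 α) (φt : ℝ → L2Dom) (φtt : ℝ → Hneg1 α),
        IsWeakSolution α T φ0 φ1 (fun _ => 0) φ φt φtt →
          (∃ g : ℝ × ℝ → ℝ, IsNormalTrace α T (fun _ => 0) φ φt g) ∧
          ∀ g : ℝ × ℝ → ℝ, IsNormalTrace α T (fun _ => 0) φ φt g →
            energy φ0 φ1 ≤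
              C * (∫ p in Ioo δ₀ (1 - δ₀) ×ˢ Ioo 0 T, g p ^ 2) +
                C * interiorTerm δ₀ T φ φt := by
  obtain ⟨ι, _, ⟨M⟩⟩ := exists_modeSystem hα.1.le hα.2
  have hT10 : 10 ≤ T := ten_le_of_rpow_lt hδ₀ ((le_max_left _ _).trans_lt hT)
  obtain ⟨K, hK0, hK⟩ := M.exists_observability hδ₀ hT10
  -- The boundary term needs the constant 1 and the interior term K; the sum serves for both because
  -- both terms are nonnegative.
  refine ⟨1 + K, by linarith, fun φ0 φ1 φ φt φtt h => ?_⟩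
  obtain ⟨g₀, hg₀⟩ := M.exists_tendsto_traceL2 φ0 φ1 (by linarith : (0 : ℝ) ≤ T)
  have htr := M.isNormalTrace_of_tendsto (by linarith) h hg₀
  refine ⟨⟨g₀, htr⟩, fun g hg => ?_⟩
  have hsub : Ioo δ₀ (1 - δ₀) ×ˢ Ioo 0 T ⊆ Ioo 0 1 ×ˢ Ioo 0 T :=
    prod_mono (Ioo_subset_Ioo hδ₀.1.le (by linarith [hδ₀.1])) le_rfl
  -- Uniqueness of the trace transfers the inequality from the constructed limit to an arbitrary
  -- trace g.
  have he : ∫ p in Ioo δ₀ (1 - δ₀) ×ˢ Ioo 0 T, g p ^ 2 =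
      ∫ p in Ioo δ₀ (1 - δ₀) ×ˢ Ioo 0 T, g₀ p ^ 2 := by
    refine integral_congr_ae ?_
    filter_upwards [ae_mono (Measure.restrict_mono hsub le_rfl) (hg.ae_eq htr)] with p hp
    rw [hp]
  have h1 : 0 ≤ ∫ p in Ioo δ₀ (1 - δ₀) ×ˢ Ioo 0 T, g₀ p ^ 2 :=
    integral_nonneg fun _ => sq_nonneg _
  have h2 := interiorTerm_nonneg δ₀ T φ φt
  have h3 := mul_nonneg hK0 h1
  rw [he]
  linarith [hK h hg₀]
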